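/- All graphs are finite and simple. A graph is Hamiltonian if it contains a spanning cycle. **Families.** For $r\ge 1$ and an even integer $t$ with $2\le t\le 2r-2$, let $F_{r,t}$ denote any graph on $2r+2$ vertices with one vertex of degree $t$ and the remaining $2r+1$ vertices of degree $2r$, and let $F'_{r,t}$ denote any graph on $2r+1$ vertices with $t+1$ vertices of degree $2r$ and $2r-t$ vertices of degree $2r-1$. Let $\mathcal F_r$ be the family of all graphs (up to isomorphism) obtained, for some such $t$, from the disjoint union of an $F_{r,t}$ and an $F'_{r,t}$ by adding edges from the vertex of degree $t$ in $F_{r,t}$ to the $2r-t$ vertices of degree $2r-1$ in $F'_{r,t}$ (so $\mathcal F_1=\varnothing$). For $r\ge 1$ and an even integer $t$ with $2\le t\le 2r$, let $H_{r,t}$ denote any graph on $2r+3$ vertices with one vertex of degree $t$ and the remaining $2r+2$ vertices of degree $2r+1$, and let $H'_{r,t}$ denote any graph on $2r+3$ vertices with $t+2$ vertices of degree $2r+1$ and $2r+1-t$ vertices of degree $2r$. Let $\mathcal H_r$ be the family of all graphs (up to isomorphism) obtained, for some such $t$, from the disjoint union of an $H_{r,t}$ and an $H'_{r,t}$ by adding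 edges from the vertex of degree $t$ in $H_{r,t}$ to the $2r+1-t$ vertices of degree $2r$ in $H'_{r,t}$. **Theorem.** 1. Let $k\ge 2$. Every connected $k$-regular graph on at most $2k+2$ vertices is Hamiltonian. 2. Let $k=2r$ with $r\ge 1$. A graph $G$ is a connected, $k$-regular, non-Hamiltonian graph on $2k+3$ vertices if and only if $G\in\mathcal F_r$. 3. Let $k=2r+1$ with $r\ge 1$. A graph $G$ is a connected, $k$-regular, non-Hamiltonian graph on $2k+4$ vertices if and only if $G\in\mathcal H_r$ or $k=3$ and $G$ is isomorphic to the Petersen graph. 4. For $r\ge 2$ and every even $t$ with $2\le t\le 2r-2$, graphs $F_{r,t}$ and $F'_{r,t}$ exist; for $r\ge 1$ and every even $t$ with $2\le t\le 2r$, graphs $H_{r,t}$ and $H'_{r,t}$ exist. 5. Consequently, the minimum number of vertices of a connected $k$-regular non-Hamiltonian graph is $2k+3$ for even $k\ge 4$ and $2k+4$ for odd $k\ge 3$. -/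

import Mathlib

universe u

/-- The graph obtained from the disjoint union of `A` and `B` by adding all edges
from the vertex `a` of `A` to the vertices of `B` that lie in `S`. -/
def attach {α β : Type*} (A : SimpleGraph α) (a : α) (B : SimpleGraph β) (S : Set β) :
    SimpleGraph (α ⊕ β) where
  Adj
    | Sum.inl x, Sum.inl y => A.Adj x y
    | Sum.inr x, Sum.inr y => B.Adj x y
    | Sum.inl x, Sum.inr y => x = a ∧ y ∈ S
    | Sum.inr y, Sum.inl x => x = a ∧ y ∈ S
  symm := ⟨by
    rintro (x | x) (y | y) h
    · exact SimpleGraph.Adj.symm h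
    · exact h
    · exact h
    · exact SimpleGraph.Adj.symm h⟩
  loopless := ⟨by
    rintro (x | x) h
    · exact A.irrefl h
    · exact B.irrefl h⟩

open Classical in
/-- `A`, with distinguished vertex `a`, is a graph `F_{r,t}`: it has `2r+2` vertices, the vertex `a`
has degree `t`, and the remaining `2r+1` vertices have degree `2r`. -/
def IsF (r t : ℕ) (A : SimpleGraph (Fin (2 * r + 2))) (a : Fin (2 * r + 2)) : Prop :=
  A.degree a = t ∧ ∀ x, x ≠ a → A.degree x = 2 * r

open Classical in
/-- `B` is a graph `F'_{r,t}`: it has `2r+1` vertices, `t+1` of them of degree `2r` and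
`2r-t` of them of degree `2r-1`. -/
def IsF' (r t : ℕ) (B : SimpleGraph (Fin (2 * r + 1))) : Prop :=
  (Finset.univ.filter fun x => B.degree x = 2 * r).card = t + 1 ∧
  (Finset.univ.filter fun x => B.degree x = 2 * r - 1).card = 2 * r - t

open Classical in
/-- `G` belongs (up to isomorphism) to the family `𝓕_r`: for some even `t` with `2 ≤ t ≤ 2r-2`,
it arises from some `F_{r,t}` and some `F'_{r,t}` by joining the vertex of degree `t` of the former
to all vertices of degree `2r-1` of the latter. -/
def InFamilyF (r : ℕ) {V : Type*} (G : SimpleGraph V) : Prop :=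
  ∃ t : ℕ, Even t ∧ 2 ≤ t ∧ t ≤ 2 * r - 2 ∧
    ∃ (A : SimpleGraph (Fin (2 * r + 2))) (a : Fin (2 * r + 2)) (B : SimpleGraph (Fin (2 * r + 1))),
      IsF r t A a ∧ IsF' r t B ∧
        Nonempty (G ≃g attach A a B {y | B.degree y = 2 * r - 1})

open Classical in
/-- `A`, with distinguished vertex `a`, is a graph `H_{r,t}`: it has `2r+3` vertices, the vertex `a`
has degree `t`, and the remaining `2r+2` vertices have degree `2r+1`. -/
def IsH (r t : ℕ) (A : SimpleGraph (Fin (2 * r + 3))) (a : Fin (2 * r + 3)) : Prop :=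
  A.degree a = t ∧ ∀ x, x ≠ a → A.degree x = 2 * r + 1

open Classical in
/-- `B` is a graph `H'_{r,t}`: it has `2r+3` vertices, `t+2` of them of degree `2r+1` and
`2r+1-t` of them of degree `2r`. -/
def IsH' (r t : ℕ) (B : SimpleGraph (Fin (2 * r + 3))) : Prop :=
  (Finset.univ.filter fun x => B.degree x = 2 * r + 1).card = t + 2 ∧
  (Finset.univ.filter fun x => B.degree x = 2 * r).card = 2 * r + 1 - t

open Classical in
/-- `G` belongs (up to isomorphism) to the family `𝓗_r`: for some even `t` with `2 ≤ t ≤ 2r`,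
it arises from some `H_{r,t}` and some `H'_{r,t}` by joining the vertex of degree `t` of the former
to all vertices of degree `2r` of the latter. -/
def InFamilyH (r : ℕ) {V : Type*} (G : SimpleGraph V) : Prop :=
  ∃ t : ℕ, Even t ∧ 2 ≤ t ∧ t ≤ 2 * r ∧
    ∃ (A : SimpleGraph (Fin (2 * r + 3))) (a : Fin (2 * r + 3)) (B : SimpleGraph (Fin (2 * r + 3))),
      IsH r t A a ∧ IsH' r t B ∧
        Nonempty (G ≃g attach A a B {y | B.degree y = 2 * r})

/-- The Petersen graph: the vertices are the 2-element subsets of a 5-element set, adjacent when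
disjoint. -/
def petersen : SimpleGraph {s : Finset (Fin 5) // s.card = 2} where
  Adj s t := Disjoint s.1 t.1
  symm := ⟨fun _ _ h => h.symm⟩
  loopless := ⟨fun s h => by
    have h0 : s.1 = ∅ := disjoint_self.mp h
    have h2 := s.2
    simp [h0] at h2⟩

/-- The orders of the connected `k`-regular graphs that are not Hamiltonian. -/
def nonHamiltonianOrders (k : ℕ) : Set ℕ :=
  {n | ∃ (G : SimpleGraph (Fin n)) (_ : DecidableRel G.Adj),
    G.Connected ∧ G.IsRegularOfDegree k ∧ ¬ G.IsHamiltonian}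

/-! Let `G` be connected, `k`-regular and non-Hamiltonian on `n ≤ 2k+4` vertices. The argument
splits according to whether `G` has a cut vertex.

With a cut vertex `v`, each side of the separation has more than `k` vertices
(`Separation.lt_card`), so `n ≥ 2k+3`, and for `n ∈ {2k+3, 2k+4}` the sizes of the two sides are
forced. The handshake lemma on one side (`Separation.even_add`) makes the number `t` of edges from
`v` to that side even, and the graph is cut at `v` into the two pieces that define the families.
Conversely, members of the families are connected and regular, and the attaching vertex is a cut
vertex (`attach_spec`).

Without a cut vertex, only the Petersen graph survives (`nonempty_iso_petersen_of_noCutVertex`). A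
longest path with far-reaching end neighbours yields a cycle of length at least `2k`
(`exists_long_cycle`). Among all longest cycles, of length `c`, take one whose complement contains a
path `Q` with as many vertices as possible, say `p + 1`. The neighbours on the cycle of the two ends
of `Q` (their feet) must be far apart, since `Q` could otherwise be used as a detour. As only a few
vertices lie off the cycle, counting gaps forces `p = 0` (`MaxCycle.eq_zero_of_four_le`,
`MaxCycle.eq_zero_of_eq_three`). Hence the vertices off the cycle are independent.

Let `v` be one of them. Then `v` and the successors of its `k` feet form an independent set of size
`k + 1`. If `d` of the gaps between consecutive feet are longer than two, counting edges in the
complement of this set gives `d ≥ 1` and `2d(k-d) ≤ k(n-2k-2)`. Therefore `n = 2k+4`, and `d = 1`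
when `k ≥ 5`. In the latter case `v` alone is off the cycle, one gap has length five, and two chords
leaving that gap complete a Hamiltonian cycle (`MaxCycle.false_of_five_le`). Order `2k+4` is
considered for odd `k` only, so `k = 3` and `n = 10` remain. There the cycle has length nine, and
every chord pattern except that of the Petersen graph closes up to a Hamiltonian cycle. -/

set_option linter.unusedSectionVars false

/-! ### Paths and cycles as lists of vertices -/

/-- The list `l` is a chain of adjacent vertices from `u` to `w`. -/
def Trace {V : Type*} (G : SimpleGraph V) (u w : V) (l : List V) : Prop :=
  l.IsChain G.Adj ∧ l.head? = some u ∧ l.getLast? = some w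

/-- The list `l` enumerates the vertices of a cycle. -/
def CyclicList {V : Type*} (G : SimpleGraph V) (l : List V) : Prop :=
  3 ≤ l.length ∧ l.Nodup ∧ ∃ u w, Trace G u w l ∧ G.Adj w u

/-- The segment `g a, g (a+1), …, g b`. -/
def seg {V : Type*} (g : ℕ → V) (a b : ℕ) : List V := (List.range' a (b + 1 - a)).map g

/-- The function `f` enumerates a cycle of length `c` cyclically. -/
def CycFun {V : Type*} (G : SimpleGraph V) {c : ℕ} (f : ZMod c → V) : Prop :=
  Function.Injective f ∧ ∀ i, G.Adj (f i) (f (i + 1))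

section Lists

variable {V : Type*} {G : SimpleGraph V}

theorem Trace.single (u : V) : Trace G u u [u] := ⟨by simp, by simp, by simp⟩

theorem Trace.append {u w u' w' : V} {l l' : List V} (h : Trace G u w l) (h' : Trace G u' w' l')
    (ha : G.Adj w u') : Trace G u w' (l ++ l') := by
  obtain ⟨h1, h2, h3⟩ := h
  obtain ⟨h1', h2', h3'⟩ := h'
  refine ⟨?_, ?_, ?_⟩
  · refine h1.append h1' ?_
    intro x hx y hy
    rw [h3] at hx
    rw [h2'] at hy
    simp only [Option.mem_def, Option.some.injEq] at hx hy
    subst hx; subst hy; exact ha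
  · simp [List.head?_append, h2]
  · simp [List.getLast?_append, h3']

theorem Trace.reverse {u w : V} {l : List V} (h : Trace G u w l) : Trace G w u l.reverse := by
  obtain ⟨h1, h2, h3⟩ := h
  refine ⟨?_, by simpa using h3, by simpa using h2⟩
  rw [List.isChain_reverse]
  exact h1.imp fun _ _ h => h.symm

theorem Trace.left_mem {u w : V} {l : List V} (h : Trace G u w l) : u ∈ l :=
  List.mem_of_mem_head? h.2.1

theorem Trace.right_mem {u w : V} {l : List V} (h : Trace G u w l) : w ∈ l :=
  List.mem_of_getLast? h.2.2

theorem Trace.cons {x u w : V} {l : List V} (h : Trace G u w l) (ha : G.Adj x u) :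
    Trace G x w (x :: l) := by
  simpa using (Trace.single x).append h ha

theorem mem_seg {g : ℕ → V} {a b : ℕ} {x : V} : x ∈ seg g a b ↔ ∃ i, a ≤ i ∧ i ≤ b ∧ g i = x := by
  simp only [seg, List.mem_map, List.mem_range'_1]
  constructor
  · rintro ⟨i, ⟨h1, h2⟩, rfl⟩; exact ⟨i, h1, by omega, rfl⟩
  · rintro ⟨i, h1, h2, rfl⟩; exact ⟨i, ⟨h1, by omega⟩, rfl⟩

@[simp] theorem length_seg (g : ℕ → V) (a b : ℕ) : (seg g a b).length = b + 1 - a := by simp [seg]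

theorem nodup_seg {g : ℕ → V} {a b : ℕ}
    (h : ∀ i j, a ≤ i → i ≤ b → a ≤ j → j ≤ b → g i = g j → i = j) : (seg g a b).Nodup := by
  refine List.Nodup.map_on ?_ (List.nodup_range')
  intro i hi j hj
  simp only [List.mem_range'_1] at hi hj
  exact h i j hi.1 (by omega) hj.1 (by omega)

theorem trace_seg {g : ℕ → V} {a b : ℕ} (hab : a ≤ b)
    (h : ∀ i, a ≤ i → i < b → G.Adj (g i) (g (i + 1))) : Trace G (g a) (g b) (seg g a b) := by
  induction b, hab using Nat.le_induction with
  | base => simpa [seg] using Trace.single (G := G) (g a)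
  | succ b hb ih =>
    have h1 : seg g a (b + 1) = seg g a b ++ [g (b + 1)] := by
      have : b + 1 + 1 - a = (b + 1 - a) + 1 := by omega
      simp only [seg, this, List.range'_1_concat, List.map_append, List.map_cons, List.map_nil]
      congr 3; omega
    rw [h1]
    exact (ih fun i h1 h2 => h i h1 (by omega)).append (Trace.single _) (h b hb (by omega))

theorem Trace.exists_walk {u w : V} {l : List V} (h : Trace G u w l) :
    ∃ p : G.Walk u w, p.support = l := by
  induction l generalizing u with
  | nil => simpa using h.2.1
  | cons a l ih =>
    obtain ⟨h1, h2, h3⟩ := h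
    simp only [List.head?_cons, Option.some.injEq] at h2
    subst h2
    cases l with
    | nil =>
      simp only [List.getLast?_singleton, Option.some.injEq] at h3
      subst h3
      exact ⟨.nil, by simp⟩
    | cons b l =>
      obtain ⟨p, hp⟩ := ih (u := b) ⟨h1.tail, rfl, by simpa using h3⟩
      have hab : G.Adj a b := by
        simp only [List.isChain_cons_cons] at h1; exact h1.1
      exact ⟨.cons hab p, by simp [hp]⟩

theorem CyclicList.isHamiltonian [Fintype V] [DecidableEq V] {l : List V} (h : CyclicList G l)
    (hl : l.length = Fintype.card V) : G.IsHamiltonian := by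
  intro _
  obtain ⟨h3, hn, u, w, ht, ha⟩ := h
  obtain ⟨p, hp⟩ := ht.exists_walk
  have hpath : p.IsPath := by rw [SimpleGraph.Walk.isPath_def, hp]; exact hn
  have hlen : p.length + 1 = l.length := by rw [← hp, SimpleGraph.Walk.length_support]
  refine ⟨w, .cons ha p, ?_⟩
  rw [SimpleGraph.Walk.isHamiltonianCycle_iff_isCycle_and_length_eq]
  refine ⟨?_, by simp; omega⟩
  rw [SimpleGraph.Walk.cons_isCycle_iff]
  refine ⟨hpath, fun hmem => ?_⟩
  cases p with
  | nil => simp at hlen; omega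
  | cons hadj q =>
    rename_i x
    rw [SimpleGraph.Walk.edges_cons, List.mem_cons] at hmem
    rw [SimpleGraph.Walk.cons_isPath_iff] at hpath
    rcases hmem with hmem | hmem
    · have hxw : x = w := by
        rw [Sym2.eq_iff] at hmem
        rcases hmem with ⟨h1, h2⟩ | ⟨h1, _⟩
        · exact absurd h1 ha.ne
        · exact h1.symm
      subst hxw
      have := (SimpleGraph.Walk.isPath_iff_nil.1 hpath.1).length_eq_zero
      simp [this] at hlen; omega
    · exact hpath.2 (SimpleGraph.Walk.snd_mem_support_of_mem_edges _ hmem)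

/-- Indexing by `ZMod c` makes rotations and reflections of a cycle available, so that exchange
arguments can be carried out with a chosen vertex at index `0`. The values at natural indices are
recorded for `swap_zero`, which needs to know the new cycle position by position. -/
theorem CyclicList.exists_cycFun {l : List V} (h : CyclicList G l) {c : ℕ} (hc : l.length = c) :
    ∃ f : ZMod c → V, CycFun G f ∧ ∀ t (ht : t < l.length), f (t : ZMod c) = l[t] := by
  obtain ⟨h3, hn, u, w, ⟨hch, hu, hw⟩, ha⟩ := h
  have : NeZero c := ⟨by omega⟩
  have hlt : ∀ i : ZMod c, i.val < l.length := fun i => by rw [hc]; exact ZMod.val_lt i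
  have hval : ∀ t (ht : t < l.length) (h : (t : ZMod c).val < l.length),
      l[(t : ZMod c).val] = l[t] := by
    intro t ht h
    congr 1
    rw [ZMod.val_natCast, Nat.mod_eq_of_lt (by omega)]
  refine ⟨fun i => l[i.val]'(hlt i), ⟨?_, ?_⟩, fun t ht => hval t ht _⟩
  · intro i j hij
    have := (List.Nodup.getElem_inj_iff hn).1 hij
    exact ZMod.val_injective c this
  · intro i
    have hi := hlt i
    by_cases hlast : i.val + 1 < l.length
    · have hv : (i + 1).val = i.val + 1 := by
        have : Fact (1 < c) := ⟨by omega⟩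
        rw [ZMod.val_add, ZMod.val_one, Nat.mod_eq_of_lt (by omega)]
      have := List.isChain_iff_getElem.1 hch i.val hlast
      simpa [hv] using this
    · have hv : (i + 1).val = 0 := by
        have : Fact (1 < c) := ⟨by omega⟩
        rw [ZMod.val_add, ZMod.val_one, show i.val + 1 = c by omega, Nat.mod_self]
      have e1 : l[i.val] = w := by
        rw [List.getLast?_eq_getElem?, show l.length - 1 = i.val by omega,
          List.getElem?_eq_getElem hi] at hw
        simpa using hw
      have e2 : l[0]'(by omega) = u := by
        rw [List.head?_eq_getElem?, List.getElem?_eq_getElem (by omega)] at hu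
        simpa using hu
      simp only [hv, e1, e2, ha]

theorem CycFun.shift {c : ℕ} {f : ZMod c → V} (h : CycFun G f) (a : ZMod c) :
    CycFun G (fun i => f (a + i)) :=
  ⟨fun i j hij => by simpa using h.1 hij, fun i => by
    have := h.2 (a + i)
    rwa [add_assoc] at this⟩

theorem CycFun.reflect {c : ℕ} {f : ZMod c → V} (h : CycFun G f) : CycFun G (fun i => f (-i)) :=
  ⟨fun i j hij => by simpa using h.1 hij, fun i => by
    have := (h.2 (-(i + 1))).symm
    simpa using this⟩

theorem ZMod.natCast_inj_of_lt {c i j : ℕ} (hi : i < c) (hj : j < c)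
    (h : (i : ZMod c) = (j : ZMod c)) : i = j := by
  rw [ZMod.natCast_eq_natCast_iff'] at h
  rwa [Nat.mod_eq_of_lt hi, Nat.mod_eq_of_lt hj] at h

theorem CycFun.adj_nat {c : ℕ} {f : ZMod c → V} (h : CycFun G f) (i : ℕ) :
    G.Adj (f (i : ZMod c)) (f ((i + 1 : ℕ) : ZMod c)) := by
  push_cast; exact h.2 _

theorem CycFun.inj_nat {c : ℕ} {f : ZMod c → V} (h : CycFun G f) {i j : ℕ} (hi : i < c)
    (hj : j < c) (hij : f (i : ZMod c) = f (j : ZMod c)) : i = j :=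
  ZMod.natCast_inj_of_lt hi hj (h.1 hij)

end Lists

/-! ### Exchange arguments on a longest cycle -/

/-- The vertices of the list `Q` are distinct and avoid the range of `f`. -/
def OffPath {ι V : Type*} (f : ι → V) (Q : List V) : Prop := Q.Nodup ∧ ∀ x ∈ Q, ∀ i, f i ≠ x

section Exchange

variable {V : Type*} {G : SimpleGraph V}

theorem seg_disjoint_seg {g : ℕ → V} {c a b a' b' : ℕ}
    (hg : ∀ i j, i < c → j < c → g i = g j → i = j) (h : b < a') (h' : b' < c) :
    (seg g a b).Disjoint (seg g a' b') := by
  intro x hx hx'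
  obtain ⟨i, h1, h2, rfl⟩ := mem_seg.1 hx
  obtain ⟨j, h3, h4, h5⟩ := mem_seg.1 hx'
  have := hg j i (by omega) (by omega) h5
  omega

theorem seg_disjoint_seg' {g : ℕ → V} {c a b a' b' : ℕ}
    (hg : ∀ i j, i < c → j < c → g i = g j → i = j) (h : b' < a) (h' : b < c) :
    (seg g a b).Disjoint (seg g a' b') :=
  (seg_disjoint_seg hg h h').symm

theorem seg_nodup_of_lt {g : ℕ → V} {c a b : ℕ}
    (hg : ∀ i j, i < c → j < c → g i = g j → i = j) (h : b < c) : (seg g a b).Nodup :=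
  nodup_seg fun _ _ _ _ _ _ h' => hg _ _ (by omega) (by omega) h'

theorem OffPath.seg_disjoint {ι : Type*} {f : ι → V} {Q : List V} (hQ : OffPath f Q)
    (e : ℕ → ι) (a b : ℕ) : (seg (fun t => f (e t)) a b).Disjoint Q := by
  intro x hx hx'
  obtain ⟨i, _, _, h⟩ := mem_seg.1 hx
  exact hQ.2 x hx' _ h

theorem OffPath.reverse {ι : Type*} {f : ι → V} {Q : List V} (hQ : OffPath f Q) :
    OffPath f Q.reverse :=
  ⟨List.nodup_reverse.2 hQ.1, fun x hx => hQ.2 x (List.mem_reverse.1 hx)⟩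

variable {c : ℕ} {f : ZMod c → V}

theorem OffPath.shift {Q : List V} (hQ : OffPath f Q) (a : ZMod c) :
    OffPath (fun i => f (a + i)) Q := ⟨hQ.1, fun x hx _ => hQ.2 x hx _⟩

theorem OffPath.reflect {Q : List V} (hQ : OffPath f Q) :
    OffPath (fun i => f (-i)) Q := ⟨hQ.1, fun x hx _ => hQ.2 x hx _⟩

theorem CycFun.inj_fun (hf : CycFun G f) :
    ∀ i j : ℕ, i < c → j < c → (fun t : ℕ => f (t : ZMod c)) i = (fun t : ℕ => f (t : ZMod c)) j → i = j :=
  fun _ _ hi hj h => hf.inj_nat hi hj h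

theorem CycFun.trace_seg (hf : CycFun G f) {a b : ℕ} (h : a ≤ b) :
    Trace G (f (a : ZMod c)) (f (b : ZMod c)) (seg (fun t : ℕ => f (t : ZMod c)) a b) :=
  _root_.trace_seg h fun i _ _ => hf.adj_nat i

theorem CycFun.adj_last (hf : CycFun G f) (hc : 1 ≤ c) :
    G.Adj (f ((c - 1 : ℕ) : ZMod c)) (f 0) := by
  have := hf.adj_nat (c - 1)
  rwa [show c - 1 + 1 = c by omega, ZMod.natCast_self] at this

/-- The detour through `Q` replaces the `t - 1` vertices strictly between `f 0` and `f t`; a longest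
cycle cannot gain from it. -/
theorem gap_zero (hf : CycFun G f) (hmax : ∀ l, CyclicList G l → l.length ≤ c)
    {Q : List V} {u w : V} (hQ : OffPath f Q) (hT : Trace G u w Q) {t : ℕ} (h1 : 1 ≤ t)
    (h2 : t < c) (hu : G.Adj u (f 0)) (hw : G.Adj w (f (t : ZMod c))) : Q.length + 1 ≤ t := by
  have hne : 1 ≤ Q.length := List.length_pos_of_mem hT.left_mem
  have key : CyclicList G (Q ++ seg (fun t : ℕ => f (t : ZMod c)) t (c - 1) ++ [f 0]) := by
    refine ⟨by simp; omega, ?_, u, f 0, ?_, hu.symm⟩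
    · have h0 : [f 0] = seg (fun t : ℕ => f (t : ZMod c)) 0 0 := by simp [seg]
      rw [h0]
      simp only [List.nodup_append', List.disjoint_append_left]
      exact ⟨⟨hQ.1, seg_nodup_of_lt hf.inj_fun (by omega), (hQ.seg_disjoint _ _ _).symm⟩,
        seg_nodup_of_lt hf.inj_fun (by omega), (hQ.seg_disjoint _ _ _).symm,
        seg_disjoint_seg' hf.inj_fun (by omega) (by omega)⟩
    · exact (hT.append (hf.trace_seg (by omega)) hw).append (Trace.single _)
        (hf.adj_last (by omega))
  have := hmax _ key
  simp at this
  omega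

theorem gap (hf : CycFun G f) (hmax : ∀ l, CyclicList G l → l.length ≤ c)
    {Q : List V} {u w : V} (hQ : OffPath f Q) (hT : Trace G u w Q) {i : ZMod c} {t : ℕ}
    (h1 : 1 ≤ t) (h2 : t < c) (hu : G.Adj u (f i)) (hw : G.Adj w (f (i + t))) :
    Q.length + 1 ≤ t :=
  gap_zero (hf.shift i) hmax (hQ.shift i) hT h1 h2 (by simpa using hu) hw

/-- With such a chord, `f 1, …, f t`, then `Q` backwards, then `f 0, f (c-1), …, f (t+1)` would be a
cycle with `c + Q.length` vertices. -/
theorem succ_not_adj_zero (hf : CycFun G f) (hmax : ∀ l, CyclicList G l → l.length ≤ c)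
    {Q : List V} {u w : V} (hQ : OffPath f Q) (hT : Trace G u w Q) {t : ℕ} (h1 : 1 ≤ t)
    (h2 : t + 1 < c) (hu : G.Adj u (f 0)) (hw : G.Adj w (f (t : ZMod c))) :
    ¬ G.Adj (f 1) (f ((t + 1 : ℕ) : ZMod c)) := by
  intro hadj
  have hne : 1 ≤ Q.length := List.length_pos_of_mem hT.left_mem
  have key : CyclicList G (seg (fun t : ℕ => f (t : ZMod c)) 1 t ++ Q.reverse ++ [f 0] ++
      (seg (fun t : ℕ => f (t : ZMod c)) (t + 1) (c - 1)).reverse) := by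
    refine ⟨by simp; omega, ?_, f ((1 : ℕ) : ZMod c), f ((t + 1 : ℕ) : ZMod c), ?_, ?_⟩
    · have h0 : [f 0] = seg (fun t : ℕ => f (t : ZMod c)) 0 0 := by simp [seg]
      rw [h0]
      simp only [List.nodup_append', List.disjoint_append_left, List.disjoint_reverse_right,
        List.nodup_reverse]
      refine ⟨⟨⟨seg_nodup_of_lt hf.inj_fun (by omega), hQ.1, hQ.seg_disjoint _ _ _⟩,
        seg_nodup_of_lt hf.inj_fun (by omega), ?_, (hQ.reverse.seg_disjoint _ _ _).symm⟩,
        seg_nodup_of_lt hf.inj_fun (by omega), ⟨?_, (hQ.reverse.seg_disjoint _ _ _).symm⟩, ?_⟩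
      · exact seg_disjoint_seg' hf.inj_fun (by omega) (by omega)
      · exact seg_disjoint_seg hf.inj_fun (by omega) (by omega)
      · exact seg_disjoint_seg hf.inj_fun (by omega) (by omega)
    · refine (((hf.trace_seg h1).append hT.reverse hw.symm).append (Trace.single _) hu).append
        (hf.trace_seg (by omega)).reverse (hf.adj_last (by omega)).symm
    · simpa using hadj.symm
  have := hmax _ key
  simp at this
  omega

theorem exists_nat_shift (hc : 1 ≤ c) {i j : ZMod c} (hij : i ≠ j) :
    ∃ t : ℕ, 1 ≤ t ∧ t < c ∧ j = i + t := by
  have : NeZero c := ⟨by omega⟩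
  refine ⟨(j - i).val, ?_, ZMod.val_lt _, by simp⟩
  have : (j - i).val ≠ 0 := by
    rw [Ne, ZMod.val_eq_zero, sub_eq_zero]; exact hij.symm
  omega

theorem succ_not_adj (hf : CycFun G f) (hmax : ∀ l, CyclicList G l → l.length ≤ c) (hc : 1 ≤ c)
    {Q : List V} {u w : V} (hQ : OffPath f Q) (hT : Trace G u w Q) {i j : ZMod c}
    (hij : i ≠ j) (hu : G.Adj u (f i)) (hw : G.Adj w (f j)) :
    ¬ G.Adj (f (i + 1)) (f (j + 1)) := by
  obtain ⟨t, h1, h2, rfl⟩ := exists_nat_shift hc hij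
  rcases Nat.lt_or_ge (t + 1) c with h3 | h3
  · have := succ_not_adj_zero (hf.shift i) hmax (hQ.shift i) hT h1 h3 (by simpa using hu) hw
    simpa [add_assoc] using this
  -- Here `t = c - 1`, so `i` is the successor of `j`; feet of the two ends of `Q` at distance one
  -- contradict `gap`.
  · exfalso
    have hne : 1 ≤ Q.length := List.length_pos_of_mem hT.left_mem
    have h4 : i = i + (t : ZMod c) + ((1 : ℕ) : ZMod c) := by
      have : ((t + 1 : ℕ) : ZMod c) = 0 := by rw [show t + 1 = c by omega]; simp
      rw [add_assoc, ← Nat.cast_add, this, add_zero]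
    have := gap hf hmax hQ.reverse hT.reverse (i := i + t) (t := 1) le_rfl (by omega) hw
      (by rw [← h4]; exact hu)
    rw [List.length_reverse] at this; omega

theorem pred_not_adj (hf : CycFun G f) (hmax : ∀ l, CyclicList G l → l.length ≤ c) (hc : 1 ≤ c)
    {Q : List V} {u w : V} (hQ : OffPath f Q) (hT : Trace G u w Q) {i j : ZMod c}
    (hij : i ≠ j) (hu : G.Adj u (f i)) (hw : G.Adj w (f j)) :
    ¬ G.Adj (f (i - 1)) (f (j - 1)) := by
  have := succ_not_adj hf.reflect hmax hc hQ.reflect hT (i := -i) (j := -j)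
    (by simpa using hij) (by simpa using hu) (by simpa using hw)
  simpa [sub_eq_add_neg, add_comm] using this

/-- Replacing a segment of a longest cycle by an outside path of the same length. -/
theorem swap_zero (hf : CycFun G f) {Q : List V} {u w : V} (hQ : OffPath f Q)
    (hT : Trace G u w Q) (h2 : Q.length + 1 < c) (hu : G.Adj u (f 0))
    (hw : G.Adj w (f ((Q.length + 1 : ℕ) : ZMod c))) :
    ∃ f' : ZMod c → V, CycFun G f' ∧
      (∀ s : ℕ, Q.length + 1 ≤ s → s ≤ c → f' (s : ZMod c) = f (s : ZMod c)) ∧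
      (∀ s : ℕ, 1 ≤ s → s ≤ Q.length → f' (s : ZMod c) ∈ Q) := by
  have hne : 1 ≤ Q.length := List.length_pos_of_mem hT.left_mem
  set t := Q.length with ht
  have key : CyclicList G ([f 0] ++ Q ++ seg (fun t : ℕ => f (t : ZMod c)) (t + 1) (c - 1)) := by
    refine ⟨by simp; omega, ?_, f 0, f ((c - 1 : ℕ) : ZMod c), ?_, hf.adj_last (by omega)⟩
    · have h0 : [f 0] = seg (fun t : ℕ => f (t : ZMod c)) 0 0 := by simp [seg]
      rw [h0]
      simp only [List.nodup_append', List.disjoint_append_left]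
      exact ⟨⟨seg_nodup_of_lt hf.inj_fun (by omega), hQ.1, hQ.seg_disjoint _ _ _⟩,
        seg_nodup_of_lt hf.inj_fun (by omega), seg_disjoint_seg hf.inj_fun (by omega) (by omega),
        (hQ.seg_disjoint _ _ _).symm⟩
    · exact ((Trace.single _).append hT hu.symm).append (hf.trace_seg (by omega)) hw
  obtain ⟨f', hf', hv⟩ := key.exists_cycFun (c := c) (by simp; omega)
  refine ⟨f', hf', ?_, ?_⟩
  · intro s h3 h4
    rcases Nat.lt_or_ge s c with h5 | h5
    · rw [hv s (by simp; omega)]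
      rw [List.getElem_append_right (by simp; omega)]
      simp only [seg, List.getElem_map, List.getElem_range']
      congr 2
      simp; omega
    -- Index `c` stands for index `0`; admitting it in the statement records that `f 0` stays in
    -- place.
    · have : s = c := by omega
      subst this
      have := hv 0 (by simp)
      simpa using this
  · intro s h3 h4
    rw [hv s (by simp; omega)]
    rw [List.getElem_append_left (by simp; omega), List.getElem_append_right (by simp; omega)]
    exact List.getElem_mem _

/-- A vertex `v` outside of a longest cycle, adjacent to both sides of `g i` and of `g j`, forbids
chords from `g i` and `g j` to two consecutive vertices. -/
theorem crossing_zero (hf : CycFun G f) (hmax : ∀ l, CyclicList G l → l.length ≤ c)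
    {v : V} (hv : ∀ i, f i ≠ v) {i j : ℕ} (hi : 1 ≤ i) (hi' : i + 1 < c) (hj : 1 ≤ j)
    (hj' : j + 1 < c)
    (hi1 : G.Adj v (f ((i - 1 : ℕ) : ZMod c))) (hi2 : G.Adj v (f ((i + 1 : ℕ) : ZMod c)))
    (hj1 : G.Adj v (f ((j - 1 : ℕ) : ZMod c))) (hj2 : G.Adj v (f ((j + 1 : ℕ) : ZMod c)))
    (hb : G.Adj (f ((c - 1 : ℕ) : ZMod c)) (f (i : ZMod c))) (hb' : G.Adj (f (j : ZMod c)) (f 0)) :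
    False := by
  have hv' : ∀ a b, v ∉ seg (fun t : ℕ => f (t : ZMod c)) a b := by
    intro a b h
    obtain ⟨s, _, _, h⟩ := mem_seg.1 h
    exact hv _ h
  have htr := fun a b (h : a ≤ b) => hf.trace_seg (a := a) (b := b) h
  rcases lt_trichotomy i j with h | rfl | h
  -- In each of the three orders of `i` and `j` the cycle uses all `c` vertices and `v`. It goes
  -- from `f 0` up to just before the smaller index, through `v` to just after the larger one, on to
  -- `f (c-1)`, by a chord to `f i`, along the middle segment to `f j`, and by the other chord home.
  · have key : CyclicList G (seg (fun t : ℕ => f (t : ZMod c)) 0 (i - 1) ++ [v] ++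
        seg (fun t : ℕ => f (t : ZMod c)) (j + 1) (c - 1) ++
        seg (fun t : ℕ => f (t : ZMod c)) i j) := by
      refine ⟨by simp; omega, ?_, f ((0 : ℕ) : ZMod c), f (j : ZMod c), ?_, by simpa using hb'⟩
      · simp only [List.nodup_append', List.disjoint_append_left, List.disjoint_singleton,
          List.singleton_disjoint, List.nodup_singleton, hv', not_false_eq_true, and_true]
        refine ⟨⟨seg_nodup_of_lt hf.inj_fun (by omega), seg_nodup_of_lt hf.inj_fun (by omega),
          seg_disjoint_seg hf.inj_fun (by omega) (by omega)⟩, seg_nodup_of_lt hf.inj_fun (by omega),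
          seg_disjoint_seg hf.inj_fun (by omega) (by omega),
          seg_disjoint_seg' hf.inj_fun (by omega) (by omega)⟩
      · exact (((htr _ _ (by omega)).append (Trace.single v) hi1.symm).append
          (htr _ _ (by omega)) hj2).append (htr _ _ (by omega)) hb
    have := hmax _ key
    simp at this
    omega
  · have key : CyclicList G (seg (fun t : ℕ => f (t : ZMod c)) 0 (i - 1) ++ [v] ++
        seg (fun t : ℕ => f (t : ZMod c)) (i + 1) (c - 1) ++
        seg (fun t : ℕ => f (t : ZMod c)) i i) := by
      refine ⟨by simp; omega, ?_, f ((0 : ℕ) : ZMod c), f (i : ZMod c), ?_, by simpa using hb'⟩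
      · simp only [List.nodup_append', List.disjoint_append_left, List.disjoint_singleton,
          List.singleton_disjoint, List.nodup_singleton, hv', not_false_eq_true, and_true]
        refine ⟨⟨seg_nodup_of_lt hf.inj_fun (by omega), seg_nodup_of_lt hf.inj_fun (by omega),
          seg_disjoint_seg hf.inj_fun (by omega) (by omega)⟩, seg_nodup_of_lt hf.inj_fun (by omega),
          seg_disjoint_seg hf.inj_fun (by omega) (by omega),
          seg_disjoint_seg' hf.inj_fun (by omega) (by omega)⟩
      · exact (((htr _ _ (by omega)).append (Trace.single v) hi1.symm).append
          (htr _ _ (by omega)) hj2).append (htr _ _ (by omega)) hb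
    have := hmax _ key
    simp at this
    omega
  · have key : CyclicList G (seg (fun t : ℕ => f (t : ZMod c)) 0 (j - 1) ++ [v] ++
        seg (fun t : ℕ => f (t : ZMod c)) (i + 1) (c - 1) ++
        (seg (fun t : ℕ => f (t : ZMod c)) j i).reverse) := by
      refine ⟨by simp; omega, ?_, f ((0 : ℕ) : ZMod c), f (j : ZMod c), ?_, by simpa using hb'⟩
      · simp only [List.nodup_append', List.disjoint_append_left, List.disjoint_singleton,
          List.singleton_disjoint, List.nodup_singleton, hv', not_false_eq_true, and_true,
          List.disjoint_reverse_right, List.nodup_reverse]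
        refine ⟨⟨seg_nodup_of_lt hf.inj_fun (by omega), seg_nodup_of_lt hf.inj_fun (by omega),
          seg_disjoint_seg hf.inj_fun (by omega) (by omega)⟩, seg_nodup_of_lt hf.inj_fun (by omega),
          seg_disjoint_seg hf.inj_fun (by omega) (by omega),
          seg_disjoint_seg' hf.inj_fun (by omega) (by omega)⟩
      · exact (((htr _ _ (by omega)).append (Trace.single v) hj1.symm).append
          (htr _ _ (by omega)) hi2).append (htr _ _ (by omega)).reverse hb
    have := hmax _ key
    simp at this
    omega

end Exchange

/-! ### Longest paths and the neighbours of their ends -/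

/-- `g 0, …, g (l-1)` is a path. -/
def PathFun {V : Type*} (G : SimpleGraph V) (l : ℕ) (g : ℕ → V) : Prop :=
  (∀ i j, i < l → j < l → g i = g j → i = j) ∧ ∀ i, i + 1 < l → G.Adj (g i) (g (i + 1))

/-- No vertex separates the graph. -/
def NoCutVertex {V : Type*} (G : SimpleGraph V) : Prop :=
  ∀ (v : V) (S : Set V), v ∉ S → S.Nonempty → (∃ y, y ∉ S ∧ y ≠ v) →
    ∃ x ∈ S, ∃ y, y ∉ S ∧ y ≠ v ∧ G.Adj x y

section LongestPath

variable {V : Type*} {G : SimpleGraph V}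

theorem SimpleGraph.Connected.exists_adj_compl (h : G.Connected) {S : Set V} (hS : S.Nonempty)
    (hS' : S ≠ Set.univ) : ∃ x ∈ S, ∃ y, y ∉ S ∧ G.Adj x y := by
  obtain ⟨x, hx⟩ := hS
  obtain ⟨y, hy⟩ := (Set.ne_univ_iff_exists_notMem S).1 hS'
  obtain ⟨p⟩ := h.preconnected x y
  obtain ⟨d, _, h1, h2⟩ := p.exists_boundary_dart S hx hy
  exact ⟨_, h1, _, h2, d.adj⟩

theorem exists_maximal_of_bounded {α : Type*} {p : α → Prop} {φ : α → ℕ} (B : ℕ)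
    (hB : ∀ a, p a → φ a ≤ B) (h : ∃ a, p a) : ∃ a, p a ∧ ∀ b, p b → φ b ≤ φ a := by
  have hb : BddAbove (φ '' {a | p a}) := ⟨B, by rintro _ ⟨a, ha, rfl⟩; exact hB a ha⟩
  have hn : (φ '' {a | p a}).Nonempty := by obtain ⟨a, ha⟩ := h; exact ⟨_, a, ha, rfl⟩
  obtain ⟨a, ha, he⟩ := Nat.sSup_mem hn hb
  refine ⟨a, ha, fun b hb' => ?_⟩
  rw [he]
  exact le_csSup hb ⟨b, hb', rfl⟩

theorem PathFun.reverse {l : ℕ} {g : ℕ → V} (h : PathFun G l g) :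
    PathFun G l (fun t => g (l - 1 - t)) := by
  refine ⟨fun i j hi hj hij => ?_, fun i hi => ?_⟩
  · have := h.1 _ _ (by omega) (by omega) hij
    omega
  · have := (h.2 (l - 1 - (i + 1)) (by omega)).symm
    rwa [show l - 1 - (i + 1) + 1 = l - 1 - i by omega] at this

/-- Pósa rotation: the edge from `g 0` to `g (j+1)` replaces the one from `g j` to `g (j+1)`, so
that `g j` becomes the first vertex. -/
theorem PathFun.rotate {l : ℕ} {g : ℕ → V} (h : PathFun G l g) {j : ℕ} (hj : j + 1 < l)
    (ha : G.Adj (g 0) (g (j + 1))) : PathFun G l (fun t => if t ≤ j then g (j - t) else g t) := by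
  refine ⟨fun a b ha hb hab => ?_, fun i hi => ?_⟩
  · simp only at hab
    split_ifs at hab with h1 h2 h2
    · have := h.1 _ _ (by omega) (by omega) hab; omega
    · have := h.1 _ _ (by omega) (by omega) hab; omega
    · have := h.1 _ _ (by omega) (by omega) hab; omega
    · exact h.1 _ _ (by omega) (by omega) hab
  · simp only
    rcases lt_trichotomy i j with h1 | rfl | h1
    · rw [if_pos (by omega), if_pos (by omega)]
      have := (h.2 (j - (i + 1)) (by omega)).symm
      rwa [show j - (i + 1) + 1 = j - i by omega] at this
    · rw [if_pos le_rfl, if_neg (by omega), Nat.sub_self]; exact ha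
    · rw [if_neg (by omega), if_neg (by omega)]; exact h.2 i hi

theorem PathFun.trace {l : ℕ} {g : ℕ → V} (h : PathFun G l g) {a b : ℕ} (hab : a ≤ b) (hb : b < l) :
    Trace G (g a) (g b) (seg g a b) :=
  trace_seg hab fun i _ h2 => h.2 i (by omega)

theorem exists_longest_path [Fintype V] [Nonempty V] : ∃ (l : ℕ) (g : ℕ → V), 1 ≤ l ∧
    PathFun G l g ∧ ∀ (Q : List V) (u w : V), Q.Nodup → Trace G u w Q → Q.length ≤ l := by
  classical
  obtain ⟨Q, ⟨hQ, u, w, hT⟩, hmax⟩ := exists_maximal_of_bounded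
    (p := fun Q : List V => Q.Nodup ∧ ∃ u w, Trace G u w Q) (φ := List.length) (Fintype.card V)
    (fun Q hQ => hQ.1.length_le_card)
    ⟨[Classical.arbitrary V], by simp, _, _, Trace.single _⟩
  refine ⟨Q.length, fun t => Q.getD t u, List.length_pos_of_mem hT.left_mem, ⟨?_, ?_⟩,
    fun Q' u w h1 h2 => hmax Q' ⟨h1, u, w, h2⟩⟩
  · intro i j hi hj hij
    simp only [List.getD_eq_getElem _ _ hi, List.getD_eq_getElem _ _ hj] at hij
    exact (List.Nodup.getElem_inj_iff hQ).1 hij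
  · intro i hi
    simp only [List.getD_eq_getElem _ _ hi, List.getD_eq_getElem _ _ (Nat.lt_of_succ_lt hi)]
    exact List.isChain_iff_getElem.1 hT.1 i hi

theorem PathFun.exists_of_adj_zero {l : ℕ} {g : ℕ → V} (h : PathFun G l g) (hl : 1 ≤ l)
    (hP : ∀ (Q : List V) (u w : V), Q.Nodup → Trace G u w Q → Q.length ≤ l) {x : V}
    (hx : G.Adj (g 0) x) : ∃ t, 1 ≤ t ∧ t < l ∧ g t = x := by
  by_contra hcon
  have hmem : x ∉ seg g 0 (l - 1) := by
    intro hm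
    obtain ⟨i, _, h2, rfl⟩ := mem_seg.1 hm
    refine hcon ⟨i, ?_, by omega, rfl⟩
    rcases Nat.eq_zero_or_pos i with rfl | h0
    · exact absurd hx (G.irrefl)
    · exact h0
  have := hP (x :: seg g 0 (l - 1)) x (g (l - 1)) (List.nodup_cons.2 ⟨hmem,
    nodup_seg fun i j _ _ _ _ h' => h.1 i j (by omega) (by omega) h'⟩)
    ((h.trace (by omega) (by omega)).cons hx.symm)
  simp at this
  omega

/-- A cycle that is not spanning has, by connectivity, an edge leaving it. Opening the cycle there
gives a path with one more vertex. -/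
theorem cyclicList_length_lt [Fintype V] [DecidableEq V] (hconn : G.Connected)
    (hham : ¬ G.IsHamiltonian) {l : ℕ}
    (hP : ∀ (Q : List V) (u w : V), Q.Nodup → Trace G u w Q → Q.length ≤ l) {Q : List V}
    (hQ : CyclicList G Q) : Q.length < l := by
  have hne : Q.length ≠ Fintype.card V := fun h => hham (hQ.isHamiltonian h)
  have h3 := hQ.1
  obtain ⟨f, hf, -⟩ := hQ.exists_cycFun rfl
  have : NeZero Q.length := ⟨by omega⟩
  have hr : Set.range f ≠ Set.univ := by
    intro hu
    have := Fintype.card_of_bijective ⟨hf.1, Set.range_eq_univ.1 hu⟩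
    rw [ZMod.card] at this
    exact hne this
  obtain ⟨_, ⟨i, rfl⟩, y, hy, hadj⟩ := hconn.exists_adj_compl (Set.range_nonempty f) hr
  have hf' := hf.shift i
  have := hP (y :: seg (fun t : ℕ => f (i + t)) 0 (Q.length - 1)) y _
    (List.nodup_cons.2 ⟨fun hm => by
      obtain ⟨t, _, _, rfl⟩ := mem_seg.1 hm
      exact hy ⟨_, rfl⟩, seg_nodup_of_lt (c := Q.length) hf'.inj_fun (by omega)⟩)
    ((hf'.trace_seg (Nat.zero_le (Q.length - 1))).cons (by simpa using hadj.symm))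
  simp at this
  omega

theorem PathFun.card_add_le [Fintype V] {l : ℕ} {g : ℕ → V} (h : PathFun G l g) (s : Finset V)
    (hs : ∀ x ∈ s, ∀ t < l, g t ≠ x) : l + s.card ≤ Fintype.card V := by
  classical
  have h1 : ((Finset.range l).image g).card = l := by
    rw [Finset.card_image_of_injOn, Finset.card_range]
    intro a ha b hb hab
    exact h.1 a b (by simpa using ha) (by simpa using hb) hab
  have h2 : Disjoint ((Finset.range l).image g) s := by
    rw [Finset.disjoint_left]
    intro x hx hx'
    obtain ⟨t, ht, rfl⟩ := Finset.mem_image.1 hx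
    exact hs _ hx' t (by simpa using ht) rfl
  have := Finset.card_union_of_disjoint h2
  have h3 := Finset.card_le_univ ((Finset.range l).image g ∪ s)
  omega

variable [Fintype V] [DecidableRel G.Adj]

theorem card_filter_adj_path {k : ℕ} (hreg : G.IsRegularOfDegree k) {l : ℕ} {g : ℕ → V}
    (h : PathFun G l g) {x : V} (hx : ∀ y, G.Adj x y → ∃ t < l, g t = y) :
    ((Finset.range l).filter fun t => G.Adj x (g t)).card = k := by
  classical
  rw [← hreg x, ← SimpleGraph.card_neighborFinset_eq_degree]
  refine Finset.card_bij (fun t _ => g t) ?_ ?_ ?_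
  · intro t ht; simpa using (Finset.mem_filter.1 ht).2
  · intro a ha b hb hab
    simp only [Finset.mem_filter, Finset.mem_range] at ha hb
    exact h.1 a b ha.1 hb.1 hab
  · intro y hy
    obtain ⟨t, ht, rfl⟩ := hx y (by simpa using hy)
    exact ⟨t, by simpa [ht] using hy, rfl⟩

/-- The data of a longest path in a connected regular non-Hamiltonian graph. -/
structure LongestPath (G : SimpleGraph V) [DecidableRel G.Adj] (k l : ℕ) (g : ℕ → V) : Prop where
  pos : 1 ≤ l
  path : PathFun G l g
  longest : ∀ (Q : List V) (u w : V), Q.Nodup → Trace G u w Q → Q.length ≤ l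
  reg : G.IsRegularOfDegree k
  cyc : ∀ Q, CyclicList G Q → Q.length < l

variable {k l : ℕ} {g : ℕ → V}

theorem LongestPath.reverse (h : LongestPath G k l g) : LongestPath G k l (fun t => g (l - 1 - t)) :=
  ⟨h.pos, h.path.reverse, h.longest, h.reg, h.cyc⟩

theorem LongestPath.rotate (h : LongestPath G k l g) {j : ℕ} (hj : j + 1 < l)
    (ha : G.Adj (g 0) (g (j + 1))) :
    LongestPath G k l (fun t => if t ≤ j then g (j - t) else g t) :=
  ⟨h.pos, h.path.rotate hj ha, h.longest, h.reg, h.cyc⟩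

theorem LongestPath.exists_of_adj_zero (h : LongestPath G k l g) {x : V} (hx : G.Adj (g 0) x) :
    ∃ t, 1 ≤ t ∧ t < l ∧ g t = x :=
  h.path.exists_of_adj_zero h.pos h.longest hx

theorem LongestPath.exists_of_adj_last (h : LongestPath G k l g) {x : V}
    (hx : G.Adj (g (l - 1)) x) : ∃ t, t + 1 < l ∧ g t = x := by
  obtain ⟨t, h1, h2, h3⟩ := h.reverse.exists_of_adj_zero (x := x) (by simpa using hx)
  exact ⟨l - 1 - t, by omega, h3⟩

theorem LongestPath.card_zero (h : LongestPath G k l g) :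
    ((Finset.range l).filter fun t => G.Adj (g 0) (g t)).card = k :=
  card_filter_adj_path h.reg h.path fun y hy => by
    obtain ⟨t, _, h2, h3⟩ := h.exists_of_adj_zero hy; exact ⟨t, h2, h3⟩

theorem LongestPath.card_last (h : LongestPath G k l g) :
    ((Finset.range l).filter fun t => G.Adj (g (l - 1)) (g t)).card = k :=
  card_filter_adj_path h.reg h.path fun y hy => by
    obtain ⟨t, h2, h3⟩ := h.exists_of_adj_last hy; exact ⟨t, by omega, h3⟩

theorem LongestPath.card_zero_pred (h : LongestPath G k l g) :
    ((Finset.range (l - 1)).filter fun t => G.Adj (g 0) (g (t + 1))).card = k := by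
  rw [← h.card_zero]
  refine Finset.card_bij (fun t _ => t + 1) ?_ ?_ ?_
  · intro t ht
    simp only [Finset.mem_filter, Finset.mem_range] at ht ⊢
    exact ⟨by omega, ht.2⟩
  · intro a _ b _ hab; simpa using hab
  · intro t ht
    simp only [Finset.mem_filter, Finset.mem_range] at ht
    have : t ≠ 0 := by rintro rfl; exact G.irrefl ht.2
    refine ⟨t - 1, ?_, by omega⟩
    simp only [Finset.mem_filter, Finset.mem_range, show t - 1 + 1 = t by omega]
    exact ⟨by omega, ht.2⟩

theorem LongestPath.card_last_pred (h : LongestPath G k l g) :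
    ((Finset.range (l - 1)).filter fun t => G.Adj (g (l - 1)) (g t)).card = k := by
  rw [← h.card_last]
  congr 1
  ext t
  simp only [Finset.mem_filter, Finset.mem_range]
  constructor
  · rintro ⟨h1, h2⟩; exact ⟨by omega, h2⟩
  · rintro ⟨h1, h2⟩
    refine ⟨?_, h2⟩
    have : t ≠ l - 1 := by rintro rfl; exact G.irrefl h2
    omega

/-- Two crossing end edges close the initial part up to `g a` and the final part from `g b` into a
cycle, losing only the vertices strictly between them. -/
theorem LongestPath.cyclicList_cross (h : LongestPath G k l g) {a b : ℕ} (hab : a < b) (hb : b < l)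
    (h3 : 3 ≤ a + 1 + (l - b)) (ha : G.Adj (g (l - 1)) (g a)) (h0 : G.Adj (g 0) (g b)) :
    CyclicList G (seg g 0 a ++ (seg g b (l - 1)).reverse) := by
  refine ⟨by simp; omega, ?_, g 0, g b, ?_, h0.symm⟩
  · simp only [List.nodup_append', List.nodup_reverse, List.disjoint_reverse_right]
    exact ⟨seg_nodup_of_lt h.path.1 (by omega), seg_nodup_of_lt h.path.1 (by omega),
      seg_disjoint_seg h.path.1 hab (by omega)⟩
  · exact (h.path.trace (by omega) (by omega)).append
      (h.path.trace (by omega) (by omega)).reverse ha.symm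

theorem LongestPath.three_le (h : LongestPath G k l g) (hk : 2 ≤ k) : 3 ≤ l := by
  have h1 := h.card_zero_pred
  have h2 : ((Finset.range (l - 1)).filter fun t => G.Adj (g 0) (g (t + 1))).card ≤ l - 1 := by
    simpa using Finset.card_filter_le (Finset.range (l - 1)) fun t => G.Adj (g 0) (g (t + 1))
  omega

theorem LongestPath.not_cross_succ (h : LongestPath G k l g) (hk : 2 ≤ k) {t : ℕ} (ht : t + 1 < l)
    (ha : G.Adj (g (l - 1)) (g t)) (h0 : G.Adj (g 0) (g (t + 1))) : False := by
  have h3 := h.three_le hk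
  have := h.cyc _ (h.cyclicList_cross (Nat.lt_succ_self t) ht (by omega) ha h0)
  simp at this
  omega

/-- Counting neighbours of the ends of a longest path, outside of a set `s` of positions. -/
theorem LongestPath.two_mul_add_card_le (h : LongestPath G k l g) (hk : 2 ≤ k) (s : Finset ℕ)
    (hs : ∀ t ∈ s, t + 1 < l ∧ ¬ G.Adj (g 0) (g (t + 1)) ∧ ¬ G.Adj (g (l - 1)) (g t)) :
    2 * k + s.card + 1 ≤ l := by
  have h1 := h.card_zero_pred
  have h2 := h.card_last_pred
  set A := (Finset.range (l - 1)).filter fun t => G.Adj (g 0) (g (t + 1))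
  set B := (Finset.range (l - 1)).filter fun t => G.Adj (g (l - 1)) (g t)
  have hAB : Disjoint A B := by
    rw [Finset.disjoint_left]
    intro t ht ht'
    simp only [A, B, Finset.mem_filter, Finset.mem_range] at ht ht'
    exact h.not_cross_succ hk (by omega) ht'.2 ht.2
  have hABs : Disjoint (A ∪ B) s := by
    rw [Finset.disjoint_left]
    intro t ht ht'
    simp only [A, B, Finset.mem_union, Finset.mem_filter, Finset.mem_range] at ht
    rcases ht with ht | ht
    · exact (hs t ht').2.1 ht.2
    · exact (hs t ht').2.2 ht.2
  have hsub : A ∪ B ∪ s ⊆ Finset.range (l - 1) := by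
    intro t ht
    simp only [A, B, Finset.mem_union, Finset.mem_filter] at ht
    rcases ht with (ht | ht) | ht
    · exact ht.1
    · exact ht.1
    · have := (hs t ht).1; simp; omega
  have h3 := Finset.card_le_card hsub
  rw [Finset.card_union_of_disjoint hABs, Finset.card_union_of_disjoint hAB, Finset.card_range] at h3
  have := h.pos
  omega

/-- Otherwise there are crossing edges from `g 0` to `g b` and from `g (l-1)` to `g a` with `a < b`;
take them with `b - a` minimal. By minimality the positions strictly between `a` and `b - 1` belong
to neither of the two sets counted in `two_mul_add_card_le`. This makes the path so long that the
crossing cycle, which omits only `b - a - 1` vertices, has at least `2 * k` of them. -/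
theorem LongestPath.le_of_no_long_cycle (h : LongestPath G k l g) (hk : 2 ≤ k)
    (hcyc : ∀ Q, CyclicList G Q → Q.length < 2 * k) {i i' : ℕ} (hi : i < l)
    (hi0 : G.Adj (g 0) (g i)) (hil : G.Adj (g (l - 1)) (g i')) : i ≤ i' := by
  by_contra hlt
  push Not at hlt
  obtain ⟨⟨a, b⟩, ⟨hab, hb, h0, h1⟩, hmin⟩ := exists_maximal_of_bounded (α := ℕ × ℕ)
    (p := fun x => x.1 < x.2 ∧ x.2 < l ∧ G.Adj (g 0) (g x.2) ∧ G.Adj (g (l - 1)) (g x.1))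
    (φ := fun x => l + x.1 - x.2) (l + l) (fun x hx => by have := hx.1; have := hx.2.1; omega)
    ⟨(i', i), hlt, hi, hi0, hil⟩
  simp only at hab hb h0 h1
  have hcount := h.two_mul_add_card_le hk (Finset.Ioo a (b - 1)) (by
    intro t ht
    rw [Finset.mem_Ioo] at ht
    refine ⟨by omega, fun h2 => ?_, fun h2 => ?_⟩
    · have := hmin (a, t + 1) ⟨by simp only; omega, by simp only; omega, h2, h1⟩
      simp only at this; omega
    · have := hmin (t, b) ⟨by simp only; omega, hb, h0, h2⟩
      simp only at this; omega)
  rw [Nat.card_Ioo] at hcount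
  have h2 := hcyc _ (h.cyclicList_cross hab hb (by omega) h1 h0)
  simp at h2
  omega

/-- The first neighbour of `g 0` after `g j`. -/
theorem LongestPath.exists_next (h : LongestPath G k l g) {i j : ℕ} (hi0 : G.Adj (g 0) (g i))
    (hmax : ∀ s < l, G.Adj (g 0) (g s) → s ≤ i) (hj : j < i) :
    ∃ s, j < s ∧ s ≤ i ∧ G.Adj (g 0) (g s) ∧ k ≤ j + (i + 1 - s) := by
  obtain ⟨s, ⟨hs1, hs2, hs3⟩, hs4⟩ := exists_maximal_of_bounded
    (p := fun s => j < s ∧ s ≤ i ∧ G.Adj (g 0) (g s)) (φ := fun s => l - s) l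
    (fun s _ => by omega) ⟨i, hj, le_rfl, hi0⟩
  refine ⟨s, hs1, hs2, hs3, ?_⟩
  -- By the choice of `s`, no neighbour of `g 0` lies strictly between `g j` and `g s`, which gives
  -- the bound on `k`.
  have h1 : (Finset.range l).filter (fun s => G.Adj (g 0) (g s)) ⊆
      Finset.Icc 1 j ∪ Finset.Icc s i := by
    intro x hx
    simp only [Finset.mem_filter, Finset.mem_range] at hx
    simp only [Finset.mem_union, Finset.mem_Icc]
    have hx0 : x ≠ 0 := by rintro rfl; exact G.irrefl hx.2
    have hxi := hmax x hx.1 hx.2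
    by_cases hxj : x ≤ j
    · left; omega
    · have := hs4 x ⟨by omega, hxi, hx.2⟩
      right; omega
  have h2 := (Finset.card_le_card h1).trans (Finset.card_union_le _ _)
  rw [h.card_zero, Nat.card_Icc, Nat.card_Icc] at h2
  omega

/-- The last neighbour of `g (l - 1)` before `g t`. -/
theorem LongestPath.exists_prev (h : LongestPath G k l g) {i' t : ℕ}
    (hil : G.Adj (g (l - 1)) (g i')) (hmin : ∀ s < l, G.Adj (g (l - 1)) (g s) → i' ≤ s)
    (ht : i' < t) :
    ∃ s, s < t ∧ i' ≤ s ∧ G.Adj (g (l - 1)) (g s) ∧ k ≤ (s + 1 - i') + (l - 1 - t) := by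
  obtain ⟨s', ⟨hs1', hs2', hs3'⟩, hs4'⟩ := exists_maximal_of_bounded
    (p := fun s => s < t ∧ i' ≤ s ∧ G.Adj (g (l - 1)) (g s)) (φ := fun s => s) t
    (fun s hs => by omega) ⟨i', ht, le_rfl, hil⟩
  refine ⟨s', hs1', hs2', hs3', ?_⟩
  have h1 : (Finset.range l).filter (fun s => G.Adj (g (l - 1)) (g s)) ⊆
      Finset.Icc i' s' ∪ Finset.Ico t (l - 1) := by
    intro x hx
    simp only [Finset.mem_filter, Finset.mem_range] at hx
    simp only [Finset.mem_union, Finset.mem_Icc, Finset.mem_Ico]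
    have hx0 : x ≠ l - 1 := by rintro rfl; exact G.irrefl hx.2
    have hxi := hmin x hx.1 hx.2
    by_cases hxj : t ≤ x
    · right; omega
    · have := hs4' x ⟨by omega, hxi, hx.2⟩
      left; omega
  have h2 := (Finset.card_le_card h1).trans (Finset.card_union_le _ _)
  rw [h.card_last, Nat.card_Icc, Nat.card_Ico] at h2
  omega

/-- Walking from `g j` down to `g 0`, then from the next neighbour of `g 0` up to the last
neighbour of `g (l-1)` before `g t`, then from `g (l-1)` down to `g t`. -/
theorem LongestPath.exists_long_trace (h : LongestPath G k l g) {i i' j t : ℕ} (hi : i < l)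
    (hi0 : G.Adj (g 0) (g i)) (hmax : ∀ s < l, G.Adj (g 0) (g s) → s ≤ i)
    (hil : G.Adj (g (l - 1)) (g i')) (hmin : ∀ s < l, G.Adj (g (l - 1)) (g s) → i' ≤ s)
    (hii : i ≤ i') (hj : j < i) (ht : i' < t) (htl : t < l) :
    ∃ L : List V, L.Nodup ∧ Trace G (g j) (g t) L ∧ 2 * k + 1 ≤ L.length ∧
      ∀ x ∈ L, ∃ s < l, g s = x := by
  obtain ⟨s, hs1, hs2, hs3, hk1⟩ := h.exists_next hi0 hmax hj
  obtain ⟨s', hs1', hs2', hs3', hk2⟩ := h.exists_prev hil hmin ht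
  -- The two bounds on `k` add up to the required length: `hk1` accounts for the positions up to `j`
  -- and from `s` to `i`, `hk2` for those from `i'` to `s'` and from `t` on, and `i ≤ i'`.
  refine ⟨(seg g 0 j).reverse ++ seg g s s' ++ (seg g t (l - 1)).reverse, ?_, ?_, ?_, ?_⟩
  · simp only [List.nodup_append', List.nodup_reverse, List.disjoint_reverse_right,
      List.disjoint_reverse_left, List.disjoint_append_left]
    exact ⟨⟨seg_nodup_of_lt h.path.1 (by omega), seg_nodup_of_lt h.path.1 (by omega),
      seg_disjoint_seg h.path.1 (by omega) (by omega)⟩, seg_nodup_of_lt h.path.1 (by omega),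
      seg_disjoint_seg h.path.1 (by omega) (by omega),
      seg_disjoint_seg h.path.1 (by omega) (by omega)⟩
  · exact ((h.path.trace (Nat.zero_le j) (by omega)).reverse.append
      (h.path.trace (by omega) (by omega)) hs3).append
      (h.path.trace (by omega) (by omega)).reverse hs3'.symm
  · simp; omega
  · intro x hx
    simp only [List.mem_append, List.mem_reverse, mem_seg] at hx
    rcases hx with (⟨s, _, _, rfl⟩ | ⟨s, _, _, rfl⟩) | ⟨s, _, _, rfl⟩ <;>
      exact ⟨s, by omega, rfl⟩

/-- The cycle through two blocks joined by two disjoint edges. -/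
theorem LongestPath.exists_long_cycle_of_two_blocks (h : LongestPath G k l g) (hk : 2 ≤ k)
    {i i' j t : ℕ} (hi' : i' < l)
    (hi0 : G.Adj (g 0) (g i)) (hmax : ∀ s < l, G.Adj (g 0) (g s) → s ≤ i)
    (hil : G.Adj (g (l - 1)) (g i')) (hmin : ∀ s < l, G.Adj (g (l - 1)) (g s) → i' ≤ s)
    (hii : i < i') (hj : j < i) (ht : i' < t) (htl : t < l)
    (h1 : G.Adj (g j) (g i')) (h2 : G.Adj (g i) (g t)) :
    ∃ L : List V, CyclicList G L ∧ 2 * k + 1 ≤ L.length := by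
  obtain ⟨s, hs1, hs2, hs3, hk1⟩ := h.exists_next hi0 hmax hj
  obtain ⟨s', hs1', hs2', hs3', hk2⟩ := h.exists_prev hil hmin ht
  refine ⟨(seg g 0 j).reverse ++ seg g s i ++ seg g t (l - 1) ++ (seg g i' s').reverse,
    ⟨by simp; omega, ?_, g j, g i', ?_, h1.symm⟩, by simp; omega⟩
  · simp only [List.nodup_append', List.nodup_reverse, List.disjoint_reverse_right,
      List.disjoint_reverse_left, List.disjoint_append_left]
    exact ⟨⟨⟨seg_nodup_of_lt h.path.1 (by omega), seg_nodup_of_lt h.path.1 (by omega),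
      seg_disjoint_seg h.path.1 (by omega) (by omega)⟩, seg_nodup_of_lt h.path.1 (by omega),
      seg_disjoint_seg h.path.1 (by omega) (by omega),
      seg_disjoint_seg h.path.1 (by omega) (by omega)⟩, seg_nodup_of_lt h.path.1 (by omega),
      ⟨seg_disjoint_seg h.path.1 (by omega) (by omega),
      seg_disjoint_seg h.path.1 (by omega) (by omega)⟩,
      seg_disjoint_seg' h.path.1 (by omega) (by omega)⟩
  · exact (((h.path.trace (Nat.zero_le j) (by omega)).reverse.append
      (h.path.trace (by omega) (by omega)) hs3).append
      (h.path.trace (by omega) (by omega)) h2).append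
      (h.path.trace (by omega) (by omega)).reverse hs3'

end LongestPath

/-! ### A cycle of length at least `2k` in the absence of cut vertices -/

section Circumference

variable {V : Type*} {G : SimpleGraph V} [DecidableRel G.Adj] {k l : ℕ} {g : ℕ → V}

/-- The largest index of a neighbour of `g 0` on the path `g 0, …, g (l-1)`. -/
def lastNbr (G : SimpleGraph V) [DecidableRel G.Adj] (l : ℕ) (g : ℕ → V) : ℕ :=
  ((Finset.range l).filter fun t => G.Adj (g 0) (g t)).sup id

theorem le_lastNbr {t : ℕ} (ht : t < l) (h : G.Adj (g 0) (g t)) : t ≤ lastNbr G l g :=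
  Finset.le_sup (f := id) (by simpa using ⟨ht, h⟩)

theorem lastNbr_lt (hl : 1 ≤ l) : lastNbr G l g < l := by
  rw [lastNbr, Finset.sup_lt_iff (by exact hl)]
  intro t ht
  simp only [Finset.mem_filter, Finset.mem_range] at ht
  exact ht.1

theorem lastNbr_congr {g' : ℕ → V} (hl : 1 ≤ l) (h : ∀ t < l, g t = g' t) :
    lastNbr G l g = lastNbr G l g' := by
  unfold lastNbr
  congr 1
  ext t
  simp only [Finset.mem_filter, Finset.mem_range]
  constructor
  · rintro ⟨h1, h2⟩; rw [h t h1, h 0 hl] at h2; exact ⟨h1, h2⟩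
  · rintro ⟨h1, h2⟩; rw [← h t h1, ← h 0 hl] at h2; exact ⟨h1, h2⟩

variable [Fintype V]

theorem LongestPath.lastNbr_mem (h : LongestPath G k l g) (hk : 1 ≤ k) :
    lastNbr G l g < l ∧ G.Adj (g 0) (g (lastNbr G l g)) := by
  have hne : ((Finset.range l).filter fun t => G.Adj (g 0) (g t)).Nonempty := by
    rw [← Finset.card_pos, h.card_zero]; exact hk
  obtain ⟨t, ht, he⟩ := Finset.exists_mem_eq_sup _ hne id
  have he' : lastNbr G l g = t := he
  rw [he']
  simpa using ht

/-- A longest path on which the extreme neighbours of the ends are as far as possible from them. -/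
def Extremal (G : SimpleGraph V) [DecidableRel G.Adj] (k l : ℕ) (g : ℕ → V) : Prop :=
  LongestPath G k l g ∧ ∀ g', LongestPath G k l g' →
    lastNbr G l g' + lastNbr G l (fun t => g' (l - 1 - t)) ≤
      lastNbr G l g + lastNbr G l (fun t => g (l - 1 - t))

theorem Extremal.reverse (h : Extremal G k l g) : Extremal G k l (fun t => g (l - 1 - t)) := by
  refine ⟨h.1.reverse, fun g' hg' => ?_⟩
  have h1 := h.2 g' hg'
  have h2 : lastNbr G l (fun t => (fun t => g (l - 1 - t)) (l - 1 - t)) = lastNbr G l g :=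
    lastNbr_congr h.1.pos fun t ht => by
      simp only; congr 1; omega
  rw [h2]
  omega

theorem LongestPath.lastNbr_add_lastNbr_lt (h : LongestPath G k l g) (hk : 2 ≤ k)
    (hcyc : ∀ Q, CyclicList G Q → Q.length < 2 * k) :
    lastNbr G l g + lastNbr G l (fun t => g (l - 1 - t)) + 1 ≤ l := by
  obtain ⟨h1, h2⟩ := h.lastNbr_mem (by omega)
  obtain ⟨h3, h4⟩ := h.reverse.lastNbr_mem (by omega)
  have := h.le_of_no_long_cycle hk hcyc h1 h2
    (i' := l - 1 - lastNbr G l fun t => g (l - 1 - t)) (by simpa using h4)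
  omega

/-- Rotation at `j` leaves the part of the path after `g j` in place, hence also the neighbours of
the last vertex counted by the second summand. By extremality the new first vertex `g j` then
reaches no further than `g 0` did. -/
theorem Extremal.rotation_nbrs (h : Extremal G k l g) (hk : 2 ≤ k)
    (hcyc : ∀ Q, CyclicList G Q → Q.length < 2 * k) {j : ℕ} (hj : j + 1 < l)
    (ha : G.Adj (g 0) (g (j + 1))) {x : V} (hx : G.Adj (g j) x) :
    ∃ t ≤ lastNbr G l g, g t = x := by
  have hr := h.1.rotate hj ha
  set g' := fun t => if t ≤ j then g (j - t) else g t with hg'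
  have h1 := h.2 g' hr
  have h2 := h.1.lastNbr_add_lastNbr_lt hk hcyc
  obtain ⟨h3, h4⟩ := h.1.reverse.lastNbr_mem (by omega)
  have hji : j + 1 ≤ lastNbr G l g := le_lastNbr hj ha
  set i := lastNbr G l g
  set r := lastNbr G l (fun t => g (l - 1 - t))
  have h5 : r ≤ lastNbr G l (fun t => g' (l - 1 - t)) := by
    refine le_lastNbr h3 ?_
    simp only [hg']
    rw [if_neg (by omega), if_neg (by omega)]
    exact h4
  obtain ⟨t, _, ht2, ht3⟩ := hr.exists_of_adj_zero (x := x) (by simpa [hg'] using hx)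
  have h6 : t ≤ lastNbr G l g' := le_lastNbr ht2 (by rw [ht3]; simpa [hg'] using hx)
  simp only [hg'] at ht3
  split_ifs at ht3 with h7
  · exact ⟨j - t, by omega, ht3⟩
  · exact ⟨t, by omega, ht3⟩

/-- Since `g i`, the last neighbour of `g 0`, is no cut vertex, some earlier `g j` has a neighbour
beyond the block `g 0, …, g i`. By `rotation_nbrs` this `j` does not precede a neighbour of `g 0`.
So `j` and the `k` predecessors of neighbours are `k + 1` different positions below `i`. -/
theorem Extremal.exists_bridge (h : Extremal G k l g) (hk : 2 ≤ k)
    (hcyc : ∀ Q, CyclicList G Q → Q.length < 2 * k) (h2 : NoCutVertex G) :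
    k + 1 ≤ lastNbr G l g ∧ ∃ j < lastNbr G l g, ∃ z, G.Adj (g j) z ∧
      ∀ t ≤ lastNbr G l g, g t ≠ z := by
  obtain ⟨h3, h4⟩ := h.1.lastNbr_mem (by omega)
  have h5 := h.1.lastNbr_add_lastNbr_lt hk hcyc
  have hr1 : 1 ≤ lastNbr G l (fun t => g (l - 1 - t)) := by
    obtain ⟨h6, h7⟩ := h.1.reverse.lastNbr_mem (by omega)
    by_contra h0
    rw [show lastNbr G l (fun t => g (l - 1 - t)) = 0 by omega] at h7
    exact G.irrefl h7
  have hrot := fun j hj ha x hx => h.rotation_nbrs hk hcyc (j := j) hj ha (x := x) hx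
  set i := lastNbr G l g with hi
  have hi0 : i ≠ 0 := by intro h0; rw [h0] at h4; exact G.irrefl h4
  have hinj := h.1.path.1
  obtain ⟨_, ⟨j, hj, rfl⟩, z, hz1, hz2, hz3⟩ := h2 (g i) {x | ∃ t < i, g t = x}
    (by rintro ⟨t, ht, he⟩; have := hinj _ _ (by omega) (by omega) he; omega)
    ⟨g 0, 0, by omega, rfl⟩
    ⟨g (l - 1), by rintro ⟨t, ht, he⟩; have := hinj _ _ (by omega) (by omega) he; omega,
      fun he => by have := hinj _ _ (by omega) (by omega) he; omega⟩
  have hz : ∀ t ≤ i, g t ≠ z := by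
    intro t ht he
    rcases Nat.lt_or_ge t i with h6 | h6
    · exact hz1 ⟨t, h6, he⟩
    · exact hz2 (by rw [← he, show t = i by omega])
  refine ⟨?_, j, hj, z, hz3, hz⟩
  have hsub : insert j ((Finset.range (l - 1)).filter fun t => G.Adj (g 0) (g (t + 1))) ⊆
      Finset.range i := by
    intro t ht
    rw [Finset.mem_insert] at ht
    rcases ht with rfl | ht
    · simpa using hj
    · simp only [Finset.mem_filter, Finset.mem_range] at ht ⊢
      exact le_lastNbr (by omega) ht.2
  have hnot : j ∉ (Finset.range (l - 1)).filter fun t => G.Adj (g 0) (g (t + 1)) := by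
    intro hmem
    simp only [Finset.mem_filter, Finset.mem_range] at hmem
    obtain ⟨t, ht, he⟩ := hrot j (by omega) hmem.2 z hz3
    exact hz t ht he
  have := Finset.card_le_card hsub
  rw [Finset.card_insert_of_notMem hnot, h.1.card_zero_pred, Finset.card_range] at this
  exact this

/-- If all cycles were shorter than `2 * k`, the end blocks of an extremal path would meet in at
most one vertex, each with at least `k + 2` vertices. With `n ≤ 2k+4` hardly anything remains
outside of them, and the bridges supplied by `exists_bridge` connect the blocks to a long cycle. -/
theorem exists_long_cycle [DecidableEq V] (hk : 2 ≤ k) (hconn : G.Connected)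
    (hreg : G.IsRegularOfDegree k) (hham : ¬ G.IsHamiltonian) (h2 : NoCutVertex G)
    (hn : Fintype.card V ≤ 2 * k + 4) : ∃ Q, CyclicList G Q ∧ 2 * k ≤ Q.length := by
  by_contra hcon
  have hcyc : ∀ Q, CyclicList G Q → Q.length < 2 * k := fun Q hQ => by
    by_contra h; exact hcon ⟨Q, hQ, by omega⟩
  have := hconn.nonempty
  obtain ⟨l, g₀, hl, hg₀, hlong⟩ := exists_longest_path (G := G)
  have hL₀ : LongestPath G k l g₀ :=
    ⟨hl, hg₀, hlong, hreg, fun Q hQ => cyclicList_length_lt hconn hham hlong hQ⟩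
  obtain ⟨g, hg, hmax⟩ := exists_maximal_of_bounded (p := fun g => LongestPath G k l g)
    (φ := fun g => lastNbr G l g + lastNbr G l (fun t => g (l - 1 - t))) (l + l)
    (fun g hg => by
      have := lastNbr_lt (G := G) (g := g) hg.pos
      have := lastNbr_lt (G := G) (g := fun t => g (l - 1 - t)) hg.pos
      omega) ⟨g₀, hL₀⟩
  have hE : Extremal G k l g := ⟨hg, hmax⟩
  obtain ⟨hi1, j, hj, z, hz, hz'⟩ := hE.exists_bridge hk hcyc h2
  obtain ⟨hr1, j', hj', z', hzr, hzr'⟩ := hE.reverse.exists_bridge hk hcyc h2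
  have hir := hg.lastNbr_add_lastNbr_lt hk hcyc
  obtain ⟨hi3, hi4⟩ := hg.lastNbr_mem (by omega)
  obtain ⟨hr3, hr4⟩ := hg.reverse.lastNbr_mem (by omega)
  have himax : ∀ s < l, G.Adj (g 0) (g s) → s ≤ lastNbr G l g := fun s hs h => le_lastNbr hs h
  have hrmin : ∀ s < l, G.Adj (g (l - 1)) (g s) →
      l - 1 - lastNbr G l (fun t => g (l - 1 - t)) ≤ s := by
    intro s hs h
    have : l - 1 - s ≤ lastNbr G l (fun t => g (l - 1 - t)) := le_lastNbr (by omega) (by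
      rw [show l - 1 - (l - 1 - s) = s by omega]; simpa using h)
    omega
  set i := lastNbr G l g
  set r := lastNbr G l (fun t => g (l - 1 - t))
  have hr4' : G.Adj (g (l - 1)) (g (l - 1 - r)) := by simpa using hr4
  have hll := hg.path.card_add_le ∅ (by simp)
  rw [Finset.card_empty] at hll
  have hdirect : ∀ a b, a < i → l - 1 - r < b → b < l → ¬ G.Adj (g a) (g b) := by
    intro a b ha hb hbl hab
    obtain ⟨L, h1, h3, h4, -⟩ := hg.exists_long_trace hi3 hi4 himax hr4' hrmin (by omega) ha hb hbl
    have := hcyc L ⟨by omega, h1, _, _, h3, hab.symm⟩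
    omega
  by_cases hzp : ∃ t < l, g t = z
  -- The bridge cannot end strictly inside the other block (`hdirect`), so it ends between `g i` and
  -- the start `g (l-1-r)` of that block. This forces `l = n = 2k+4` and makes the blocks disjoint
  -- and consecutive. The bridge from the other side must then end at `g i`.
  · obtain ⟨t, ht, rfl⟩ := hzp
    have hti : i < t := by
      by_contra h; exact hz' t (by omega) rfl
    have ht' : ¬ l - 1 - r < t := fun h => hdirect j t hj h ht hz
    have hn' : l = Fintype.card V := by omega
    have hzp' : ∃ t < l, g t = z' := by
      by_contra h
      push Not at h
      have := hg.path.card_add_le {z'} (by simpa using h)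
      rw [Finset.card_singleton] at this
      omega
    obtain ⟨s, hs, rfl⟩ := hzp'
    have hsr : s < l - 1 - r := by
      by_contra h
      refine hzr' (l - 1 - s) (by omega) ?_
      congr 1; omega
    have hsi : ¬ s < i := fun h => hdirect s (l - 1 - j') h (by omega) (by omega) hzr.symm
    obtain ⟨L, h1, h3⟩ := hg.exists_long_cycle_of_two_blocks hk (by omega) hi4 himax hr4' hrmin (by omega) hj
      (t := l - 1 - j') (by omega) (by omega)
      (by rw [show l - 1 - r = t by omega]; exact hz)
      (by rw [show i = s by omega]; exact hzr.symm)
    have := hcyc L h1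
    omega
  -- With `z` off the path, `l = 2k+3` and the blocks share exactly `g i`. As `g i` is no cut
  -- vertex, the first block together with `z` has a further edge into the second block, either
  -- directly or through `z`.
  · push Not at hzp
    have h1 := hg.path.card_add_le {z} (by simpa using hzp)
    rw [Finset.card_singleton] at h1
    have hii : l - 1 - r = i := by omega
    have hinj := hg.path.1
    obtain ⟨x, hx, y, hy1, hy2, hxy⟩ := h2 (g i) ({x | ∃ t < i, g t = x} ∪ {z})
      (by
        rintro (⟨t, ht, he⟩ | h)
        · have := hinj _ _ (by omega) (by omega) he; omega
        · exact hzp i hi3 h)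
      ⟨z, Or.inr rfl⟩
      ⟨g (l - 1), by
        rintro (⟨t, ht, he⟩ | h)
        · have := hinj _ _ (by omega) (by omega) he; omega
        · exact hzp _ (by omega) h, fun he => by
          have := hinj _ _ (by omega) (by omega) he; omega⟩
    have hy : ∃ t < l, g t = y := by
      by_contra h
      push Not at h
      have hzy : z ≠ y := fun h => hy1 (Or.inr h.symm)
      classical
      have := hg.path.card_add_le {z, y} (by
        intro x hx
        rw [Finset.mem_insert, Finset.mem_singleton] at hx
        rcases hx with rfl | rfl
        · exact hzp
        · exact h)
      rw [Finset.card_pair hzy] at this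
      omega
    obtain ⟨t, ht, rfl⟩ := hy
    have hti : i < t := by
      rcases lt_trichotomy t i with h | rfl | h
      · exact absurd (Or.inl ⟨t, h, rfl⟩) hy1
      · exact absurd rfl hy2
      · exact h
    rcases hx with ⟨s, hs, rfl⟩ | hx
    · exact hdirect s t hs (by omega) ht hxy
    · rw [Set.mem_singleton_iff] at hx
      subst hx
      obtain ⟨L, h1, h3, h4, h5⟩ := hg.exists_long_trace hi3 hi4 himax hr4' hrmin (by omega) hj
        (t := t) (by omega) ht
      have hxL : x ∉ L := fun hm => by
        obtain ⟨s, hs, he⟩ := h5 x hm; exact hzp s hs he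
      have := hcyc (x :: L) ⟨by simp; omega, List.nodup_cons.2 ⟨hxL, h1⟩, x, g t,
        h3.cons hz.symm, hxy.symm⟩
      simp at this
      omega

/-- The second neighbour of an end of a longest path is the other end, since an inner vertex would
acquire degree three; the path then closes to a cycle. -/
theorem isHamiltonian_of_isRegularOfDegree_two [DecidableEq V] (hconn : G.Connected)
    (hreg : G.IsRegularOfDegree 2) : G.IsHamiltonian := by
  by_contra hham
  have := hconn.nonempty
  obtain ⟨l, g, hl, hg, hlong⟩ := exists_longest_path (G := G)
  have hL : LongestPath G 2 l g :=
    ⟨hl, hg, hlong, hreg, fun Q hQ => cyclicList_length_lt hconn hham hlong hQ⟩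
  have hl3 := hL.three_le le_rfl
  obtain ⟨t, ht, ht1⟩ := Finset.exists_mem_ne (by rw [hL.card_zero]; omega) 1
  simp only [Finset.mem_filter, Finset.mem_range] at ht
  have ht0 : t ≠ 0 := by rintro rfl; exact G.irrefl ht.2
  rcases Nat.lt_or_ge (t + 1) l with htl | htl
  · have hsub : ({g 0, g (t - 1), g (t + 1)} : Finset V) ⊆ G.neighborFinset (g t) := by
      intro x hx
      simp only [Finset.mem_insert, Finset.mem_singleton] at hx
      rw [SimpleGraph.mem_neighborFinset]
      rcases hx with rfl | rfl | rfl
      · exact ht.2.symm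
      · have := (hg.2 (t - 1) (by omega)).symm
        rwa [show t - 1 + 1 = t by omega] at this
      · exact hg.2 t htl
    have hne : ∀ a b, a < l → b < l → a ≠ b → g a ≠ g b := fun a b ha hb h he =>
      h (hg.1 a b ha hb he)
    have hcard : ({g 0, g (t - 1), g (t + 1)} : Finset V).card = 3 := by
      rw [Finset.card_eq_three]
      exact ⟨_, _, _, hne _ _ (by omega) (by omega) (by omega),
        hne _ _ (by omega) (by omega) (by omega), hne _ _ (by omega) (by omega) (by omega), rfl⟩
    have := Finset.card_le_card hsub
    rw [hcard, SimpleGraph.card_neighborFinset_eq_degree, hreg] at this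
    omega
  · have htl' : t = l - 1 := by omega
    have := hL.cyc (seg g 0 (l - 1)) ⟨by simp; omega,
      seg_nodup_of_lt hg.1 (by omega), _, _, hg.trace (by omega) (by omega), by
        rw [← htl']; exact ht.2.symm⟩
    simp at this
    omega

end Circumference

/-! ### Counting well-spaced sets on a cycle -/

section CyclicCounting

variable {c : ℕ}

/-- The blocks `{i, i+1}` for `i ∈ U`, enlarged to `{i, …, i+p+1}` for `i ∈ D`, are pairwise
disjoint: if two of them met, the start of one would lie inside the other. -/
theorem injOn_add_of_gaps {p : ℕ} {U D : Finset (ZMod c)} (hU : ∀ i ∈ U, i + 1 ∉ U)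
    (hD : ∀ i ∈ D, ∀ j : ℕ, 1 ≤ j → j ≤ p + 1 → i + j ∉ U) (hDU : D ⊆ U)
    {x y : ZMod c × ℕ} (hx : x.1 ∈ U ∧ x.2 ≤ 1 ∨ x.1 ∈ D ∧ x.2 ≤ p + 1)
    (hy : y.1 ∈ U ∧ y.2 ≤ 1 ∨ y.1 ∈ D ∧ y.2 ≤ p + 1) (h : x.1 + x.2 = y.1 + y.2) : x = y := by
  have key : ∀ x y : ZMod c × ℕ, (x.1 ∈ U ∧ x.2 ≤ 1 ∨ x.1 ∈ D ∧ x.2 ≤ p + 1) →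
      (y.1 ∈ U ∧ y.2 ≤ 1 ∨ y.1 ∈ D ∧ y.2 ≤ p + 1) → x.1 + x.2 = y.1 + y.2 → ¬ x.2 < y.2 := by
    rintro ⟨i, j⟩ ⟨i', j'⟩ hx hy h hlt
    simp only at hx hy h hlt
    have hi : i = i' + ((j' - j : ℕ) : ZMod c) := by
      rw [Nat.cast_sub hlt.le]; linear_combination h
    have hiU : i ∈ U := by
      rcases hx with hx | hx
      · exact hx.1
      · exact hDU hx.1
    rcases hy with hy | hy
    · have : j' - j = 1 := by omega
      rw [this, Nat.cast_one] at hi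
      exact hU i' hy.1 (hi ▸ hiU)
    · exact hD i' hy.1 (j' - j) (by omega) (by omega) (hi ▸ hiU)
  have h1 := key x y hx hy h
  have h2 := key y x hy hx h.symm
  have h3 : x.2 = y.2 := by omega
  refine Prod.ext ?_ h3
  rw [h3] at h
  exact add_right_cancel h

variable [NeZero c]

theorem two_mul_card_add_le {p : ℕ} {U D : Finset (ZMod c)} (hU : ∀ i ∈ U, i + 1 ∉ U)
    (hD : ∀ i ∈ D, ∀ j : ℕ, 1 ≤ j → j ≤ p + 1 → i + j ∉ U) (hDU : D ⊆ U) :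
    2 * U.card + p * D.card ≤ c := by
  have hdisj : Disjoint (U ×ˢ Finset.range 2) (D ×ˢ Finset.Ico 2 (p + 2)) := by
    rw [Finset.disjoint_left]
    rintro ⟨i, j⟩ h h'
    simp only [Finset.mem_product, Finset.mem_range, Finset.mem_Ico] at h h'
    omega
  have h1 : ∀ x ∈ U ×ˢ Finset.range 2 ∪ D ×ˢ Finset.Ico 2 (p + 2),
      x.1 ∈ U ∧ x.2 ≤ 1 ∨ x.1 ∈ D ∧ x.2 ≤ p + 1 := by
    intro x hx
    simp only [Finset.mem_union, Finset.mem_product, Finset.mem_range, Finset.mem_Ico] at hx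
    rcases hx with ⟨h1, h2⟩ | ⟨h1, h2⟩
    · exact Or.inl ⟨h1, by omega⟩
    · exact Or.inr ⟨h1, by omega⟩
  have h2 := Finset.card_le_card_of_injOn (s := U ×ˢ Finset.range 2 ∪ D ×ˢ Finset.Ico 2 (p + 2))
    (t := (Finset.univ : Finset (ZMod c))) (fun x => x.1 + (x.2 : ZMod c)) (by simp)
    (fun x hx y hy h => injOn_add_of_gaps hU hD hDU (h1 x hx) (h1 y hy) h)
  rw [Finset.card_union_of_disjoint hdisj, Finset.card_product, Finset.card_product,
    Finset.card_range, Nat.card_Ico, Finset.card_univ, ZMod.card] at h2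
  rw [show p + 2 - 2 = p by omega] at h2
  linarith

/-- In the case of equality the blocks of length `p + 2` tile the cycle, so the next block starts
where the previous one ends. -/
theorem add_mem_of_gaps_of_card_eq {p : ℕ} {A : Finset (ZMod c)}
    (hA : ∀ i ∈ A, ∀ j : ℕ, 1 ≤ j → j ≤ p + 1 → i + j ∉ A) (hc : (p + 2) * A.card = c)
    {i : ZMod c} (hi : i ∈ A) : i + ((p + 2 : ℕ) : ZMod c) ∈ A := by
  have hU : ∀ i ∈ A, i + 1 ∉ A := fun i hi => by
    simpa using hA i hi 1 le_rfl (by omega)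
  have h1 : ∀ x ∈ A ×ˢ Finset.range (p + 2), x.1 ∈ A ∧ x.2 ≤ 1 ∨ x.1 ∈ A ∧ x.2 ≤ p + 1 := by
    intro x hx
    simp only [Finset.mem_product, Finset.mem_range] at hx
    exact Or.inr ⟨hx.1, by omega⟩
  have hinj : Set.InjOn (fun x : ZMod c × ℕ => x.1 + (x.2 : ZMod c))
      (A ×ˢ Finset.range (p + 2) : Finset (ZMod c × ℕ)) :=
    fun x hx y hy h => injOn_add_of_gaps hU hA subset_rfl (h1 x hx) (h1 y hy) h
  have h2 : (A ×ˢ Finset.range (p + 2)).image (fun x => x.1 + (x.2 : ZMod c)) = Finset.univ := by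
    rw [← Finset.card_eq_iff_eq_univ, Finset.card_image_of_injOn hinj, Finset.card_product,
      Finset.card_range, ZMod.card, mul_comm]
    exact hc
  have h3 : i + ((p + 2 : ℕ) : ZMod c) ∈
      (A ×ˢ Finset.range (p + 2)).image (fun x => x.1 + (x.2 : ZMod c)) := by
    rw [h2]; exact Finset.mem_univ _
  obtain ⟨⟨i', j⟩, hm, he⟩ := Finset.mem_image.1 h3
  simp only [Finset.mem_product, Finset.mem_range] at hm he
  rcases Nat.eq_zero_or_pos j with rfl | hj
  · rw [← he]; simpa using hm.1
  · have he' : i' = i + ((p + 2 - j : ℕ) : ZMod c) := by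
      rw [Nat.cast_sub (by omega)]; linear_combination he
    exact absurd (he' ▸ hm.1) (hA i hi _ (by omega) (by omega))

/-- Among the pairs of a point of `A \ B` and a later point of `B`, one at minimal distance has
nothing of `A ∪ B` in between, and that distance exceeds `p + 1`. Thus each change from one kind of
foot to the other costs an extra long gap. -/
theorem exists_change {p : ℕ} (hc : 1 ≤ c) {A B : Finset (ZMod c)}
    (h : ∀ i ∈ A, ∀ j : ℕ, 1 ≤ j → j ≤ p + 1 → i + j ∉ B) (hA : (A \ B).Nonempty)
    (hB : B.Nonempty) : ∃ i ∈ A \ B, ∀ j : ℕ, 1 ≤ j → j ≤ p + 1 → i + j ∉ A ∪ B := by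
  classical
  have hex : ∃ t : ℕ, 1 ≤ t ∧ ∃ i ∈ A \ B, i + (t : ZMod c) ∈ B := by
    obtain ⟨i, hi⟩ := hA
    obtain ⟨b, hb⟩ := hB
    have hne : i ≠ b := by rintro rfl; exact (Finset.mem_sdiff.1 hi).2 hb
    obtain ⟨t, h1, -, h3⟩ := exists_nat_shift hc hne
    exact ⟨t, h1, i, hi, h3 ▸ hb⟩
  obtain ⟨h1, i, hi, hit⟩ := Nat.find_spec hex
  have hmin := fun m (hm : m < Nat.find hex) => Nat.find_min hex hm
  set t := Nat.find hex
  have htp : p + 1 < t := by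
    by_contra hle
    exact h i (Finset.mem_sdiff.1 hi).1 t h1 (by omega) hit
  refine ⟨i, hi, fun j hj1 hj2 hmem => ?_⟩
  have hjB : i + (j : ZMod c) ∉ B := fun hm => hmin j (by omega) ⟨hj1, i, hi, hm⟩
  have hjA : i + (j : ZMod c) ∈ A := (Finset.mem_union.1 hmem).resolve_right hjB
  refine hmin (t - j) (by omega) ⟨by omega, _, Finset.mem_sdiff.2 ⟨hjA, hjB⟩, ?_⟩
  rw [Nat.cast_sub (by omega)]
  simpa using hit

/-- Two sets of feet with gaps of length at least `p + 2` between feet of different kinds. -/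
theorem two_mul_card_union_add_le {p : ℕ} (hc : 1 ≤ c) {A B : Finset (ZMod c)}
    (hAB : ∀ i ∈ A, ∀ j : ℕ, 1 ≤ j → j ≤ p + 1 → i + j ∉ B)
    (hBA : ∀ i ∈ B, ∀ j : ℕ, 1 ≤ j → j ≤ p + 1 → i + j ∉ A)
    (hA : ∀ i ∈ A, i + 1 ∉ A) (hB : ∀ i ∈ B, i + 1 ∉ B) (hA0 : A.Nonempty) (hB0 : B.Nonempty) :
    2 * (A ∪ B).card + p * ((A ∩ B).card + (if A ⊆ B then 0 else 1) + (if B ⊆ A then 0 else 1)) ≤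
      c := by
  classical
  have hU : ∀ i ∈ A ∪ B, i + 1 ∉ A ∪ B := by
    intro i hi hi'
    rw [Finset.mem_union] at hi hi'
    rcases hi with hi | hi <;> rcases hi' with hi' | hi'
    · exact hA i hi hi'
    · exact hAB i hi 1 le_rfl (by omega) (by simpa using hi')
    · exact hBA i hi 1 le_rfl (by omega) (by simpa using hi')
    · exact hB i hi hi'
  set D := (A ∪ B).filter fun i : ZMod c => ∀ j : ℕ, 1 ≤ j → j ≤ p + 1 → i + j ∉ A ∪ B with hDdef
  have hcount := two_mul_card_add_le (p := p) hU (D := D) (fun i hi => (Finset.mem_filter.1 hi).2)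
    (Finset.filter_subset _ _)
  refine le_trans (Nat.add_le_add_left (Nat.mul_le_mul_left _ ?_) _) hcount
  have hint : A ∩ B ⊆ D := by
    intro i hi
    rw [Finset.mem_inter] at hi
    refine Finset.mem_filter.2 ⟨Finset.mem_union_left _ hi.1, fun j h1 h2 h3 => ?_⟩
    rcases Finset.mem_union.1 h3 with h3 | h3
    · exact hBA i hi.2 j h1 h2 h3
    · exact hAB i hi.1 j h1 h2 h3
  have h1 : (if A ⊆ B then 0 else 1) ≤ (D ∩ (A \ B)).card := by
    split_ifs with hsub
    · omega
    · obtain ⟨i, hi, hi'⟩ := exists_change hc hAB (Finset.sdiff_nonempty.2 hsub) hB0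
      refine Finset.card_pos.2 ⟨i, Finset.mem_inter.2 ⟨Finset.mem_filter.2
        ⟨Finset.mem_union_left _ (Finset.mem_sdiff.1 hi).1, hi'⟩, hi⟩⟩
  have h2 : (if B ⊆ A then 0 else 1) ≤ (D ∩ (B \ A)).card := by
    split_ifs with hsub
    · omega
    · obtain ⟨i, hi, hi'⟩ := exists_change hc hBA (Finset.sdiff_nonempty.2 hsub) hA0
      rw [Finset.union_comm] at hi'
      refine Finset.card_pos.2 ⟨i, Finset.mem_inter.2 ⟨Finset.mem_filter.2
        ⟨Finset.mem_union_right _ (Finset.mem_sdiff.1 hi).1, hi'⟩, hi⟩⟩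
  have hd1 : Disjoint (A ∩ B) (D ∩ (A \ B)) := by
    rw [Finset.disjoint_left]; intro i hi hi'
    simp only [Finset.mem_inter, Finset.mem_sdiff] at hi hi'
    exact hi'.2.2 hi.2
  have hd2 : Disjoint (A ∩ B ∪ D ∩ (A \ B)) (D ∩ (B \ A)) := by
    rw [Finset.disjoint_left]; intro i hi hi'
    simp only [Finset.mem_inter, Finset.mem_sdiff, Finset.mem_union] at hi hi'
    rcases hi with hi | hi
    · exact hi'.2.2 hi.1
    · exact hi'.2.2 hi.2.1
  have hsub : A ∩ B ∪ D ∩ (A \ B) ∪ D ∩ (B \ A) ⊆ D :=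
    Finset.union_subset (Finset.union_subset hint Finset.inter_subset_left) Finset.inter_subset_left
  have := Finset.card_le_card hsub
  rw [Finset.card_union_of_disjoint hd2, Finset.card_union_of_disjoint hd1] at this
  omega

end CyclicCounting

/-! ### Feet of a longest path outside of a longest cycle -/

section OutsidePaths

variable {V : Type*} [Fintype V] {G : SimpleGraph V} [DecidableRel G.Adj] {k c p : ℕ}

/-- In the `k`-regular graph `G` the longest cycles have length `c`, and paths outside of a longest
cycle have at most `p + 1` vertices. -/
structure MaxCycle (G : SimpleGraph V) [DecidableRel G.Adj] (k c p : ℕ) : Prop where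
  three : 3 ≤ c
  reg : G.IsRegularOfDegree k
  max : ∀ l, CyclicList G l → l.length ≤ c
  out : ∀ f : ZMod c → V, CycFun G f → ∀ (Q : List V) (u w : V), OffPath f Q → Trace G u w Q →
    Q.length ≤ p + 1

/-- The positions of the neighbours of `u` on the cycle `f`. -/
def nbrPos (G : SimpleGraph V) [DecidableRel G.Adj] [NeZero c] (f : ZMod c → V) (u : V) :
    Finset (ZMod c) := Finset.univ.filter fun i => G.Adj u (f i)

theorem mem_nbrPos [NeZero c] {f : ZMod c → V} {u : V} {i : ZMod c} :
    i ∈ nbrPos G f u ↔ G.Adj u (f i) := by simp [nbrPos]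

variable [NeZero c] {f : ZMod c → V} {Q : List V} {u w : V}

theorem CycFun.card_add_le (hf : CycFun G f) (s : Finset V) (hs : ∀ x ∈ s, ∀ i, f i ≠ x) :
    c + s.card ≤ Fintype.card V := by
  classical
  have h1 : (Finset.univ.image f).card = c := by
    rw [Finset.card_image_of_injective _ hf.1, Finset.card_univ, ZMod.card]
  have h2 : Disjoint (Finset.univ.image f) s := by
    rw [Finset.disjoint_left]
    intro x hx hx'
    obtain ⟨i, _, rfl⟩ := Finset.mem_image.1 hx
    exact hs _ hx' i rfl
  have := Finset.card_union_of_disjoint h2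
  have h3 := Finset.card_le_univ (Finset.univ.image f ∪ s)
  omega

theorem OffPath.card_add_le (hf : CycFun G f) (hQ : OffPath f Q) :
    c + Q.length ≤ Fintype.card V := by
  classical
  have := hf.card_add_le Q.toFinset (fun x hx => hQ.2 x (by simpa using hx))
  rwa [List.toFinset_card_of_nodup hQ.1] at this

theorem MaxCycle.mem_of_adj (h : MaxCycle G k c p) (hf : CycFun G f) (hQ : OffPath f Q)
    (hT : Trace G u w Q) (hl : Q.length = p + 1) {x : V} (hx : G.Adj u x) (hx' : ∀ i, f i ≠ x) :
    x ∈ Q := by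
  by_contra hmem
  have := h.out f hf (x :: Q) x w ⟨List.nodup_cons.2 ⟨hmem, hQ.1⟩, fun y hy => by
    rcases List.mem_cons.1 hy with rfl | hy
    · exact hx'
    · exact hQ.2 y hy⟩ (hT.cons hx.symm)
  simp at this
  omega

/-- By maximality of `Q`, the neighbours of `u` off the cycle lie on `Q`, where at most `p` vertices
are available. -/
theorem MaxCycle.le_card_nbrPos (h : MaxCycle G k c p) (hf : CycFun G f) (hQ : OffPath f Q)
    (hT : Trace G u w Q) (hl : Q.length = p + 1) : k ≤ p + (nbrPos G f u).card := by
  classical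
  have hsub : G.neighborFinset u ⊆ Q.toFinset.erase u ∪ (nbrPos G f u).image f := by
    intro x hx
    rw [SimpleGraph.mem_neighborFinset] at hx
    rw [Finset.mem_union]
    by_cases hx' : ∃ i, f i = x
    · obtain ⟨i, rfl⟩ := hx'
      exact Or.inr (Finset.mem_image_of_mem _ (mem_nbrPos.2 hx))
    · push Not at hx'
      exact Or.inl (Finset.mem_erase.2 ⟨hx.ne', by simpa using h.mem_of_adj hf hQ hT hl hx hx'⟩)
  have h1 := (Finset.card_le_card hsub).trans (Finset.card_union_le _ _)
  rw [SimpleGraph.card_neighborFinset_eq_degree, h.reg, Finset.card_image_of_injective _ hf.1,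
    Finset.card_erase_of_mem (by simpa using hT.left_mem), List.toFinset_card_of_nodup hQ.1] at h1
  omega

theorem MaxCycle.not_mem_of_gap (h : MaxCycle G k c p) (hf : CycFun G f) (hQ : OffPath f Q)
    (hT : Trace G u w Q) (hpc : Q.length < c) :
    ∀ i ∈ nbrPos G f u, ∀ j : ℕ, 1 ≤ j → j ≤ Q.length → i + j ∉ nbrPos G f w := by
  intro i hi j h1 h2 hj
  have := gap hf h.max hQ hT h1 (by omega) (mem_nbrPos.1 hi) (mem_nbrPos.1 hj)
  omega

theorem OffPath.single {u : V} (hu : ∀ i, f i ≠ u) : OffPath f [u] :=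
  ⟨by simp, fun x hx => by rw [List.mem_singleton] at hx; subst hx; exact hu⟩

theorem MaxCycle.add_one_not_mem (h : MaxCycle G k c p) (hf : CycFun G f) (hu : ∀ i, f i ≠ u) :
    ∀ i ∈ nbrPos G f u, i + 1 ∉ nbrPos G f u := by
  intro i hi
  simpa using h.not_mem_of_gap hf (OffPath.single hu) (Trace.single u)
    (by simp; have := h.three; omega) i hi 1 le_rfl (by simp)

theorem MaxCycle.feet_count (h : MaxCycle G k c p) (hf : CycFun G f) (hQ : OffPath f Q)
    (hT : Trace G u w Q) (hl : Q.length = p + 1) (hpc : p + 1 < c)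
    (hA : (nbrPos G f u).Nonempty) (hB : (nbrPos G f w).Nonempty) :
    2 * (nbrPos G f u ∪ nbrPos G f w).card + p * ((nbrPos G f u ∩ nbrPos G f w).card +
      (if nbrPos G f u ⊆ nbrPos G f w then 0 else 1) +
      (if nbrPos G f w ⊆ nbrPos G f u then 0 else 1)) ≤ c := by
  refine two_mul_card_union_add_le (by omega) ?_ ?_
    (h.add_one_not_mem hf (hQ.2 _ hT.left_mem)) (h.add_one_not_mem hf (hQ.2 _ hT.right_mem)) hA hB
  · rw [← hl]; exact h.not_mem_of_gap hf hQ hT (by omega)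
  · have := h.not_mem_of_gap hf hQ.reverse hT.reverse (by simpa [hl] using hpc)
    simpa [hl] using this

theorem Trace.ne_of_two_le (hT : Trace G u w Q) (hn : Q.Nodup) (hl : 2 ≤ Q.length) : u ≠ w := by
  intro he
  have h1 := hT.2.1
  have h2 := hT.2.2
  rw [List.head?_eq_getElem?, List.getElem?_eq_getElem (by omega)] at h1
  rw [List.getLast?_eq_getElem?, List.getElem?_eq_getElem (by omega)] at h2
  have h3 : Q[0] = Q[Q.length - 1] := by
    simp only [Option.some.injEq] at h1 h2
    rw [h1, h2, he]
  have := (List.Nodup.getElem_inj_iff hn).1 h3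
  omega

end OutsidePaths

/-! ### Independence of the vertices off the cycle for `k ≥ 4` -/

section NoOutsideEdge

variable {V : Type*} [Fintype V] {G : SimpleGraph V} [DecidableRel G.Adj] {k c p : ℕ}
  [NeZero c] {f : ZMod c → V} {Q : List V} {u w : V}

/-- For `k ≥ 4`, the ends of a longest outside path have the same, equally spaced, feet. -/
theorem MaxCycle.feet_eq (h : MaxCycle G k c p) (hk : 4 ≤ k) (hp : 1 ≤ p) (hc : 2 * k ≤ c)
    (hn : Fintype.card V ≤ 2 * k + 4) (h3 : Fintype.card V = 2 * k + 3 → Even k)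
    (h4 : Fintype.card V = 2 * k + 4 → Odd k) (hf : CycFun G f) (hQ : OffPath f Q)
    (hT : Trace G u w Q) (hl : Q.length = p + 1) :
    nbrPos G f u = nbrPos G f w ∧ (nbrPos G f u).card + p = k ∧
      (p + 2) * (nbrPos G f u).card = c := by
  have hcn := hQ.card_add_le hf
  have ha := h.le_card_nbrPos hf hQ hT hl
  have hb := h.le_card_nbrPos hf hQ.reverse hT.reverse (by simpa using hl)
  have hcount := h.feet_count hf hQ hT hl (by omega) (Finset.card_pos.1 (by omega))
    (Finset.card_pos.1 (by omega))
  have hui := Finset.card_union_add_card_inter (nbrPos G f u) (nbrPos G f w)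
  have hi1 : (nbrPos G f u ∩ nbrPos G f w).card ≤ (nbrPos G f u).card :=
    Finset.card_le_card Finset.inter_subset_left
  have hi2 : (nbrPos G f u ∩ nbrPos G f w).card ≤ (nbrPos G f w).card :=
    Finset.card_le_card Finset.inter_subset_right
  -- Because `2k ≤ c` and `c + p + 1 ≤ 2k + 4`.
  have hp3 : p ≤ 3 := by omega
  have hpar : k = 4 → Fintype.card V ≤ 11 := by
    intro h'
    by_contra h5
    have := h4 (by omega)
    rw [h'] at this
    exact absurd this (by decide)
  have hpar' : k = 5 → Fintype.card V ≠ 13 := by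
    intro h' h5
    have := h3 (by omega)
    rw [h'] at this
    exact absurd this (by decide)
  by_cases heq : nbrPos G f u = nbrPos G f w
  · rw [← heq, Finset.inter_self, Finset.union_self] at hcount
    simp only [subset_rfl, if_true, add_zero] at hcount
    refine ⟨heq, ?_⟩
    generalize (nbrPos G f u).card = a at *
    -- Here `(p+2)a ≤ c ≤ n-p-1` with `a ≥ k-p`. Together with parity this leaves only the pairs
    -- `(p, k)` equal to `(1,4)`, `(1,5)`, `(2,4)` and `(3,5)`, each with equality throughout.
    interval_cases p <;> omega
  · exfalso
    have hne : ¬ (nbrPos G f u ⊆ nbrPos G f w ∧ nbrPos G f w ⊆ nbrPos G f u) :=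
      fun h => heq (h.1.antisymm h.2)
    have hlt : (nbrPos G f u ∩ nbrPos G f w).card < (nbrPos G f u).card ∨
        (nbrPos G f u ∩ nbrPos G f w).card < (nbrPos G f w).card := by
      by_contra hcon
      push Not at hcon
      have e1 := Finset.eq_of_subset_of_card_le Finset.inter_subset_left hcon.1
      have e2 := Finset.eq_of_subset_of_card_le Finset.inter_subset_right hcon.2
      exact heq (e1.symm.trans e2)
    have hone : 1 ≤ (if nbrPos G f u ⊆ nbrPos G f w then 0 else 1) +
      (if nbrPos G f w ⊆ nbrPos G f u then 0 else 1) := by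
      split_ifs <;> first | omega | (exact absurd ⟨by assumption, by assumption⟩ hne)
    have hcount' : 2 * (nbrPos G f u ∪ nbrPos G f w).card +
        p * ((nbrPos G f u ∩ nbrPos G f w).card + 1) ≤ c :=
      le_trans (Nat.add_le_add_left (Nat.mul_le_mul_left _ (by omega)) _) hcount
    clear hcount
    generalize (nbrPos G f u ∩ nbrPos G f w).card = q at *
    generalize (nbrPos G f u ∪ nbrPos G f w).card = s at *
    generalize (nbrPos G f u).card = a at *
    generalize (nbrPos G f w).card = b at *
    interval_cases p <;> omega

/-- The segment following a foot is adjacent to all feet. -/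
theorem MaxCycle.adj_feet (h : MaxCycle G k c p) (hk : 4 ≤ k) (hp : 1 ≤ p) (hc : 2 * k ≤ c)
    (hn : Fintype.card V ≤ 2 * k + 4) (h3 : Fintype.card V = 2 * k + 3 → Even k)
    (h4 : Fintype.card V = 2 * k + 4 → Odd k) (hf : CycFun G f) (hQ : OffPath f Q)
    (hT : Trace G u w Q) (hl : Q.length = p + 1) {i : ZMod c} (hi : i ∈ nbrPos G f u)
    {r : ℕ} (hr : 1 ≤ r) (hrc : (p + 2) * r ≤ c) :
    G.Adj (f (i + ((p + 2) * r : ℕ))) (f (i + 1)) ∧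
      G.Adj (f (i + ((p + 2) * r : ℕ))) (f (i + (p + 1 : ℕ))) := by
  have hstep : ∀ {f : ZMod c → V} {Q : List V} {u w : V}, CycFun G f → OffPath f Q →
      Trace G u w Q → Q.length = p + 1 → ∀ j ∈ nbrPos G f u,
        j + ((p + 2 : ℕ) : ZMod c) ∈ nbrPos G f u := by
    intro f Q u w hf hQ hT hl j hj
    obtain ⟨h1, -, h2⟩ := h.feet_eq hk hp hc hn h3 h4 hf hQ hT hl
    have hcn := hQ.card_add_le hf
    refine add_mem_of_gaps_of_card_eq ?_ h2 hj
    have := h.not_mem_of_gap hf hQ hT (by omega)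
    rw [← h1, hl] at this
    exact this
  have hcn := hQ.card_add_le hf
  obtain ⟨heq, -, -⟩ := h.feet_eq hk hp hc hn h3 h4 hf hQ hT hl
  have hi2 := hstep hf hQ hT hl i hi
  rw [heq, mem_nbrPos] at hi2
  -- Consecutive feet are `p + 2` apart, so the `p + 1` vertices between `f i` and the next foot can
  -- be exchanged with `Q`. They then form a longest path outside of the longest cycle `f'`, and
  -- their own feet are equally spaced from `f i` on.
  obtain ⟨f', hf', hv1, hv2⟩ := swap_zero (hf.shift i) (hQ.shift i) hT (by omega)
    (by simpa using mem_nbrPos.1 hi) (by rw [hl]; exact hi2)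
  set g : ZMod c → V := fun j => f (i + j) with hg
  have hgf : CycFun G g := hf.shift i
  have hQ' : OffPath f' (seg (fun t : ℕ => g (t : ZMod c)) 1 (p + 1)) := by
    refine ⟨seg_nodup_of_lt hgf.inj_fun (by omega), fun x hx j hj => ?_⟩
    obtain ⟨s, hs1, hs2, rfl⟩ := mem_seg.1 hx
    have hjv : ((j.val : ℕ) : ZMod c) = j := ZMod.natCast_zmod_val j
    have hjlt := ZMod.val_lt j
    rw [← hjv] at hj
    rcases Nat.eq_zero_or_pos j.val with h0 | h0
    · have e := hv1 c (by omega) le_rfl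
      rw [ZMod.natCast_self] at e
      rw [h0, Nat.cast_zero, e] at hj
      have := hgf.inj_nat (i := 0) (j := s) (by omega) (by omega) (by simpa [hg] using hj)
      omega
    · rcases Nat.lt_or_ge Q.length j.val with h5 | h5
      · rw [hv1 _ (by omega) (by omega)] at hj
        have := hgf.inj_nat hjlt (by omega) hj
        omega
      · exact (hQ.shift i).2 _ (hv2 _ h0 h5) _ hj.symm
  have hT' := hgf.trace_seg (a := 1) (b := p + 1) (by omega)
  have hl' : (seg (fun t : ℕ => g (t : ZMod c)) 1 (p + 1)).length = p + 1 := by simp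
  have hf0 : f' 0 = g 0 := by
    have e := hv1 c (by omega) le_rfl
    rwa [ZMod.natCast_self] at e
  have hmem : ∀ r : ℕ, (((p + 2) * r : ℕ) : ZMod c) ∈ nbrPos G f' (g ((1 : ℕ) : ZMod c)) := by
    intro r
    induction r with
    | zero =>
      rw [mem_nbrPos]
      simp only [mul_zero, Nat.cast_zero, hf0]
      have := (hgf.adj_nat 0).symm
      simpa using this
    | succ r ih =>
      have := hstep hf' hQ' hT' hl' _ ih
      rwa [← Nat.cast_add, show (p + 2) * r + (p + 2) = (p + 2) * (r + 1) by ring] at this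
  obtain ⟨heq', -, -⟩ := h.feet_eq hk hp hc hn h3 h4 hf' hQ' hT' hl'
  have hm1 := hmem r
  have hm2 := hmem r
  rw [heq'] at hm2
  rw [mem_nbrPos] at hm1 hm2
  have hpr : p + 2 ≤ (p + 2) * r := Nat.le_mul_of_pos_right _ hr
  rw [hv1 _ (by omega) hrc] at hm1 hm2
  refine ⟨?_, ?_⟩
  · simpa [hg] using hm1.symm
  · simpa [hg] using hm2.symm

/-- If `p ≥ 1`, a foot is adjacent to both ends of each of the `a` segments between feet and to both
ends of `Q`. These are `2a + 2` different vertices, which is too many because `a + p = k` and `p ≤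
3`. -/
theorem MaxCycle.eq_zero_of_four_le (h : MaxCycle G k c p) (hk : 4 ≤ k) (hc : 2 * k ≤ c)
    (hn : Fintype.card V ≤ 2 * k + 4) (h3 : Fintype.card V = 2 * k + 3 → Even k)
    (h4 : Fintype.card V = 2 * k + 4 → Odd k) (hf : CycFun G f) (hQ : OffPath f Q)
    (hT : Trace G u w Q) (hl : Q.length = p + 1) : p = 0 := by
  classical
  by_contra hp0
  have hp : 1 ≤ p := by omega
  have hcn := hQ.card_add_le hf
  have hp3 : p ≤ 3 := by omega
  obtain ⟨heq, hka, hca⟩ := h.feet_eq hk hp hc hn h3 h4 hf hQ hT hl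
  set a := (nbrPos G f u).card with ha
  obtain ⟨i₀, hi₀⟩ : (nbrPos G f u).Nonempty := Finset.card_pos.1 (by omega)
  have hstep : ∀ m : ℕ, i₀ + (((p + 2) * m : ℕ) : ZMod c) ∈ nbrPos G f u := by
    intro m
    induction m with
    | zero => simpa using hi₀
    | succ m ih =>
      have hgap := h.not_mem_of_gap hf hQ hT (by omega)
      rw [← heq, hl] at hgap
      have := add_mem_of_gaps_of_card_eq hgap hca ih
      rwa [add_assoc, ← Nat.cast_add, show (p + 2) * m + (p + 2) = (p + 2) * (m + 1) by ring] at this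
  have hadj : ∀ m < a, ∀ e, (e = 1 ∨ e = p + 1) →
      G.Adj (f i₀) (f (i₀ + (((p + 2) * m + e : ℕ) : ZMod c))) := by
    intro m hm e he
    have hmc : (p + 2) * m + (p + 2) * (a - m) = c := by
      rw [← mul_add, show m + (a - m) = a by omega]; exact hca
    obtain ⟨h5, h6⟩ := h.adj_feet hk hp hc hn h3 h4 hf hQ hT hl (hstep m) (r := a - m) (by omega)
      (by omega)
    rw [add_assoc, ← Nat.cast_add, hmc, ZMod.natCast_self, add_zero] at h5 h6
    rw [Nat.cast_add, ← add_assoc]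
    rcases he with rfl | rfl
    · simpa using h5
    · exact h6
  have huw : u ≠ w := hT.ne_of_two_le hQ.1 (by omega)
  set S : Finset V := (Finset.range a ×ˢ ({1, p + 1} : Finset ℕ)).image
    fun x => f (i₀ + (((p + 2) * x.1 + x.2 : ℕ) : ZMod c)) with hS
  have hScard : S.card = a * 2 := by
    rw [hS, Finset.card_image_of_injOn, Finset.card_product, Finset.card_range,
      Finset.card_pair (by omega)]
    rintro ⟨m, e⟩ hx ⟨m', e'⟩ hx' he
    simp only [Finset.coe_product, Set.mem_prod, Finset.mem_coe, Finset.mem_range,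
      Finset.mem_insert, Finset.mem_singleton] at hx hx'
    have hlt : ∀ m e, m < a → (e = 1 ∨ e = p + 1) → (p + 2) * m + e < c := by
      intro m e hm he
      have : (p + 2) * (m + 1) ≤ (p + 2) * a := Nat.mul_le_mul_left _ (by omega)
      have e2 : (p + 2) * (m + 1) = (p + 2) * m + (p + 2) := by ring
      omega
    have := (hf.shift i₀).inj_nat (hlt _ _ hx.1 hx.2) (hlt _ _ hx'.1 hx'.2) he
    rw [Prod.mk.injEq]
    clear_value a
    interval_cases p <;> omega
  have hsub : insert u (insert w S) ⊆ G.neighborFinset (f i₀) := by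
    intro x hx
    rw [SimpleGraph.mem_neighborFinset]
    rw [Finset.mem_insert, Finset.mem_insert] at hx
    rcases hx with rfl | rfl | hx
    · exact (mem_nbrPos.1 hi₀).symm
    · rw [heq] at hi₀; exact (mem_nbrPos.1 hi₀).symm
    · obtain ⟨⟨m, e⟩, hm, rfl⟩ := Finset.mem_image.1 hx
      simp only [Finset.mem_product, Finset.mem_range, Finset.mem_insert,
        Finset.mem_singleton] at hm
      exact hadj m hm.1 e hm.2
  have hwS : w ∉ S := fun hm => by
    obtain ⟨x, _, he⟩ := Finset.mem_image.1 hm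
    exact hQ.2 w hT.right_mem _ he
  have huS : u ∉ insert w S := fun hm => by
    rcases Finset.mem_insert.1 hm with he | hm
    · exact huw he
    · obtain ⟨x, _, he⟩ := Finset.mem_image.1 hm
      exact hQ.2 u hT.left_mem _ he
  have := Finset.card_le_card hsub
  rw [Finset.card_insert_of_notMem huS, Finset.card_insert_of_notMem hwS, hScard,
    SimpleGraph.card_neighborFinset_eq_degree, h.reg] at this
  clear_value a
  interval_cases p <;> omega

end NoOutsideEdge

/-! ### Independence of the vertices off the cycle for `k = 3` -/

section CubicOutside

variable {V : Type*} [Fintype V] {G : SimpleGraph V} [DecidableRel G.Adj] {k c p : ℕ}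
  [NeZero c] {f : ZMod c → V} {Q : List V} {u w : V}

theorem MaxCycle.sub_one_ne_add_one (h : MaxCycle G k c p) (hf : CycFun G f) (i : ZMod c) :
    f (i - 1) ≠ f (i + 1) := by
  intro he
  have h1 := hf.1 he
  have h2 : ((2 : ℕ) : ZMod c) = ((0 : ℕ) : ZMod c) := by push_cast; linear_combination -h1
  have := ZMod.natCast_inj_of_lt (by have := h.three; omega) (by have := h.three; omega) h2
  omega

/-- In a cubic graph a vertex of the cycle has only one neighbour outside. -/
theorem MaxCycle.nbrPos_disjoint (h : MaxCycle G 3 c p) (hf : CycFun G f) (huw : u ≠ w)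
    (hu : ∀ i, f i ≠ u) (hw : ∀ i, f i ≠ w) : Disjoint (nbrPos G f u) (nbrPos G f w) := by
  classical
  rw [Finset.disjoint_left]
  intro i hi hi'
  rw [mem_nbrPos] at hi hi'
  have hsub : ({u, w, f (i - 1), f (i + 1)} : Finset V) ⊆ G.neighborFinset (f i) := by
    intro x hx
    simp only [Finset.mem_insert, Finset.mem_singleton] at hx
    rw [SimpleGraph.mem_neighborFinset]
    rcases hx with rfl | rfl | rfl | rfl
    · exact hi.symm
    · exact hi'.symm
    · simpa using (hf.2 (i - 1)).symm
    · exact hf.2 i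
  have hcard : ({u, w, f (i - 1), f (i + 1)} : Finset V).card = 4 := by
    rw [Finset.card_insert_of_notMem, Finset.card_insert_of_notMem, Finset.card_pair]
    · exact h.sub_one_ne_add_one hf i
    · simp [(hw _).symm]
    · simp [huw, (hu _).symm]
  have := Finset.card_le_card hsub
  rw [hcard, SimpleGraph.card_neighborFinset_eq_degree, h.reg] at this
  omega

/-- The two sets of feet are disjoint and nonempty, so around the cycle the kind of foot changes at
least once in each direction; this accounts for the two extra `p`. -/
theorem MaxCycle.cubic_feet_count (h : MaxCycle G 3 c p) (hf : CycFun G f) (hQ : OffPath f Q)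
    (hT : Trace G u w Q) (hl : Q.length = p + 1) (hp : 1 ≤ p) (hpc : p + 1 < c)
    (hA : (nbrPos G f u).Nonempty) (hB : (nbrPos G f w).Nonempty) :
    2 * ((nbrPos G f u).card + (nbrPos G f w).card) + p * 2 ≤ c := by
  have hdis := h.nbrPos_disjoint hf (hT.ne_of_two_le hQ.1 (by omega)) (hQ.2 _ hT.left_mem)
    (hQ.2 _ hT.right_mem)
  have hcount := h.feet_count hf hQ hT hl hpc hA hB
  rw [Finset.disjoint_iff_inter_eq_empty.1 hdis, Finset.card_empty,
    Finset.card_union_of_disjoint hdis, if_neg, if_neg] at hcount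
  · exact hcount
  · intro hs
    obtain ⟨i, hi⟩ := hB
    exact Finset.disjoint_left.1 hdis (hs hi) hi
  · intro hs
    obtain ⟨i, hi⟩ := hA
    exact Finset.disjoint_left.1 hdis hi (hs hi)

/-- In a cubic graph on ten vertices, an outside path on four vertices whose first vertex has no
foot yields a cut vertex. -/
theorem MaxCycle.exists_foot_of_four (h : MaxCycle G 3 c p) (hp : p = 3) (hc : c = 6)
    (hn : Fintype.card V = 10) (h2 : NoCutVertex G) (hf : CycFun G f) (hQ : OffPath f Q)
    (hT : Trace G u w Q) (hl : Q.length = p + 1) : (nbrPos G f u).Nonempty := by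
  classical
  subst hp
  rw [Finset.nonempty_iff_ne_empty]
  intro hempty
  have hu0 : ∀ i, ¬ G.Adj u (f i) := fun i hi => by
    have := mem_nbrPos.2 hi
    rw [hempty] at this
    simp at this
  obtain ⟨a, b, y, z, rfl⟩ : ∃ a b y z, Q = [a, b, y, z] := by
    match Q, hl with
    | [a, b, y, z], _ => exact ⟨a, b, y, z, rfl⟩
  have hau : a = u := by simpa using hT.2.1
  have hzw : z = w := by simpa using hT.2.2
  subst hau hzw
  have hch := hT.1
  simp only [List.isChain_cons_cons, List.isChain_singleton, and_true] at hch
  obtain ⟨hab, hby, hyz⟩ := hch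
  have hnd := hQ.1
  simp only [List.nodup_cons, List.mem_cons, List.not_mem_nil, or_false, not_or, List.nodup_nil,
    not_false_eq_true, and_true] at hnd
  obtain ⟨⟨n1, n2, n3⟩, ⟨n4, n5⟩, n6⟩ := hnd
  have hoff : ∀ x, x = a ∨ x = b ∨ x = y ∨ x = z → ∀ i, f i ≠ x := fun x hx =>
    hQ.2 x (by simpa using hx)
  have hrange : ∀ x, (∀ i, f i ≠ x) → x = a ∨ x = b ∨ x = y ∨ x = z := by
    intro x hx
    by_contra hcon
    have := hf.card_add_le (insert x [a, b, y, z].toFinset) (fun v hv => by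
      rcases Finset.mem_insert.1 hv with rfl | hv
      · exact hx
      · exact hQ.2 v (by simpa using hv))
    rw [Finset.card_insert_of_notMem (by simpa using hcon), List.toFinset_card_of_nodup hQ.1] at this
    simp at this
    omega
  -- Without feet, `a` has its three neighbours among the only other vertices off the cycle.
  have hall : G.Adj a y ∧ G.Adj a z := by
    have hsub : G.neighborFinset a ⊆ {b, y, z} := by
      intro x hx
      rw [SimpleGraph.mem_neighborFinset] at hx
      rcases hrange x (fun i hi => hu0 i (hi ▸ hx)) with rfl | rfl | rfl | rfl
      · exact absurd hx G.irrefl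
      all_goals simp
    have hc3 : ({b, y, z} : Finset V).card = 3 := by
      rw [Finset.card_eq_three]; exact ⟨b, y, z, n4, n5, n6, rfl⟩
    have heq := Finset.eq_of_subset_of_card_le hsub (by
      rw [hc3, SimpleGraph.card_neighborFinset_eq_degree, h.reg])
    constructor
    · rw [← SimpleGraph.mem_neighborFinset, heq]; simp
    · rw [← SimpleGraph.mem_neighborFinset, heq]; simp
  obtain ⟨hay, haz⟩ := hall
  have hpair : ∀ q r s t, G.Adj q r → G.Adj r s → G.Adj s t →
      [q, r, s, t].Nodup → (∀ x ∈ [q, r, s, t], x = a ∨ x = b ∨ x = y ∨ x = z) →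
      ∀ i j, G.Adj q (f i) → ¬ G.Adj t (f j) := by
    -- Any two of `b`, `y`, `z` are the ends of a path through all four outside vertices. If both
    -- had feet, `cubic_feet_count` would require `2 * 2 + 3 * 2 = 10` vertices on a cycle of length
    -- six. So at most one of the three has feet, and it is a cut vertex.
    intro q r s t h1 h3 h4 h5 h6 i j hi hj
    have hQ' : OffPath f [q, r, s, t] := ⟨h5, fun x hx => hoff x (h6 x hx)⟩
    have hT' : Trace G q t [q, r, s, t] := ⟨by simp [h1, h3, h4], rfl, rfl⟩
    have := h.cubic_feet_count hf hQ' hT' rfl (by omega) (by omega) ⟨i, mem_nbrPos.2 hi⟩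
      ⟨j, mem_nbrPos.2 hj⟩
    have e1 : 1 ≤ (nbrPos G f q).card := Finset.card_pos.2 ⟨i, mem_nbrPos.2 hi⟩
    have e2 : 1 ≤ (nbrPos G f t).card := Finset.card_pos.2 ⟨j, mem_nbrPos.2 hj⟩
    omega
  have hzb : ∀ i j, G.Adj z (f i) → ¬ G.Adj b (f j) :=
    fun i j hi hj => hpair b y a z hby hay.symm haz (by simp; grind) (by simp) j i hj hi
  have hyb : ∀ i j, G.Adj b (f i) → ¬ G.Adj y (f j) :=
    fun i j hi hj => hpair b a z y hab.symm haz hyz.symm (by simp; grind) (by simp) i j hi hj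
  have hyz' : ∀ i j, G.Adj y (f i) → ¬ G.Adj z (f j) :=
    fun i j hi hj => hpair y b a z hby.symm hab.symm haz (by simp; grind) (by simp) i j hi hj
  have hcut : ∀ v, v ≠ a → (∀ x, x = a ∨ x = b ∨ x = y ∨ x = z → x ≠ v → ∀ i, ¬ G.Adj x (f i)) →
      (∀ i, f i ≠ v) → False := by
    intro v hv1 hv2 hv3
    obtain ⟨x, ⟨hx1, hx2⟩, x', hx3, hx4, hx5⟩ := h2 v {x | (x = a ∨ x = b ∨ x = y ∨ x = z) ∧ x ≠ v}
      (fun hm => hm.2 rfl) ⟨a, Or.inl rfl, hv1.symm⟩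
      ⟨f 0, fun hm => hoff _ hm.1 0 rfl, hv3 0⟩
    by_cases hx' : ∃ i, f i = x'
    · obtain ⟨i, rfl⟩ := hx'
      exact hv2 x hx1 hx2 i hx5
    · push Not at hx'
      exact hx3 ⟨hrange x' hx', hx4⟩
  by_cases e1 : ∃ i, G.Adj b (f i)
  · obtain ⟨i, hi⟩ := e1
    refine hcut b (Ne.symm n1) ?_ (hoff b (by simp))
    rintro x (rfl | rfl | rfl | rfl) hne j hj
    · exact hu0 j hj
    · exact hne rfl
    · exact hyb i j hi hj
    · exact hzb j i hj hi
  · push Not at e1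
    by_cases e2 : ∃ i, G.Adj y (f i)
    · obtain ⟨i, hi⟩ := e2
      refine hcut y (Ne.symm n2) ?_ (hoff y (by simp))
      rintro x (rfl | rfl | rfl | rfl) hne j hj
      · exact hu0 j hj
      · exact e1 j hj
      · exact hne rfl
      · exact hyz' i j hi hj
    · push Not at e2
      refine hcut z (Ne.symm n3) ?_ (hoff z (by simp))
      rintro x (rfl | rfl | rfl | rfl) hne j hj
      · exact hu0 j hj
      · exact e1 j hj
      · exact e2 j hj
      · exact hne rfl

/-- Once both ends have feet, `cubic_feet_count` requires a cycle of length at least `10`, `8`, `10`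
for `p = 1, 2, 3`, while only `9 - p` vertices are available. -/
theorem MaxCycle.eq_zero_of_eq_three (h : MaxCycle G 3 c p) (hc : 6 ≤ c)
    (hn : Fintype.card V ≤ 10) (h2 : NoCutVertex G) (hf : CycFun G f)
    (hQ : OffPath f Q) (hT : Trace G u w Q) (hl : Q.length = p + 1) : p = 0 := by
  by_contra hp0
  have hcn := hQ.card_add_le hf
  have ha := h.le_card_nbrPos hf hQ hT hl
  have hlr : Q.reverse.length = p + 1 := by simpa using hl
  have hb := h.le_card_nbrPos hf hQ.reverse hT.reverse hlr
  have hne : (nbrPos G f u).Nonempty ∧ (nbrPos G f w).Nonempty := by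
    by_cases hp3 : p = 3
    · exact ⟨h.exists_foot_of_four hp3 (by omega) (by omega) h2 hf hQ hT hl,
        h.exists_foot_of_four hp3 (by omega) (by omega) h2 hf hQ.reverse hT.reverse hlr⟩
    · exact ⟨Finset.card_pos.1 (by omega), Finset.card_pos.1 (by omega)⟩
  have hcount := h.cubic_feet_count hf hQ hT hl (by omega) (by omega) hne.1 hne.2
  have e1 := Finset.card_pos.2 hne.1
  have e2 := Finset.card_pos.2 hne.2
  omega

end CubicOutside

/-! ### Degree sums and independent sets -/

section EdgeCounting

variable {V : Type*} [Fintype V] [DecidableEq V] {G : SimpleGraph V} [DecidableRel G.Adj] {k : ℕ}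

/-- The number of neighbours of `x` in `T`. -/
def nbrsIn (G : SimpleGraph V) [DecidableRel G.Adj] (x : V) (T : Finset V) : ℕ :=
  (T.filter fun y => G.Adj x y).card

theorem sum_nbrsIn_comm (S T : Finset V) :
    ∑ x ∈ S, nbrsIn G x T = ∑ y ∈ T, nbrsIn G y S := by
  have := Finset.sum_card_bipartiteAbove_eq_sum_card_bipartiteBelow (s := S) (t := T) G.Adj
  simp only [Finset.bipartiteAbove, Finset.bipartiteBelow] at this
  simp only [nbrsIn, this]
  refine Finset.sum_congr rfl fun y _ => ?_
  simp only [G.adj_comm]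

theorem nbrsIn_add_compl (hreg : G.IsRegularOfDegree k) (x : V) (T : Finset V) :
    nbrsIn G x T + nbrsIn G x Tᶜ = k := by
  rw [← hreg x, ← SimpleGraph.card_neighborFinset_eq_degree, nbrsIn, nbrsIn,
    ← Finset.card_union_of_disjoint]
  · congr 1
    ext y
    by_cases hy : y ∈ T <;> simp [hy]
  · exact Finset.disjoint_filter_filter disjoint_compl_right

theorem nbrsIn_eq_zero {x : V} {T : Finset V} (h : ∀ y ∈ T, ¬ G.Adj x y) : nbrsIn G x T = 0 := by
  rw [nbrsIn, Finset.card_eq_zero, Finset.filter_eq_empty_iff]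
  exact fun y hy => h y hy

/-- Degree sum of the complement of an independent set in a regular graph. -/
theorem sum_nbrsIn_compl (hreg : G.IsRegularOfDegree k) {I : Finset V}
    (hI : ∀ x ∈ I, ∀ y ∈ I, ¬ G.Adj x y) :
    ∑ x ∈ Iᶜ, nbrsIn G x Iᶜ + k * I.card = k * Iᶜ.card := by
  have h1 : ∑ x ∈ Iᶜ, nbrsIn G x I = k * I.card := by
    rw [sum_nbrsIn_comm, Finset.sum_const_nat (m := k), mul_comm]
    intro x hx
    have := nbrsIn_add_compl hreg x I
    rw [nbrsIn_eq_zero (hI x hx)] at this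
    omega
  rw [← h1, ← Finset.sum_add_distrib, Finset.sum_const_nat (m := k), mul_comm]
  intro x _
  have := nbrsIn_add_compl hreg x I
  omega

/-- In the degree sum of the graph induced on `W`, every edge between `Z` and `W \ Z` is counted
once from either end; only the edges inside `Z` need the correction term. -/
theorem two_mul_sum_nbrsIn_le {Z W : Finset V} (h : Z ⊆ W) :
    2 * ∑ z ∈ Z, nbrsIn G z W ≤ ∑ x ∈ W, nbrsIn G x W + ∑ z ∈ Z, nbrsIn G z Z := by
  have h1 : ∑ x ∈ W \ Z, nbrsIn G x Z ≤ ∑ x ∈ W \ Z, nbrsIn G x W :=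
    Finset.sum_le_sum fun x _ => Finset.card_le_card (Finset.filter_subset_filter _ h)
  have h2 := Finset.sum_sdiff h (f := fun x => nbrsIn G x W)
  have h3 := Finset.sum_sdiff h (f := fun x => nbrsIn G x Z)
  have h4 := sum_nbrsIn_comm (G := G) W Z
  omega

end EdgeCounting

/-! ### One vertex off the cycle and the gaps between its feet -/

section IndependentOutside

variable {V : Type*} [Fintype V] [DecidableEq V] {G : SimpleGraph V} [DecidableRel G.Adj]
  {k c : ℕ} [NeZero c] {f : ZMod c → V} {v w : V}

theorem MaxCycle.card_nbrPos (h : MaxCycle G k c 0) (hf : CycFun G f) (hv : ∀ i, f i ≠ v) :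
    (nbrPos G f v).card = k := by
  refine le_antisymm ?_ (by simpa using h.le_card_nbrPos hf (OffPath.single hv) (Trace.single v) rfl)
  rw [← h.reg v, ← SimpleGraph.card_neighborFinset_eq_degree,
    ← Finset.card_image_of_injective _ hf.1]
  refine Finset.card_le_card fun x hx => ?_
  obtain ⟨i, hi, rfl⟩ := Finset.mem_image.1 hx
  simpa using mem_nbrPos.1 hi

theorem MaxCycle.not_adj_outside (h : MaxCycle G k c 0) (hf : CycFun G f) (hv : ∀ i, f i ≠ v)
    (hw : ∀ i, f i ≠ w) : ¬ G.Adj v w := by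
  intro hadj
  have := h.out f hf [v, w] v w ⟨by simpa using hadj.ne, by
    intro x hx
    simp only [List.mem_cons, List.not_mem_nil, or_false] at hx
    rcases hx with rfl | rfl
    · exact hv
    · exact hw⟩ ⟨by simpa using hadj, rfl, rfl⟩
  simp at this

theorem MaxCycle.succ_not_adj (h : MaxCycle G k c 0) (hf : CycFun G f) (hv : ∀ i, f i ≠ v)
    {i j : ZMod c} (hi : i ∈ nbrPos G f v) (hj : j ∈ nbrPos G f v) :
    ¬ G.Adj (f (i + 1)) (f (j + 1)) := by
  rcases eq_or_ne i j with rfl | hij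
  · exact G.irrefl
  · exact _root_.succ_not_adj hf h.max (by have := h.three; omega) (OffPath.single hv)
      (Trace.single v) hij (mem_nbrPos.1 hi) (mem_nbrPos.1 hj)

theorem MaxCycle.pred_not_adj (h : MaxCycle G k c 0) (hf : CycFun G f) (hv : ∀ i, f i ≠ v)
    {i j : ZMod c} (hi : i ∈ nbrPos G f v) (hj : j ∈ nbrPos G f v) :
    ¬ G.Adj (f (i - 1)) (f (j - 1)) := by
  rcases eq_or_ne i j with rfl | hij
  · exact G.irrefl
  · exact _root_.pred_not_adj hf h.max (by have := h.three; omega) (OffPath.single hv)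
      (Trace.single v) hij (mem_nbrPos.1 hi) (mem_nbrPos.1 hj)

/-- If `v` is adjacent to both sides of a vertex of the cycle, this vertex can be exchanged with
`v`; hence it has no neighbours outside. -/
theorem MaxCycle.hop_not_adj (h : MaxCycle G k c 0) (hf : CycFun G f)
    (hv : ∀ i, f i ≠ v) (hw : ∀ i, f i ≠ w) {i : ZMod c} (hi : i ∈ nbrPos G f v)
    (hi2 : i + 2 ∈ nbrPos G f v) : ¬ G.Adj w (f (i + 1)) := by
  have h3 := h.three
  rcases eq_or_ne w v with rfl | hwv
  · intro hadj
    exact h.add_one_not_mem hf hv i hi (mem_nbrPos.2 hadj)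
  obtain ⟨f', hf', hv1, hv2⟩ := swap_zero (hf.shift i) ((OffPath.single hv).shift i) (Trace.single v)
    (by simp; omega) (by simpa using mem_nbrPos.1 hi) (by
      have := mem_nbrPos.1 hi2
      simpa [show (1 : ZMod c) + 1 = 2 by norm_num] using this)
  simp only [List.length_singleton] at hv1 hv2
  have hf1 : f' ((1 : ℕ) : ZMod c) = v := by simpa using hv2 1 le_rfl le_rfl
  have hcov : ∀ j, f' j = v ∨ ∃ s : ℕ, 2 ≤ s ∧ s ≤ c ∧ f' j = f (i + s) := by
    intro j
    have hjlt := ZMod.val_lt j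
    have hjv : ((j.val : ℕ) : ZMod c) = j := ZMod.natCast_zmod_val j
    rcases Nat.lt_or_ge 1 j.val with h5 | h5
    · right
      refine ⟨j.val, h5, hjlt.le, ?_⟩
      have := hv1 j.val (by omega) hjlt.le
      rwa [hjv] at this ⊢
    · rcases Nat.eq_zero_or_pos j.val with h0 | h0
      · right
        refine ⟨c, by omega, le_rfl, ?_⟩
        have := hv1 c (by omega) le_rfl
        rw [h0, Nat.cast_zero] at hjv
        rwa [ZMod.natCast_self, hjv] at this ⊢
      · left
        rw [← hjv, show j.val = 1 by omega]; exact hf1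
  have ho1 : ∀ j, f' j ≠ f (i + 1) := by
    intro j hj
    rcases hcov j with e | ⟨s, hs1, hs2, e⟩
    · exact hv (i + 1) (by rw [← hj, e])
    · rw [e] at hj
      rcases hs2.lt_or_eq with hs | rfl
      · have := (hf.shift i).inj_nat (i := s) (j := 1) hs (by omega) (by simpa using hj)
        omega
      · have := (hf.shift i).inj_nat (i := 0) (j := 1) (by omega) (by omega) (by simpa using hj)
        omega
  have ho2 : ∀ j, f' j ≠ w := by
    intro j hj
    rcases hcov j with e | ⟨s, hs1, hs2, e⟩
    · exact hwv (by rw [← hj, e])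
    · exact hw _ (by rw [← e, hj])
  exact h.not_adj_outside hf' ho2 ho1

/-- The independent set formed by `v` and the successors of its neighbours. -/
def succSet (G : SimpleGraph V) [DecidableRel G.Adj] (f : ZMod c → V) (v : V) : Finset V :=
  insert v ((nbrPos G f v).image fun i => f (i + 1))

theorem mem_succSet {x : V} :
    x ∈ succSet G f v ↔ x = v ∨ ∃ i ∈ nbrPos G f v, f (i + 1) = x := by
  simp [succSet]

theorem MaxCycle.succSet_indep (h : MaxCycle G k c 0) (hf : CycFun G f) (hv : ∀ i, f i ≠ v) :
    ∀ x ∈ succSet G f v, ∀ y ∈ succSet G f v, ¬ G.Adj x y := by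
  intro x hx y hy hadj
  rcases mem_succSet.1 hx with rfl | ⟨i, hi, rfl⟩ <;>
    rcases mem_succSet.1 hy with rfl | ⟨j, hj, rfl⟩
  · exact G.irrefl hadj
  · exact h.add_one_not_mem hf hv j hj (mem_nbrPos.2 hadj)
  · exact h.add_one_not_mem hf hv i hi (mem_nbrPos.2 hadj.symm)
  · exact h.succ_not_adj hf hv hi hj hadj

theorem MaxCycle.card_succSet (h : MaxCycle G k c 0) (hf : CycFun G f) (hv : ∀ i, f i ≠ v) :
    (succSet G f v).card = k + 1 := by
  rw [succSet, Finset.card_insert_of_notMem, Finset.card_image_of_injective, h.card_nbrPos hf hv]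
  · intro i j hij; simpa using hf.1 hij
  · intro hm
    obtain ⟨i, _, hi⟩ := Finset.mem_image.1 hm
    exact hv _ hi

/-- The neighbours of `v` followed by a segment of more than one vertex. -/
def longGaps (G : SimpleGraph V) [DecidableRel G.Adj] (f : ZMod c → V) (v : V) : Finset (ZMod c) :=
  (nbrPos G f v).filter fun i => i + 2 ∉ nbrPos G f v

/-- The neighbours of `v` preceded by a segment of more than one vertex. -/
def longGapsRev (G : SimpleGraph V) [DecidableRel G.Adj] (f : ZMod c → V) (v : V) :
    Finset (ZMod c) :=
  (nbrPos G f v).filter fun i => i - 2 ∉ nbrPos G f v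

theorem card_longGapsRev : (longGapsRev G f v).card = (longGaps G f v).card := by
  have h1 := Finset.card_filter_add_card_filter_not (s := nbrPos G f v)
    (fun i => i + 2 ∈ nbrPos G f v)
  have h2 := Finset.card_filter_add_card_filter_not (s := nbrPos G f v)
    (fun i => i - 2 ∈ nbrPos G f v)
  have h3 : ((nbrPos G f v).filter fun i => i + 2 ∈ nbrPos G f v).card =
      ((nbrPos G f v).filter fun i => i - 2 ∈ nbrPos G f v).card := by
    refine Finset.card_bij (fun i _ => i + 2) ?_ ?_ ?_
    · intro i hi
      rw [Finset.mem_filter] at hi ⊢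
      exact ⟨hi.2, by simpa using hi.1⟩
    · intro a _ b _ hab; simpa using hab
    · intro i hi
      rw [Finset.mem_filter] at hi
      exact ⟨i - 2, Finset.mem_filter.2 ⟨hi.2, by simpa using hi.1⟩, by simp⟩
  unfold longGaps longGapsRev
  omega

/-- Each of the `k` gaps takes at least two steps, a long one at least three. -/
theorem MaxCycle.two_mul_add_card_longGaps_le (h : MaxCycle G k c 0) (hf : CycFun G f)
    (hv : ∀ i, f i ≠ v) : 2 * k + (longGaps G f v).card ≤ c := by
  have := two_mul_card_add_le (p := 1) (h.add_one_not_mem hf hv) (D := longGaps G f v) ?_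
    (Finset.filter_subset _ _)
  · rwa [h.card_nbrPos hf hv, one_mul] at this
  · intro i hi j h1 h2
    have hi' := Finset.mem_filter.1 hi
    interval_cases j
    · simpa using h.add_one_not_mem hf hv i hi'.1
    · simpa using hi'.2

/-- If the neighbours of `x` in `succSet` lie in long gaps, it has few of them. -/
theorem nbrsIn_succSet_le {x : V} (hxv : ¬ G.Adj x v)
    (hx : ∀ i ∈ nbrPos G f v, i + 2 ∈ nbrPos G f v → ¬ G.Adj x (f (i + 1))) :
    nbrsIn G x (succSet G f v) ≤ (longGaps G f v).card := by
  refine le_trans (Finset.card_le_card (t := (longGaps G f v).image fun i => f (i + 1)) ?_)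
    Finset.card_image_le
  intro y hy
  rw [Finset.mem_filter, mem_succSet] at hy
  obtain ⟨rfl | ⟨i, hi, rfl⟩, hadj⟩ := hy
  · exact absurd hadj hxv
  · exact Finset.mem_image_of_mem _ (Finset.mem_filter.2 ⟨hi, fun h2 => hx i hi h2 hadj⟩)

theorem MaxCycle.nbrsIn_outside_le (h : MaxCycle G k c 0) (hf : CycFun G f)
    (hv : ∀ i, f i ≠ v) (hw : ∀ i, f i ≠ w) :
    nbrsIn G w (succSet G f v) ≤ (longGaps G f v).card :=
  nbrsIn_succSet_le (h.not_adj_outside hf hw hv) fun _ hi hi2 => h.hop_not_adj hf hv hw hi hi2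

/-- The single vertex of a short gap is both a successor and a predecessor of a foot. Predecessors
of feet are mutually non-adjacent, so `f (i - 1)` has no neighbour in a short gap. -/
theorem MaxCycle.nbrsIn_pred_le (h : MaxCycle G k c 0) (hf : CycFun G f)
    (hv : ∀ i, f i ≠ v) {i : ZMod c} (hi : i ∈ longGapsRev G f v) :
    nbrsIn G (f (i - 1)) (succSet G f v) ≤ (longGaps G f v).card := by
  have hi' := Finset.mem_filter.1 hi
  refine nbrsIn_succSet_le (fun hadj => ?_) fun j hj hj2 hadj => ?_
  · have := h.add_one_not_mem hf hv (i - 1) (mem_nbrPos.2 hadj.symm)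
    simp [hi'.1] at this
  · refine h.pred_not_adj hf hv hi'.1 hj2 ?_
    rwa [show j + 2 - 1 = j + 1 by ring]

theorem MaxCycle.pred_not_mem_succSet (hf : CycFun G f)
    (hv : ∀ i, f i ≠ v) {i : ZMod c} (hi : i ∈ longGapsRev G f v) :
    f (i - 1) ∉ succSet G f v := by
  intro hm
  rcases mem_succSet.1 hm with e | ⟨j, hj, e⟩
  · exact hv _ e
  · have := hf.1 e
    refine (Finset.mem_filter.1 hi).2 ?_
    rwa [show i - 2 = j by linear_combination -this]

/-- The degree sum in the complement of `succSet`. -/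
theorem MaxCycle.sum_nbrsIn (h : MaxCycle G k c 0) (hf : CycFun G f) (hv : ∀ i, f i ≠ v) {m : ℕ}
    (hm : Fintype.card V = 2 * k + 1 + m) :
    ∑ x ∈ (succSet G f v)ᶜ, nbrsIn G x (succSet G f v)ᶜ + k = k * m := by
  have h1 := sum_nbrsIn_compl h.reg (h.succSet_indep hf hv)
  rw [Finset.card_compl, h.card_succSet hf hv, hm,
    show 2 * k + 1 + m - (k + 1) = k + m by omega] at h1
  linarith [mul_add k k m, mul_add k k 1]

/-- Without long gaps the feet alternate with their successors and `c = 2k`. The other vertices `Z`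
off the cycle, at least `m` where `n = 2k+1+m`, are independent and have no neighbour in `succSet`.
So their edges alone contribute `2mk` to the degree sum `k(m-1)` of the complement. -/
theorem MaxCycle.longGaps_nonempty (h : MaxCycle G k c 0) (hk : 2 ≤ k) (hf : CycFun G f)
    (hv : ∀ i, f i ≠ v) : (longGaps G f v).card ≠ 0 := by
  intro h0
  have hclosed : ∀ i ∈ nbrPos G f v, i + 2 ∈ nbrPos G f v := by
    intro i hi
    by_contra h2
    rw [Finset.card_eq_zero] at h0
    have : i ∈ longGaps G f v := Finset.mem_filter.2 ⟨hi, h2⟩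
    rw [h0] at this
    simp at this
  have hA := h.card_nbrPos hf hv
  obtain ⟨i₀, hi₀⟩ : (nbrPos G f v).Nonempty := Finset.card_pos.1 (by omega)
  have hall : ∀ t : ℕ, i₀ + (t : ZMod c) ∈ nbrPos G f v ∪ (nbrPos G f v).image (· + 1) := by
    intro t
    induction t with
    | zero => exact Finset.mem_union_left _ (by simpa using hi₀)
    | succ t ih =>
      rcases Finset.mem_union.1 ih with h1 | h1
      · refine Finset.mem_union_right _ (Finset.mem_image.2 ⟨_, h1, ?_⟩)
        push_cast; ring
      · obtain ⟨j, hj, e⟩ := Finset.mem_image.1 h1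
        refine Finset.mem_union_left _ ?_
        have := hclosed j hj
        rwa [show j + 2 = i₀ + ((t + 1 : ℕ) : ZMod c) by push_cast; linear_combination e] at this
  have hc : c ≤ 2 * k := by
    have huniv : (Finset.univ : Finset (ZMod c)) ⊆
        nbrPos G f v ∪ (nbrPos G f v).image (· + 1) := by
      intro j _
      have := hall (j - i₀).val
      simpa using this
    have h1 := (Finset.card_le_card huniv).trans (Finset.card_union_le _ _)
    have h2 : ((nbrPos G f v).image (· + 1)).card ≤ _ := Finset.card_image_le
    rw [Finset.card_univ, ZMod.card] at h1
    omega
  set Z : Finset V := Finset.univ.filter fun x => (∀ i, f i ≠ x) ∧ x ≠ v with hZ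
  have hZcard : Fintype.card V ≤ c + 1 + Z.card := by
    have hsub : (Finset.univ : Finset V) ⊆ Finset.univ.image f ∪ {v} ∪ Z := by
      intro x _
      simp only [Finset.mem_union, Finset.mem_image, Finset.mem_univ, true_and,
        Finset.mem_singleton, hZ, Finset.mem_filter]
      by_cases hx : ∃ i, f i = x
      · exact Or.inl (Or.inl hx)
      · push Not at hx
        by_cases hxv : x = v
        · exact Or.inl (Or.inr hxv)
        · exact Or.inr ⟨hx, hxv⟩
    have h1 := (Finset.card_le_card hsub).trans (Finset.card_union_le _ _)
    have h2 := Finset.card_union_le (Finset.univ.image f) {v}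
    have h3 : (Finset.univ.image f).card = c := by
      rw [Finset.card_image_of_injective _ hf.1, Finset.card_univ, ZMod.card]
    rw [Finset.card_univ] at h1
    rw [Finset.card_singleton] at h2
    omega
  have hcn := hf.card_add_le {v} (by simpa using hv)
  rw [Finset.card_singleton] at hcn
  have h2c := h.two_mul_add_card_longGaps_le hf hv
  obtain ⟨m, hm⟩ : ∃ m, Fintype.card V = 2 * k + 1 + m := ⟨Fintype.card V - (2 * k + 1), by omega⟩
  have hsum := h.sum_nbrsIn hf hv hm
  have hZoff : ∀ x ∈ Z, (∀ i, f i ≠ x) ∧ x ≠ v := fun x hx => (Finset.mem_filter.1 hx).2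
  have hZW : Z ⊆ (succSet G f v)ᶜ := by
    intro x hx
    rw [Finset.mem_compl, mem_succSet]
    rintro (e | ⟨i, _, e⟩)
    · exact (hZoff x hx).2 e
    · exact (hZoff x hx).1 _ e
  have h5 := two_mul_sum_nbrsIn_le (G := G) hZW
  have h6 : ∑ z ∈ Z, nbrsIn G z Z = 0 := Finset.sum_eq_zero fun z hz =>
    nbrsIn_eq_zero fun y hy => h.not_adj_outside hf (hZoff z hz).1 (hZoff y hy).1
  have h7 : ∑ z ∈ Z, nbrsIn G z (succSet G f v)ᶜ = Z.card * k := by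
    refine Finset.sum_const_nat fun z hz => ?_
    have e1 := nbrsIn_add_compl h.reg z (succSet G f v)
    have e2 := h.nbrsIn_outside_le hf hv (hZoff z hz).1
    omega
  have h8 : m * k ≤ Z.card * k := Nat.mul_le_mul_right _ (by omega)
  rw [h6, h7] at h5
  have h9 : k * m = m * k := mul_comm _ _
  omega

/-- The last vertices of the `d` long gaps are independent, lie outside `succSet`, and have at least
`k - d` neighbours there. Their edges account for `2d(k-d)` in the degree sum `k(m-1)`. -/
theorem MaxCycle.longGaps_mul_le (h : MaxCycle G k c 0) (hf : CycFun G f)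
    (hv : ∀ i, f i ≠ v) {m : ℕ} (hm : Fintype.card V = 2 * k + 1 + m) :
    2 * ((longGaps G f v).card * (k - (longGaps G f v).card)) + k ≤ k * m := by
  have hsum := h.sum_nbrsIn hf hv hm
  set Z : Finset V := (longGapsRev G f v).image fun i => f (i - 1) with hZ
  have hZW : Z ⊆ (succSet G f v)ᶜ := by
    intro x hx
    obtain ⟨i, hi, rfl⟩ := Finset.mem_image.1 hx
    exact Finset.mem_compl.2 (MaxCycle.pred_not_mem_succSet hf hv hi)
  have h5 := two_mul_sum_nbrsIn_le (G := G) hZW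
  have h6 : ∑ z ∈ Z, nbrsIn G z Z = 0 := Finset.sum_eq_zero fun z hz =>
    nbrsIn_eq_zero fun y hy => by
      obtain ⟨i, hi, rfl⟩ := Finset.mem_image.1 hz
      obtain ⟨j, hj, rfl⟩ := Finset.mem_image.1 hy
      exact h.pred_not_adj hf hv (Finset.mem_filter.1 hi).1 (Finset.mem_filter.1 hj).1
  have hZc : Z.card = (longGaps G f v).card := by
    rw [hZ, Finset.card_image_of_injective, card_longGapsRev]
    intro i j hij; simpa using hf.1 hij
  have h7 : Z.card * (k - (longGaps G f v).card) ≤ ∑ z ∈ Z, nbrsIn G z (succSet G f v)ᶜ := by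
    rw [← smul_eq_mul]
    refine Finset.card_nsmul_le_sum _ _ _ fun z hz => ?_
    obtain ⟨i, hi, rfl⟩ := Finset.mem_image.1 hz
    have e1 := nbrsIn_add_compl h.reg (f (i - 1)) (succSet G f v)
    have e2 := h.nbrsIn_pred_le hf hv hi
    omega
  rw [hZc] at h7
  omega

/-- For `k ≥ 5` (and for all smaller orders), there is exactly one long gap. -/
theorem MaxCycle.card_longGaps_eq_one (h : MaxCycle G k c 0) (hk : 3 ≤ k) (hf : CycFun G f)
    (hv : ∀ i, f i ≠ v) (hn : Fintype.card V ≤ 2 * k + 4) :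
    Fintype.card V = 2 * k + 4 ∧ (5 ≤ k → (longGaps G f v).card = 1) := by
  have h2c := h.two_mul_add_card_longGaps_le hf hv
  have hcn := hf.card_add_le {v} (by simpa using hv)
  rw [Finset.card_singleton] at hcn
  obtain ⟨m, hm⟩ : ∃ m, Fintype.card V = 2 * k + 1 + m := ⟨Fintype.card V - (2 * k + 1), by omega⟩
  have h0 := h.longGaps_nonempty (by omega) hf hv
  have hle := h.longGaps_mul_le hf hv hm
  have hm3 : m ≤ 3 := by omega
  have hd : (longGaps G f v).card ≤ m := by omega
  generalize (longGaps G f v).card = d at *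
  -- For `m ≤ 2` the inequality fails for every `d` with `1 ≤ d ≤ m`. For `m = 3` the values `d = 2`
  -- and `d = 3` require `k ≤ 4`.
  interval_cases m <;> interval_cases d <;> omega

/-- There is no exceptional cycle when `k ≥ 5`. -/
theorem MaxCycle.false_of_five_le (h : MaxCycle G k c 0) (hk : 5 ≤ k) (hf : CycFun G f)
    (hv : ∀ i, f i ≠ v) (hn : Fintype.card V ≤ 2 * k + 4) : False := by
  obtain ⟨hn4, hd⟩ := h.card_longGaps_eq_one (by omega) hf hv hn
  have hd1 := hd hk
  have hd2 := card_longGapsRev (G := G) (f := f) (v := v)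
  rw [hd1] at hd2
  obtain ⟨i₀, hi₀⟩ := Finset.card_eq_one.1 hd1
  obtain ⟨i₁, hi₁⟩ := Finset.card_eq_one.1 hd2
  have hm0 : i₀ ∈ longGaps G f v := by rw [hi₀]; simp
  have hm1 : i₁ ∈ longGapsRev G f v := by rw [hi₁]; simp
  obtain ⟨hA0, hA0'⟩ := Finset.mem_filter.1 hm0
  have hnext : ∀ i ∈ nbrPos G f v, i ≠ i₀ → i + 2 ∈ nbrPos G f v := by
    intro i hi hne
    by_contra h2
    have : i ∈ longGaps G f v := Finset.mem_filter.2 ⟨hi, h2⟩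
    rw [hi₀, Finset.mem_singleton] at this
    exact hne this
  have hsum := h.sum_nbrsIn hf hv (m := 3) (by omega)
  have ha' : k ≤ nbrsIn G (f (i₁ - 1)) (succSet G f v)ᶜ + 1 := by
    have e1 := nbrsIn_add_compl h.reg (f (i₁ - 1)) (succSet G f v)
    have e2 := h.nbrsIn_pred_le hf hv hm1
    omega
  have ha'W := MaxCycle.pred_not_mem_succSet hf hv hm1
  -- The complement of `succSet` has degree sum `2k`, and `f (i₁ - 1)` takes at least `k - 1`
  -- neighbours there. A second vertex `z` with so many would give `4(k-1) ≤ 2k + 2`, the last `2`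
  -- allowing for an edge between the two.
  have hfew : ∀ z, z ∉ succSet G f v → z ≠ f (i₁ - 1) → 2 ≤ nbrsIn G z (succSet G f v) := by
    intro z hz hne
    by_contra hlt
    have e1 := nbrsIn_add_compl h.reg z (succSet G f v)
    have hZW : {f (i₁ - 1), z} ⊆ (succSet G f v)ᶜ := by
      intro x hx
      rw [Finset.mem_insert, Finset.mem_singleton] at hx
      rcases hx with rfl | rfl <;> exact Finset.mem_compl.2 (by assumption)
    have h5 := two_mul_sum_nbrsIn_le (G := G) hZW
    rw [Finset.sum_pair hne.symm, Finset.sum_pair hne.symm] at h5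
    have hone : ∀ x y : V, nbrsIn G x {x, y} ≤ 1 := by
      intro x y
      refine le_trans (Finset.card_le_card (t := {y}) ?_) (by simp)
      intro t ht
      rw [Finset.mem_filter, Finset.mem_insert, Finset.mem_singleton] at ht
      rcases ht.1 with rfl | rfl
      · exact absurd ht.2 G.irrefl
      · simp
    have h6 := hone (f (i₁ - 1)) z
    have h7 := hone z (f (i₁ - 1))
    rw [Finset.pair_comm] at h7
    omega
  -- Of two neighbours of `z` in `succSet` at most one is `f (i₀ + 1)`, the only successor in a long
  -- gap. The other is the middle of a short gap.
  have hother : ∀ z, z ∉ succSet G f v → z ≠ f (i₁ - 1) → ¬ G.Adj z v →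
      ∃ i ∈ nbrPos G f v, i + 2 ∈ nbrPos G f v ∧ G.Adj z (f (i + 1)) := by
    intro z hz hne hzv
    obtain ⟨y, hy, hyne⟩ := Finset.exists_mem_ne (hfew z hz hne) (f (i₀ + 1))
    rw [Finset.mem_filter, mem_succSet] at hy
    obtain ⟨rfl | ⟨i, hi, rfl⟩, hadj⟩ := hy
    · exact absurd hadj hzv
    · exact ⟨i, hi, hnext i hi fun e => hyne (by rw [e]), hadj⟩
  have hout : ∀ w, (∀ i, f i ≠ w) → w = v := by
    intro w hw
    by_contra hwv
    have hwI : w ∉ succSet G f v := by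
      rw [mem_succSet]
      rintro (e | ⟨i, _, e⟩)
      · exact hwv e
      · exact hw _ e
    obtain ⟨i, hi, hi2, hadj⟩ := hother w hwI (hw _).symm (h.not_adj_outside hf hw hv)
    exact h.hop_not_adj hf hv hw hi hi2 hadj
  have hc : c = 2 * k + 3 := by
    have hsub : (Finset.univ : Finset V) ⊆ insert v (Finset.univ.image f) := by
      intro x _
      rw [Finset.mem_insert, Finset.mem_image]
      by_cases hx : ∃ i, f i = x
      · obtain ⟨i, hi⟩ := hx; exact Or.inr ⟨i, Finset.mem_univ _, hi⟩
      · push Not at hx; exact Or.inl (hout x hx)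
    have h1 := (Finset.card_le_card hsub).trans (Finset.card_insert_le _ _)
    rw [Finset.card_image_of_injective _ hf.1, Finset.card_univ, Finset.card_univ, ZMod.card] at h1
    have hcn := hf.card_add_le {v} (by simpa using hv)
    rw [Finset.card_singleton] at hcn
    omega
  set A := nbrPos G f v with hAdef
  have hAcard : A.card = k := h.card_nbrPos hf hv
  have hA1 := h.add_one_not_mem hf hv
  -- The positions that are neither feet nor successors of feet. They turn out to be the last three
  -- vertices `i₀ + 2`, `i₀ + 3`, `i₀ + 4` of the long gap.
  set K : Finset (ZMod c) := (A ∪ A.image (· + 1))ᶜ with hK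
  have hKcard : K.card = 3 := by
    rw [hK, Finset.card_compl, Finset.card_union_of_disjoint, Finset.card_image_of_injective,
      hAcard, ZMod.card]
    · omega
    · intro a b hab; simpa using hab
    · rw [Finset.disjoint_left]
      intro i hi hi'
      obtain ⟨j, hj, rfl⟩ := Finset.mem_image.1 hi'
      exact hA1 j hj hi
  have hKmem : ∀ j, j ∈ K ↔ j ∉ A ∧ j - 1 ∉ A := by
    intro j
    rw [hK, Finset.mem_compl, Finset.mem_union, not_or]
    refine and_congr_right fun _ => not_congr ?_
    rw [Finset.mem_image]
    constructor
    · rintro ⟨i, hi, rfl⟩; simpa using hi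
    · intro hj; exact ⟨j - 1, hj, by ring⟩
  have hKpred : ∀ j ∈ K, j ≠ i₀ + 2 → j - 1 ∈ K := by
    intro j hj hne
    rw [hKmem] at hj ⊢
    refine ⟨hj.2, fun h2 => hj.1 ?_⟩
    have := hnext (j - 1 - 1) h2 fun e => hne (by rw [← e]; ring)
    rwa [show j - 1 - 1 + 2 = j by ring] at this
  -- Going backwards from an element of `K`, one leaves `K` only at `i₀ + 2`; since `K` has three
  -- elements, it is an interval starting there.
  have hKdown : ∀ (t : ℕ), t + 2 < c → i₀ + 2 + (t : ZMod c) ∈ K → ∀ s ≤ t,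
      i₀ + 2 + (s : ZMod c) ∈ K := by
    intro t
    induction t with
    | zero => intro _ h1 s hs; rwa [show s = 0 by omega]
    | succ t ih =>
      intro htc h1 s hs
      rcases hs.lt_or_eq with hs | rfl
      · refine ih (by omega) ?_ s (by omega)
        have := hKpred _ h1 fun e => by
          have e' : ((t + 1 : ℕ) : ZMod c) = ((0 : ℕ) : ZMod c) := by
            push_cast at e ⊢; linear_combination e
          have := ZMod.natCast_inj_of_lt (by omega) (by omega) e'
          omega
        rwa [show i₀ + 2 + ((t + 1 : ℕ) : ZMod c) - 1 = i₀ + 2 + (t : ZMod c) by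
          push_cast; ring] at this
      · exact h1
  have hinj3 : ∀ s t : ℕ, s < c → t < c → i₀ + 2 + (s : ZMod c) = i₀ + 2 + (t : ZMod c) → s = t :=
    fun s t hs ht e => ZMod.natCast_inj_of_lt hs ht (add_left_cancel e)
  have hKsub : K ⊆ (Finset.range 3).image fun s : ℕ => i₀ + 2 + (s : ZMod c) := by
    intro j hj
    have hjt : j = i₀ + 2 + (((j - (i₀ + 2)).val : ℕ) : ZMod c) := by simp
    have hlt := ZMod.val_lt (j - (i₀ + 2))
    generalize (j - (i₀ + 2)).val = t at hjt hlt
    have ht2 : t + 2 < c := by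
      by_contra hge
      rw [hKmem] at hj
      rcases (show t = c - 1 ∨ t = c - 2 by omega) with rfl | rfl
      · refine hj.2 ?_
        rw [hjt, Nat.cast_sub (by omega), ZMod.natCast_self]
        rwa [show i₀ + 2 + (0 - ((1 : ℕ) : ZMod c)) - 1 = i₀ by push_cast; ring]
      · refine hj.1 ?_
        rw [hjt, Nat.cast_sub (by omega), ZMod.natCast_self]
        rwa [show i₀ + 2 + (0 - ((2 : ℕ) : ZMod c)) = i₀ by push_cast; ring]
    have ht3 : t < 3 := by
      by_contra hge
      have hsub : (Finset.range 4).image (fun s : ℕ => i₀ + 2 + (s : ZMod c)) ⊆ K := by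
        intro x hx
        obtain ⟨s, hs, rfl⟩ := Finset.mem_image.1 hx
        rw [Finset.mem_range] at hs
        exact hKdown t ht2 (hjt ▸ hj) s (by omega)
      have := Finset.card_le_card hsub
      rw [Finset.card_image_of_injOn, Finset.card_range, hKcard] at this
      · omega
      · intro a ha b hb hab
        simp only [Finset.coe_range, Set.mem_Iio] at ha hb
        exact hinj3 a b (by omega) (by omega) hab
    exact Finset.mem_image.2 ⟨t, by simpa using ht3, hjt.symm⟩
  have hKeq := Finset.eq_of_subset_of_card_le hKsub (by
    rw [hKcard]; exact Finset.card_image_le.trans (by simp))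
  have hKin : ∀ s : ℕ, s < 3 → i₀ + 2 + (s : ZMod c) ∈ K := by
    intro s hs; rw [hKeq]; exact Finset.mem_image.2 ⟨s, by simpa using hs, rfl⟩
  have hK2 : i₀ + 2 ∈ K := by simpa using hKin 0 (by omega)
  have hK3 : i₀ + 3 ∈ K := by
    have := hKin 1 (by omega)
    rwa [show i₀ + 2 + ((1 : ℕ) : ZMod c) = i₀ + 3 by push_cast; ring] at this
  have hK4 : i₀ + 4 ∈ K := by
    have := hKin 2 (by omega)
    rwa [show i₀ + 2 + ((2 : ℕ) : ZMod c) = i₀ + 4 by push_cast; ring] at this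
  have hA5 : i₀ + 5 ∈ A := by
    by_contra h5
    have h5K : i₀ + 5 ∈ K := (hKmem _).2 ⟨h5, by
      rw [show i₀ + 5 - 1 = i₀ + 4 by ring]; exact ((hKmem _).1 hK4).1⟩
    rw [hKeq] at h5K
    obtain ⟨s, hs, e⟩ := Finset.mem_image.1 h5K
    rw [Finset.mem_range] at hs
    have := hinj3 s 3 (by omega) (by omega) (by rw [e]; push_cast; ring)
    omega
  have hi₁' : i₁ = i₀ + 5 := by
    have : i₀ + 5 ∈ longGapsRev G f v := Finset.mem_filter.2 ⟨hA5, by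
      rw [show i₀ + 5 - 2 = i₀ + 3 by ring]; exact ((hKmem _).1 hK3).1⟩
    rw [hi₁, Finset.mem_singleton] at this
    exact this.symm
  have hchord : ∀ s : ℕ, s < 2 → ∃ i ∈ A, i + 2 ∈ A ∧
      G.Adj (f (i₀ + 2 + (s : ZMod c))) (f (i + 1)) := by
    intro s hs
    have hsK := (hKmem _).1 (hKin s (by omega))
    refine hother _ ?_ ?_ ?_
    · rw [mem_succSet]
      rintro (e | ⟨i, hi, e⟩)
      · exact hv _ e
      · have := hf.1 e
        refine hsK.2 ?_
        rwa [← this, add_sub_cancel_right]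
    · intro e
      have e' := hf.1 e
      rw [hi₁'] at e'
      have := hinj3 s 2 (by omega) (by omega) (by rw [e']; push_cast; ring)
      omega
    · intro hadj
      exact hsK.1 (mem_nbrPos.2 hadj.symm)
  obtain ⟨x, hx, hx2, hbx⟩ := hchord 0 (by omega)
  obtain ⟨y, hy, hy2, hby⟩ := hchord 1 (by omega)
  have hpos : ∀ x ∈ A, ∃ i : ℕ, 1 ≤ i ∧ i + 1 < c ∧ x + 1 = i₀ + 3 + (i : ZMod c) := by
    intro x hx
    have e : x + 1 = i₀ + 3 + (((x + 1 - (i₀ + 3)).val : ℕ) : ZMod c) := by simp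
    have hlt := ZMod.val_lt (x + 1 - (i₀ + 3))
    generalize (x + 1 - (i₀ + 3)).val = t at e hlt
    refine ⟨t, ?_, ?_, e⟩
    · by_contra h0
      rw [show t = 0 by omega, Nat.cast_zero, add_zero] at e
      refine ((hKmem _).1 hK3).2 ?_
      rwa [← e, add_sub_cancel_right]
    · by_contra h0
      rw [show t = c - 1 by omega, Nat.cast_sub (by omega), ZMod.natCast_self] at e
      refine ((hKmem _).1 hK2).2 ?_
      rwa [show i₀ + 2 - 1 = x by push_cast at e; linear_combination -e]
  obtain ⟨i, hi1, hi2, ei⟩ := hpos x hx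
  obtain ⟨j, hj1, hj2, ej⟩ := hpos y hy
  -- After the shift the consecutive vertices `i₀ + 2` and `i₀ + 3` have indices `c - 1` and `0`.
  -- Both have a chord to the middle of a short gap.
  refine crossing_zero (hf.shift (i₀ + 3)) h.max (v := v) (fun _ => hv _) hi1 hi2 hj1 hj2
    ?_ ?_ ?_ ?_ ?_ ?_
  · rw [Nat.cast_sub hi1, show i₀ + 3 + ((i : ZMod c) - ((1 : ℕ) : ZMod c)) = x by
      push_cast; linear_combination -ei]
    exact mem_nbrPos.1 hx
  · rw [show i₀ + 3 + ((i + 1 : ℕ) : ZMod c) = x + 2 by push_cast; linear_combination -ei]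
    exact mem_nbrPos.1 hx2
  · rw [Nat.cast_sub hj1, show i₀ + 3 + ((j : ZMod c) - ((1 : ℕ) : ZMod c)) = y by
      push_cast; linear_combination -ej]
    exact mem_nbrPos.1 hy
  · rw [show i₀ + 3 + ((j + 1 : ℕ) : ZMod c) = y + 2 by push_cast; linear_combination -ej]
    exact mem_nbrPos.1 hy2
  · rw [← ei, Nat.cast_sub (by omega), ZMod.natCast_self,
      show i₀ + 3 + (0 - ((1 : ℕ) : ZMod c)) = i₀ + 2 by push_cast; ring]
    simpa using hbx
  · rw [← ej, add_zero]
    have := hby.symm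
    rwa [show i₀ + 2 + ((1 : ℕ) : ZMod c) = i₀ + 3 by push_cast; ring] at this

end IndependentOutside

/-! ### Cubic graphs on ten vertices: the Petersen graph -/

section CubicTen

variable {V : Type*} [Fintype V] [DecidableEq V] {G : SimpleGraph V} [DecidableRel G.Adj]

-- Let `0`, `b`, `d` be the feet of `v`. The feet of a second outside vertex avoid these and the
-- middles of short gaps, and are pairwise non-consecutive. The conclusion is the negation of the
-- one instance of that last condition missing from the hypotheses, so no second vertex fits.
set_option synthInstance.maxHeartbeats 400000 in
set_option synthInstance.maxSize 1000 in
theorem zmod_seven_free_positions : ∀ b d : ZMod 7, (b ≠ 0 ∧ d ≠ 0 ∧ b ≠ d ∧ b ≠ 1 ∧ d ≠ 1 ∧ b + 1 ≠ 0 ∧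
    d + 1 ≠ 0 ∧ b + 1 ≠ d ∧ d + 1 ≠ b) →
    ∀ x, (x ∉ ({0, b, d} : Finset (ZMod 7)) ∧
      (x - 1 ∈ ({0, b, d} : Finset (ZMod 7)) → x + 1 ∉ ({0, b, d} : Finset (ZMod 7)))) →
    ∀ y, (y ∉ ({0, b, d} : Finset (ZMod 7)) ∧
      (y - 1 ∈ ({0, b, d} : Finset (ZMod 7)) → y + 1 ∉ ({0, b, d} : Finset (ZMod 7)))) →
    (y ≠ x ∧ y ≠ x + 1 ∧ x ≠ y + 1) →
    ∀ z, (z ∉ ({0, b, d} : Finset (ZMod 7)) ∧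
      (z - 1 ∈ ({0, b, d} : Finset (ZMod 7)) → z + 1 ∉ ({0, b, d} : Finset (ZMod 7)))) →
    (z ≠ x ∧ z ≠ x + 1 ∧ x ≠ z + 1 ∧ z ≠ y ∧ z ≠ y + 1) → y = z + 1 := by
  decide +kernel

set_option synthInstance.maxHeartbeats 400000 in
set_option synthInstance.maxSize 1000 in
theorem zmod_eight_free_positions : ∀ b d : ZMod 8, (b ≠ 0 ∧ d ≠ 0 ∧ b ≠ d ∧ b ≠ 1 ∧ d ≠ 1 ∧ b + 1 ≠ 0 ∧
    d + 1 ≠ 0 ∧ b + 1 ≠ d ∧ d + 1 ≠ b) →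
    ∀ x, (x ∉ ({0, b, d} : Finset (ZMod 8)) ∧
      (x - 1 ∈ ({0, b, d} : Finset (ZMod 8)) → x + 1 ∉ ({0, b, d} : Finset (ZMod 8)))) →
    ∀ y, (y ∉ ({0, b, d} : Finset (ZMod 8)) ∧
      (y - 1 ∈ ({0, b, d} : Finset (ZMod 8)) → y + 1 ∉ ({0, b, d} : Finset (ZMod 8)))) →
    (y ≠ x ∧ y ≠ x + 1 ∧ x ≠ y + 1) →
    ∀ z, (z ∉ ({0, b, d} : Finset (ZMod 8)) ∧
      (z - 1 ∈ ({0, b, d} : Finset (ZMod 8)) → z + 1 ∉ ({0, b, d} : Finset (ZMod 8)))) →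
    (z ≠ x ∧ z ≠ x + 1 ∧ x ≠ z + 1 ∧ z ≠ y ∧ z ≠ y + 1) → y = z + 1 := by
  decide +kernel

/-- The gaps are at least two and add up to nine; up to rotation they are `2,2,5`, or `2,3,4`, or
the mirror image of the latter, or `3,3,3`. -/
theorem zmod_nine_spaced_triples : ∀ b d : ZMod 9, b ≠ 0 → d ≠ 0 → b ≠ d → b ≠ 1 → d ≠ 1 → b + 1 ≠ 0 →
    d + 1 ≠ 0 → b + 1 ≠ d → d + 1 ≠ b →
    ∃ s, ({0, b, d} : Finset (ZMod 9)) = {s, s + 2, s + 4} ∨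
      ({0, b, d} : Finset (ZMod 9)) = {s, s + 2, s + 5} ∨
      ({0, b, d} : Finset (ZMod 9)) = {s, s - 2, s - 5} ∨
      ({0, b, d} : Finset (ZMod 9)) = {s, s + 3, s + 6} := by
  decide +kernel

theorem MaxCycle.exists_feet {c : ℕ} [NeZero c] (h : MaxCycle G 3 c 0) {f : ZMod c → V}
    (hf : CycFun G f) {v : V} (hv : ∀ i, f i ≠ v) :
    ∃ f', CycFun G f' ∧ (∀ x, (∀ i, f i ≠ x) ↔ ∀ i, f' i ≠ x) ∧ ∃ b d : ZMod c, b ≠ 0 ∧ d ≠ 0 ∧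
      b ≠ d ∧ b ≠ 1 ∧ d ≠ 1 ∧ b + 1 ≠ 0 ∧ d + 1 ≠ 0 ∧ b + 1 ≠ d ∧ d + 1 ≠ b ∧
        nbrPos G f' v = {0, b, d} := by
  obtain ⟨a, b, d, hab, had, hbd, he⟩ := Finset.card_eq_three.1 (h.card_nbrPos hf hv)
  have hgap := h.add_one_not_mem hf hv
  rw [he] at hgap
  simp only [Finset.mem_insert, Finset.mem_singleton, forall_eq_or_imp, forall_eq, not_or] at hgap
  obtain ⟨⟨g1, g2, g3⟩, ⟨g4, g5, g6⟩, ⟨g7, g8, g9⟩⟩ := hgap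
  refine ⟨fun i => f (a + i), hf.shift a, fun x => ⟨fun hx i => hx _, fun hx i => by
    simpa using hx (i - a)⟩, b - a, d - a, sub_ne_zero.2 hab.symm, sub_ne_zero.2 had.symm,
    fun e => hbd (by simpa using e), fun e => g2 (by rw [← e]; ring),
    fun e => g3 (by rw [← e]; ring), fun e => g4 (by linear_combination e),
    fun e => g7 (by linear_combination e), fun e => g6 (by linear_combination e),
    fun e => g8 (by linear_combination e), ?_⟩
  ext i
  have := Finset.ext_iff.1 he (a + i)
  rw [mem_nbrPos] at this ⊢
  rw [this]
  simp only [Finset.mem_insert, Finset.mem_singleton, add_eq_left]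
  exact or_congr Iff.rfl (or_congr (by rw [eq_sub_iff_add_eq, add_comm])
    (by rw [eq_sub_iff_add_eq, add_comm]))

/-- A longest cycle of such a cubic graph on ten vertices has length nine. -/
theorem MaxCycle.eq_nine {c : ℕ} [NeZero c] (h : MaxCycle G 3 c 0) (hn : Fintype.card V = 10)
    {f : ZMod c → V} (hf : CycFun G f) {v : V} (hv : ∀ i, f i ≠ v) : c = 9 := by
  have h2c := h.two_mul_add_card_longGaps_le hf hv
  have h0 := h.longGaps_nonempty (by omega) hf hv
  have hcn := hf.card_add_le {v} (by simpa using hv)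
  rw [Finset.card_singleton] at hcn
  by_contra hc9
  obtain ⟨w, hw, hwv⟩ : ∃ w, (∀ i, f i ≠ w) ∧ w ≠ v := by
    by_contra hcon
    push Not at hcon
    have hsub : (Finset.univ : Finset V) ⊆ insert v (Finset.univ.image f) := by
      intro x _
      rw [Finset.mem_insert, Finset.mem_image]
      by_cases hx : ∃ i, f i = x
      · obtain ⟨i, hi⟩ := hx; exact Or.inr ⟨i, Finset.mem_univ _, hi⟩
      · push Not at hx; exact Or.inl (hcon x hx)
    have h1 := (Finset.card_le_card hsub).trans (Finset.card_insert_le _ _)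
    rw [Finset.card_image_of_injective _ hf.1, Finset.card_univ, Finset.card_univ, ZMod.card] at h1
    omega
  obtain ⟨f', hf', hoff, b, d, b0, d0, hbd, b1, d1, b1', d1', hbd1, hdb1, hA⟩ := h.exists_feet hf hv
  rw [hoff] at hv hw
  obtain ⟨x, y, z, hxy, hxz, hyz, hB⟩ := Finset.card_eq_three.1 (h.card_nbrPos hf' hw)
  have hgap := h.add_one_not_mem hf' hw
  have hdis := h.nbrPos_disjoint hf' hwv hw hv
  have hhop : ∀ j ∈ nbrPos G f' w, j ∉ nbrPos G f' v ∧
      (j - 1 ∈ nbrPos G f' v → j + 1 ∉ nbrPos G f' v) := by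
    intro j hj
    refine ⟨Finset.disjoint_left.1 hdis hj, fun h1 h2 => ?_⟩
    refine h.hop_not_adj hf' hv hw h1 (by rwa [show j - 1 + 2 = j + 1 by ring]) ?_
    rw [sub_add_cancel]
    exact mem_nbrPos.1 hj
  rw [hA] at hhop
  have mx : x ∈ nbrPos G f' w := by rw [hB]; simp
  have my : y ∈ nbrPos G f' w := by rw [hB]; simp
  have mz : z ∈ nbrPos G f' w := by rw [hB]; simp
  have hne : ∀ i ∈ nbrPos G f' w, ∀ j ∈ nbrPos G f' w, j ≠ i + 1 := fun i hi j hj e =>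
    hgap i hi (e ▸ hj)
  have hfin : y = z + 1 := by
    rcases (show c = 7 ∨ c = 8 by omega) with rfl | rfl
    · exact zmod_seven_free_positions b d ⟨b0, d0, hbd, b1, d1, b1', d1', hbd1, hdb1⟩ x (hhop x mx)
        y (hhop y my) ⟨hxy.symm, hne x mx y my, hne y my x mx⟩
        z (hhop z mz) ⟨hxz.symm, hne x mx z mz, hne z mz x mx, hyz.symm, hne y my z mz⟩
    · exact zmod_eight_free_positions b d ⟨b0, d0, hbd, b1, d1, b1', d1', hbd1, hdb1⟩ x (hhop x mx)
        y (hhop y my) ⟨hxy.symm, hne x mx y my, hne y my x mx⟩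
        z (hhop z mz) ⟨hxz.symm, hne x mx z mz, hne z mz x mx, hyz.symm, hne y my z mz⟩
  exact hne z mz y my hfin

/-- The vertices of the cycle that are not adjacent to `v` are matched by chords. -/
theorem MaxCycle.exists_partner (h : MaxCycle G 3 9 0) (hn : Fintype.card V = 10)
    {f : ZMod 9 → V} (hf : CycFun G f) {v : V} (hv : ∀ i, f i ≠ v) :
    ∃ m : ZMod 9 → ZMod 9, (∀ i j, G.Adj (f i) (f j) ↔
        j = i + 1 ∨ j = i - 1 ∨ (i ∉ nbrPos G f v ∧ j = m i)) ∧
      ∀ i, i ∉ nbrPos G f v → m i ∉ nbrPos G f v ∧ m i ≠ i ∧ m i ≠ i + 1 ∧ m i ≠ i - 1 ∧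
        m (m i) = i := by
  have hrange : ∀ x, x = v ∨ ∃ i, f i = x := by
    intro x
    by_contra hcon
    push Not at hcon
    have := hf.card_add_le {v, x} (by
      intro y hy
      rw [Finset.mem_insert, Finset.mem_singleton] at hy
      rcases hy with rfl | rfl
      · exact hv
      · exact hcon.2)
    rw [Finset.card_pair hcon.1.symm] at this
    omega
  have hdeg : ∀ (i : ZMod 9) (S : Finset V), S ⊆ G.neighborFinset (f i) → S.card = 3 →
      S = G.neighborFinset (f i) := fun i S hS hc =>
    Finset.eq_of_subset_of_card_le hS (by
      rw [hc, SimpleGraph.card_neighborFinset_eq_degree, h.reg])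
  have hadj1 : ∀ i, G.Adj (f i) (f (i - 1)) := fun i => by simpa using (hf.2 (i - 1)).symm
  have hne1 := fun i => h.sub_one_ne_add_one hf i
  have hfull : ∀ i ∈ nbrPos G f v, ∀ j, G.Adj (f i) (f j) → j = i + 1 ∨ j = i - 1 := by
    intro i hi j hj
    have := hdeg i {v, f (i - 1), f (i + 1)} (by
      intro x hx
      simp only [Finset.mem_insert, Finset.mem_singleton] at hx
      rw [SimpleGraph.mem_neighborFinset]
      rcases hx with rfl | rfl | rfl
      · exact (mem_nbrPos.1 hi).symm
      · exact hadj1 i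
      · exact hf.2 i) (by
      rw [Finset.card_insert_of_notMem, Finset.card_pair (hne1 i)]
      simp [(hv _).symm])
    have hm : f j ∈ G.neighborFinset (f i) := by simpa using hj
    rw [← this] at hm
    simp only [Finset.mem_insert, Finset.mem_singleton] at hm
    rcases hm with e | e | e
    · exact absurd e (hv j)
    · exact Or.inr (hf.1 e)
    · exact Or.inl (hf.1 e)
  have hex : ∀ i, i ∉ nbrPos G f v → ∃ m, m ≠ i + 1 ∧ m ≠ i - 1 ∧ G.Adj (f i) (f m) ∧
      ∀ j, G.Adj (f i) (f j) → j = i + 1 ∨ j = i - 1 ∨ j = m := by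
    intro i hi
    have hlt : ({f (i - 1), f (i + 1)} : Finset V).card < (G.neighborFinset (f i)).card := by
      rw [Finset.card_pair (hne1 i), SimpleGraph.card_neighborFinset_eq_degree, h.reg]
      omega
    obtain ⟨x, hx, hx'⟩ := Finset.exists_mem_notMem_of_card_lt_card hlt
    rw [SimpleGraph.mem_neighborFinset] at hx
    rcases hrange x with rfl | ⟨m, rfl⟩
    · exact absurd (mem_nbrPos.2 hx.symm) hi
    · simp only [Finset.mem_insert, Finset.mem_singleton, not_or] at hx'
      refine ⟨m, fun e => hx'.2 (by rw [e]), fun e => hx'.1 (by rw [e]), hx, fun j hj => ?_⟩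
      have := hdeg i {f m, f (i - 1), f (i + 1)} (by
        intro x hx1
        simp only [Finset.mem_insert, Finset.mem_singleton] at hx1
        rw [SimpleGraph.mem_neighborFinset]
        rcases hx1 with rfl | rfl | rfl
        · exact hx
        · exact hadj1 i
        · exact hf.2 i) (by
        rw [Finset.card_insert_of_notMem, Finset.card_pair (hne1 i)]
        simpa using hx')
      have hm : f j ∈ G.neighborFinset (f i) := by simpa using hj
      rw [← this] at hm
      simp only [Finset.mem_insert, Finset.mem_singleton] at hm
      rcases hm with e | e | e
      · exact Or.inr (Or.inr (hf.1 e))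
      · exact Or.inr (Or.inl (hf.1 e))
      · exact Or.inl (hf.1 e)
  choose! m hm1 hm2 hm3 hm4 using hex
  refine ⟨m, fun i j => ⟨fun hij => ?_, ?_⟩, fun i hi => ?_⟩
  · by_cases hi : i ∈ nbrPos G f v
    · rcases hfull i hi j hij with e | e
      · exact Or.inl e
      · exact Or.inr (Or.inl e)
    · rcases hm4 i hi j hij with e | e | e
      · exact Or.inl e
      · exact Or.inr (Or.inl e)
      · exact Or.inr (Or.inr ⟨hi, e⟩)
  · rintro (rfl | rfl | ⟨hi, rfl⟩)
    · exact hf.2 i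
    · exact hadj1 i
    · exact hm3 i hi
  · have hmA : m i ∉ nbrPos G f v := by
      intro hmem
      rcases hfull _ hmem i (hm3 i hi).symm with e | e
      · exact hm2 i hi (by linear_combination -e)
      · exact hm1 i hi (by linear_combination -e)
    refine ⟨hmA, fun e => ?_, hm1 i hi, hm2 i hi, ?_⟩
    · have := hm3 i hi
      rw [e] at this
      exact G.irrefl this
    · rcases hm4 _ hmA i (hm3 i hi).symm with e | e | e
      · exact absurd (by linear_combination -e) (hm2 i hi)
      · exact absurd (by linear_combination -e) (hm1 i hi)
      · exact e.symm

/-- A labelling of the vertices of the Petersen graph by a cycle of length nine and one more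
vertex. -/
def petersenLabel : Option (ZMod 9) → {s : Finset (Fin 5) // s.card = 2}
  | none => ⟨{3, 4}, rfl⟩
  | some i => ![⟨{0, 1}, rfl⟩, ⟨{2, 3}, rfl⟩, ⟨{0, 4}, rfl⟩, ⟨{1, 2}, rfl⟩, ⟨{0, 3}, rfl⟩,
      ⟨{1, 4}, rfl⟩, ⟨{0, 2}, rfl⟩, ⟨{1, 3}, rfl⟩, ⟨{2, 4}, rfl⟩] i

/-- The chords of the nine-cycle in the Petersen graph. -/
def petersenChord : ZMod 9 → ZMod 9 := ![0, 5, 7, 3, 8, 1, 6, 2, 4]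

theorem petersenLabel_bijective : Function.Bijective petersenLabel := by
  decide +kernel

/-- The values of `petersenChord` at the feet `0`, `3`, `6` are fillers, excluded by the third
alternative. -/
theorem petersenLabel_disjoint_some : ∀ i j : ZMod 9,
    (Disjoint (petersenLabel (some i)).1 (petersenLabel (some j)).1 ↔
      j = i + 1 ∨ j = i - 1 ∨ (i ∉ ({0, 3, 6} : Finset (ZMod 9)) ∧ j = petersenChord i)) := by
  decide +kernel

theorem petersenLabel_disjoint_none : ∀ i : ZMod 9,
    (Disjoint (petersenLabel none).1 (petersenLabel (some i)).1 ↔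
      i ∈ ({0, 3, 6} : Finset (ZMod 9))) := by
  decide +kernel

theorem nonempty_iso_petersen (hn : Fintype.card V = 10) {f : ZMod 9 → V} (hf : CycFun G f) {v : V}
    (hv : ∀ i, f i ≠ v) (hA : nbrPos G f v = {0, 3, 6})
    (hadj : ∀ i j, G.Adj (f i) (f j) ↔
        j = i + 1 ∨ j = i - 1 ∨ (i ∉ nbrPos G f v ∧ j = petersenChord i)) :
    Nonempty (G ≃g petersen) := by
  have hinj : Function.Injective (fun o : Option (ZMod 9) => o.elim v f) := by
    rintro (_ | i) (_ | j) hij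
    · rfl
    · exact absurd hij.symm (hv j)
    · exact absurd hij (hv i)
    · exact congrArg some (hf.1 hij)
  have hbij : Function.Bijective (fun o : Option (ZMod 9) => o.elim v f) := by
    rw [Fintype.bijective_iff_injective_and_card]
    refine ⟨hinj, ?_⟩
    rw [hn, Fintype.card_option, ZMod.card]
  let e := (Equiv.ofBijective _ hbij).symm.trans (Equiv.ofBijective _ petersenLabel_bijective)
  have hvA : ∀ j, G.Adj v (f j) ↔ j ∈ ({0, 3, 6} : Finset (ZMod 9)) := by
    intro j; rw [← hA, mem_nbrPos]
  have key : ∀ a b : Option (ZMod 9), petersen.Adj (petersenLabel a) (petersenLabel b) ↔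
      G.Adj (a.elim v f) (b.elim v f) := by
    rintro (_ | i) (_ | j)
    · exact iff_of_false (petersen.irrefl) G.irrefl
    · exact (petersenLabel_disjoint_none j).trans (hvA j).symm
    · rw [petersen.adj_comm, G.adj_comm]
      exact (petersenLabel_disjoint_none i).trans (hvA i).symm
    · refine (petersenLabel_disjoint_some i j).trans ?_
      rw [← hA]
      exact (hadj i j).symm
  refine ⟨⟨e, fun {x y} => ?_⟩⟩
  obtain ⟨a, rfl⟩ := hbij.2 x
  obtain ⟨b, rfl⟩ := hbij.2 y
  have he : ∀ a, e (a.elim v f) = petersenLabel a := by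
    intro a
    simp only [e, Equiv.trans_apply, Equiv.ofBijective_apply]
    congr 1
    exact (Equiv.ofBijective _ hbij).symm_apply_apply a
  simp only [he]
  exact key a b

/-- In this lemma and the next two, the variables are the partners of certain successors of feet
(and of the predecessor `4` in the pattern `0, 2, 5`). The excluded positions are the feet, the
vertex itself, its neighbours on the cycle, and the successors or predecessors of feet to which
chords are forbidden. -/
theorem nine_chords_024 : ∀ x y : ZMod 9, x ∉ ({0, 2, 4, 1, 3, 5, 8} : Finset (ZMod 9)) →
    y ∉ ({0, 2, 4, 3, 1, 5, 8} : Finset (ZMod 9)) → x ≠ y →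
    (x = 6 ∧ y = 7) ∨ (x = 7 ∧ y = 6) := by
  decide +kernel

theorem nine_chords_025 : ∀ x y z : ZMod 9, x ∉ ({0, 2, 5, 1, 3, 6, 8, 4} : Finset (ZMod 9)) →
    y ∉ ({0, 2, 5, 3, 4, 1, 6} : Finset (ZMod 9)) →
    z ∉ ({0, 2, 5, 4, 3, 1, 8} : Finset (ZMod 9)) → x ≠ y → x ≠ z →
    x = 7 ∧ y = 8 ∧ z = 6 := by
  decide +kernel

theorem nine_chords_036 : ∀ x y z : ZMod 9, x ∉ ({0, 3, 6, 1, 2, 4, 7} : Finset (ZMod 9)) →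
    y ∉ ({0, 3, 6, 4, 5, 1, 7} : Finset (ZMod 9)) →
    z ∉ ({0, 3, 6, 7, 8, 1, 4} : Finset (ZMod 9)) → x ≠ y → x ≠ z → y ≠ z →
    (x = 8 ∧ y = 2 ∧ z = 5) ∨ (x = 5 ∧ y = 8 ∧ z = 2) := by
  decide +kernel

/-- A path through all nine cycle vertices between two feet of `v` closes through `v` to a cycle of
length ten. -/
theorem MaxCycle.false_of_list (h : MaxCycle G 3 9 0) {f : ZMod 9 → V} (hf : CycFun G f) {v : V}
    (hv : ∀ i, f i ≠ v) (l : List (ZMod 9)) (hl : l.length = 9) (hnd : l.Nodup) (a b : ZMod 9)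
    (ht : Trace G (f a) (f b) (l.map f)) (ha : G.Adj v (f a)) (hb : G.Adj v (f b)) : False := by
  have := h.max (v :: l.map f) ⟨by simp; omega, List.nodup_cons.2 ⟨fun hm => by
    obtain ⟨i, _, hi⟩ := List.mem_map.1 hm
    exact hv i hi, hnd.map hf.1⟩, v, f b, ht.cons ha, hb.symm⟩
  simp at this
  omega

/-- In each gap pattern at most two choices of chords pass the exclusions. All but one give a
spanning path between two feet, written out as a list; in the remaining one the chords are those of
`petersenChord`. -/
theorem MaxCycle.petersen_of_normalized (h : MaxCycle G 3 9 0) (hn : Fintype.card V = 10)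
    {f : ZMod 9 → V} (hf : CycFun G f) {v : V} (hv : ∀ i, f i ≠ v)
    (hA : nbrPos G f v = {0, 2, 4} ∨ nbrPos G f v = {0, 2, 5} ∨ nbrPos G f v = {0, 3, 6}) :
    Nonempty (G ≃g petersen) := by
  obtain ⟨m, hadj, hm⟩ := h.exists_partner hn hf hv
  have hinj : ∀ i j, i ∉ nbrPos G f v → j ∉ nbrPos G f v → i ≠ j → m i ≠ m j := by
    intro i j hi hj hij e
    have h1 := (hm i hi).2.2.2.2
    rw [e, (hm j hj).2.2.2.2] at h1
    exact hij h1.symm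
  have hmadj : ∀ i, i ∉ nbrPos G f v → G.Adj (f i) (f (m i)) := fun i hi =>
    (hadj i (m i)).2 (Or.inr (Or.inr ⟨hi, rfl⟩))
  have hsucc : ∀ i j, i ∈ nbrPos G f v → j ∈ nbrPos G f v → m (i + 1) ≠ j + 1 := by
    intro i j hi hj e
    refine h.succ_not_adj hf hv hi hj ?_
    rw [← e]; exact hmadj _ (h.add_one_not_mem hf hv i hi)
  have hpred : ∀ i j, i ∈ nbrPos G f v → j ∈ nbrPos G f v → m (i - 1) ≠ j - 1 := by
    intro i j hi hj e
    refine h.pred_not_adj hf hv hi hj ?_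
    rw [← e]
    refine hmadj _ fun hm => h.add_one_not_mem hf hv _ hm ?_
    rwa [sub_add_cancel]
  have hv' : ∀ i, i ∈ nbrPos G f v → G.Adj v (f i) := fun i hi => mem_nbrPos.1 hi
  have hstep : ∀ i j, (j = i + 1 ∨ j = i - 1) → G.Adj (f i) (f j) := by
    rintro i j (e | e)
    · exact (hadj i j).2 (Or.inl e)
    · exact (hadj i j).2 (Or.inr (Or.inl e))
  rcases hA with hA | hA | hA
  · exfalso
    rw [hA] at hm hinj hmadj hsucc hpred hv'
    have h1 := hm 1 (by decide)
    have h3 := hm 3 (by decide)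
    have e1 := hmadj 1 (by decide)
    have e3 := hmadj 3 (by decide)
    rcases nine_chords_024 (m 1) (m 3)
      (by
        have s1 : m 1 ≠ 3 := hsucc 0 2 (by decide) (by decide)
        have s2 : m 1 ≠ 5 := hsucc 0 4 (by decide) (by decide)
        have s3 : m 1 ≠ 8 := hpred 2 0 (by decide) (by decide)
        simp only [Finset.mem_insert, Finset.mem_singleton] at h1 ⊢
        tauto)
      (by
        have s1 : m 3 ≠ 1 := hsucc 2 0 (by decide) (by decide)
        have s2 : m 3 ≠ 5 := hsucc 2 4 (by decide) (by decide)
        have s3 : m 3 ≠ 8 := hpred 4 0 (by decide) (by decide)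
        simp only [Finset.mem_insert, Finset.mem_singleton] at h3 ⊢
        tauto)
      (hinj 1 3 (by decide) (by decide) (by decide)) with ⟨x, y⟩ | ⟨x, y⟩
    · rw [x] at e1
      rw [y] at e3
      refine h.false_of_list hf hv [4, 5, 6, 1, 2, 3, 7, 8, 0] rfl (by decide) 4 0
        ⟨?_, rfl, rfl⟩ (hv' 4 (by decide)) (hv' 0 (by decide))
      simp only [List.map_cons, List.map_nil, List.isChain_cons_cons, List.isChain_singleton,
        and_true]
      exact ⟨hstep _ _ (by decide), hstep _ _ (by decide), e1.symm, hstep _ _ (by decide),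
        hstep _ _ (by decide), e3, hstep _ _ (by decide), hstep _ _ (by decide)⟩
    · rw [x] at e1
      rw [y] at e3
      refine h.false_of_list hf hv [4, 5, 6, 3, 2, 1, 7, 8, 0] rfl (by decide) 4 0
        ⟨?_, rfl, rfl⟩ (hv' 4 (by decide)) (hv' 0 (by decide))
      simp only [List.map_cons, List.map_nil, List.isChain_cons_cons, List.isChain_singleton,
        and_true]
      exact ⟨hstep _ _ (by decide), hstep _ _ (by decide), e3.symm, hstep _ _ (by decide),
        hstep _ _ (by decide), e1, hstep _ _ (by decide), hstep _ _ (by decide)⟩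
  · exfalso
    rw [hA] at hm hinj hmadj hsucc hpred hv'
    have h1 := hm 1 (by decide)
    have h3 := hm 3 (by decide)
    have h4 := hm 4 (by decide)
    have e1 := hmadj 1 (by decide)
    have e3 := hmadj 3 (by decide)
    have e4 := hmadj 4 (by decide)
    obtain ⟨x, y, z⟩ := nine_chords_025 (m 1) (m 3) (m 4)
      (by
        have s1 : m 1 ≠ 3 := hsucc 0 2 (by decide) (by decide)
        have s2 : m 1 ≠ 6 := hsucc 0 5 (by decide) (by decide)
        have s3 : m 1 ≠ 8 := hpred 2 0 (by decide) (by decide)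
        have s4 : m 1 ≠ 4 := hpred 2 5 (by decide) (by decide)
        simp only [Finset.mem_insert, Finset.mem_singleton] at h1 ⊢
        tauto)
      (by
        have s0 : m 3 ≠ 4 := h3.2.2.1
        have s1 : m 3 ≠ 1 := hsucc 2 0 (by decide) (by decide)
        have s2 : m 3 ≠ 6 := hsucc 2 5 (by decide) (by decide)
        simp only [Finset.mem_insert, Finset.mem_singleton] at h3 ⊢
        tauto)
      (by
        have s0 : m 4 ≠ 3 := h4.2.2.2.1
        have s1 : m 4 ≠ 1 := hpred 5 2 (by decide) (by decide)
        have s2 : m 4 ≠ 8 := hpred 5 0 (by decide) (by decide)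
        simp only [Finset.mem_insert, Finset.mem_singleton] at h4 ⊢
        tauto)
      (hinj 1 3 (by decide) (by decide) (by decide)) (hinj 1 4 (by decide) (by decide) (by decide))
    rw [x] at e1
    rw [y] at e3
    rw [z] at e4
    refine h.false_of_list hf hv [0, 8, 7, 1, 2, 3, 4, 6, 5] rfl (by decide) 0 5
      ⟨?_, rfl, rfl⟩ (hv' 0 (by decide)) (hv' 5 (by decide))
    simp only [List.map_cons, List.map_nil, List.isChain_cons_cons, List.isChain_singleton,
      and_true]
    exact ⟨hstep _ _ (by decide), hstep _ _ (by decide), e1.symm, hstep _ _ (by decide),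
      hstep _ _ (by decide), hstep _ _ (by decide), e4, hstep _ _ (by decide)⟩
  · have hadj' := hadj
    have hA' := hA
    rw [hA] at hm hinj hmadj hsucc hpred hv'
    have h1 := hm 1 (by decide)
    have h4 := hm 4 (by decide)
    have h7 := hm 7 (by decide)
    have e1 := hmadj 1 (by decide)
    have e4 := hmadj 4 (by decide)
    have e7 := hmadj 7 (by decide)
    rcases nine_chords_036 (m 1) (m 4) (m 7)
      (by
        have s0 : m 1 ≠ 2 := h1.2.2.1
        have s1 : m 1 ≠ 4 := hsucc 0 3 (by decide) (by decide)
        have s2 : m 1 ≠ 7 := hsucc 0 6 (by decide) (by decide)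
        simp only [Finset.mem_insert, Finset.mem_singleton] at h1 ⊢
        tauto)
      (by
        have s0 : m 4 ≠ 5 := h4.2.2.1
        have s1 : m 4 ≠ 1 := hsucc 3 0 (by decide) (by decide)
        have s2 : m 4 ≠ 7 := hsucc 3 6 (by decide) (by decide)
        simp only [Finset.mem_insert, Finset.mem_singleton] at h4 ⊢
        tauto)
      (by
        have s0 : m 7 ≠ 8 := h7.2.2.1
        have s1 : m 7 ≠ 1 := hsucc 6 0 (by decide) (by decide)
        have s2 : m 7 ≠ 4 := hsucc 6 3 (by decide) (by decide)
        simp only [Finset.mem_insert, Finset.mem_singleton] at h7 ⊢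
        tauto)
      (hinj 1 4 (by decide) (by decide) (by decide)) (hinj 1 7 (by decide) (by decide) (by decide))
      (hinj 4 7 (by decide) (by decide) (by decide)) with ⟨x, y, z⟩ | ⟨x, y, z⟩
    · exfalso
      rw [x] at e1
      rw [y] at e4
      rw [z] at e7
      refine h.false_of_list hf hv [0, 8, 1, 2, 3, 4, 5, 7, 6] rfl (by decide) 0 6
        ⟨?_, rfl, rfl⟩ (hv' 0 (by decide)) (hv' 6 (by decide))
      simp only [List.map_cons, List.map_nil, List.isChain_cons_cons, List.isChain_singleton,
        and_true]
      exact ⟨hstep _ _ (by decide), e1.symm, hstep _ _ (by decide), hstep _ _ (by decide),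
        hstep _ _ (by decide), hstep _ _ (by decide), e7.symm, hstep _ _ (by decide)⟩
    · have h5 : m 5 = 1 := by have := h1.2.2.2.2; rwa [x] at this
      have h8 : m 8 = 4 := by have := h4.2.2.2.2; rwa [y] at this
      have h2 : m 2 = 7 := by have := h7.2.2.2.2; rwa [z] at this
      have hchord : ∀ i : ZMod 9, i ∉ ({0, 3, 6} : Finset (ZMod 9)) → m i = petersenChord i := by
        have hcases : ∀ i : ZMod 9, i ∉ ({0, 3, 6} : Finset (ZMod 9)) →
            i = 1 ∨ i = 2 ∨ i = 4 ∨ i = 5 ∨ i = 7 ∨ i = 8 := by decide +kernel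
        intro i hi
        rcases hcases i hi with rfl | rfl | rfl | rfl | rfl | rfl
        · rw [x]; rfl
        · rw [h2]; rfl
        · rw [y]; rfl
        · rw [h5]; rfl
        · rw [z]; rfl
        · rw [h8]; rfl
      refine nonempty_iso_petersen hn hf hv hA' fun i j => ?_
      rw [hadj' i j, hA']
      exact or_congr Iff.rfl (or_congr Iff.rfl (and_congr_right fun hi => by rw [hchord i hi]))

theorem MaxCycle.nonempty_iso_petersen {c : ℕ} [NeZero c] (h : MaxCycle G 3 c 0)
    (hn : Fintype.card V = 10) {f : ZMod c → V} (hf : CycFun G f) {v : V} (hv : ∀ i, f i ≠ v) :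
    Nonempty (G ≃g petersen) := by
  obtain rfl := h.eq_nine hn hf hv
  obtain ⟨f', hf', hoff, b, d, b0, d0, hbd, b1, d1, b1', d1', hbd1, hdb1, hA⟩ := h.exists_feet hf hv
  rw [hoff] at hv
  obtain ⟨s, hs⟩ := zmod_nine_spaced_triples b d b0 d0 hbd b1 d1 b1' d1' hbd1 hdb1
  rw [← hA] at hs
  have hshift : ∀ x y : ZMod 9, nbrPos G f' v = {s, s + x, s + y} →
      nbrPos G (fun i => f' (s + i)) v = {0, x, y} := by
    intro x y e
    ext i
    have := Finset.ext_iff.1 e (s + i)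
    rw [mem_nbrPos] at this ⊢
    rw [this]
    simp
  rcases hs with hs | hs | hs | hs
  · exact h.petersen_of_normalized hn (hf'.shift s) (fun _ => hv _) (Or.inl (hshift _ _ hs))
  · exact h.petersen_of_normalized hn (hf'.shift s) (fun _ => hv _)
      (Or.inr (Or.inl (hshift _ _ hs)))
  · refine h.petersen_of_normalized hn (hf'.shift s).reflect (fun _ => hv _)
      (Or.inr (Or.inl ?_))
    have := hshift (-2) (-5) (by simpa [sub_eq_add_neg] using hs)
    ext i
    have := Finset.ext_iff.1 this (-i)
    rw [mem_nbrPos] at this ⊢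
    rw [this]
    simp
  · exact h.petersen_of_normalized hn (hf'.shift s) (fun _ => hv _)
      (Or.inr (Or.inr (hshift _ _ hs)))

end CubicTen

/-! ### Regular graphs without cut vertices -/

section TwoConnected

variable {V : Type*} [Fintype V] [DecidableEq V] {G : SimpleGraph V} [DecidableRel G.Adj] {k : ℕ}

theorem SimpleGraph.IsRegularOfDegree.even_card_mul (hreg : G.IsRegularOfDegree k) :
    Even (Fintype.card V * k) := by
  have h := G.sum_degrees_eq_twice_card_edges
  rw [Finset.sum_congr rfl (fun v _ => hreg v), Finset.sum_const, Finset.card_univ,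
    smul_eq_mul] at h
  exact ⟨_, h.trans (two_mul _)⟩

/-- A graph without a Hamiltonian cycle has a longest cycle, and among all cycles of this length
one whose complement contains a longest possible path. -/
theorem exists_maxCycle (hk : 2 ≤ k) (hconn : G.Connected) (hreg : G.IsRegularOfDegree k)
    (hham : ¬ G.IsHamiltonian) (h2 : NoCutVertex G) (hn : Fintype.card V ≤ 2 * k + 4) :
    ∃ c p, 2 * k ≤ c ∧ MaxCycle G k c p ∧ ∃ (f : ZMod c → V) (Q : List V) (u w : V),
      CycFun G f ∧ OffPath f Q ∧ Trace G u w Q ∧ Q.length = p + 1 := by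
  obtain ⟨Q₀, hQ₀, hk₀⟩ := exists_long_cycle hk hconn hreg hham h2 hn
  obtain ⟨C, hC, hmax⟩ := exists_maximal_of_bounded (p := fun l => CyclicList G l)
    (φ := List.length) (Fintype.card V) (fun l hl => hl.2.1.length_le_card) ⟨Q₀, hQ₀⟩
  have hlen : C.length < Fintype.card V :=
    lt_of_le_of_ne hC.2.1.length_le_card fun e => hham (hC.isHamiltonian e)
  obtain ⟨f₀, hf₀, -⟩ := hC.exists_cycFun rfl
  have : NeZero C.length := ⟨by have := hC.1; omega⟩
  obtain ⟨x, hx⟩ : ∃ x, ∀ i, f₀ i ≠ x := by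
    by_contra hcon
    push Not at hcon
    have := Fintype.card_le_of_surjective f₀ hcon
    rw [ZMod.card] at this
    omega
  obtain ⟨⟨f, Q, u, w⟩, ⟨hf, hQ, hT⟩, hQmax⟩ := exists_maximal_of_bounded
    (p := fun a : (ZMod C.length → V) × List V × V × V =>
      CycFun G a.1 ∧ OffPath a.1 a.2.1 ∧ Trace G a.2.2.1 a.2.2.2 a.2.1)
    (φ := fun a => a.2.1.length) (Fintype.card V)
    (fun a ha => ha.2.1.1.length_le_card)
    ⟨(f₀, [x], x, x), hf₀, OffPath.single hx, Trace.single x⟩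
  have hpos : 0 < Q.length := List.length_pos_of_mem hT.left_mem
  refine ⟨C.length, Q.length - 1, hk₀.trans (hmax Q₀ hQ₀), ⟨hC.1, hreg, hmax,
    fun f' hf' Q' u' w' hQ' hT' => ?_⟩, f, Q, u, w, hf, hQ, hT, by omega⟩
  have := hQmax (f', Q', u', w') ⟨hf', hQ', hT'⟩
  simp only at this
  omega

theorem nonempty_iso_petersen_of_noCutVertex (hk : 3 ≤ k) (hconn : G.Connected)
    (hreg : G.IsRegularOfDegree k) (hham : ¬ G.IsHamiltonian) (h2 : NoCutVertex G)
    (hn : Fintype.card V ≤ 2 * k + 4) (h4 : Fintype.card V = 2 * k + 4 → Odd k) :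
    k = 3 ∧ Fintype.card V = 10 ∧ Nonempty (G ≃g petersen) := by
  obtain ⟨c, p, hc, h, f, Q, u, w, hf, hQ, hT, hl⟩ :=
    exists_maxCycle (by omega) hconn hreg hham h2 hn
  have : NeZero c := ⟨by omega⟩
  have h3 : Fintype.card V = 2 * k + 3 → Even k := fun e => by
    have := hreg.even_card_mul
    rw [e, Nat.even_mul] at this
    rcases this with h | h
    · exact absurd h (by rw [Nat.not_even_iff_odd]; exact ⟨k + 1, by ring⟩)
    · exact h
  have hp : p = 0 := by
    rcases hk.eq_or_lt with rfl | hk4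
    · exact h.eq_zero_of_eq_three hc hn h2 hf hQ hT hl
    · exact h.eq_zero_of_four_le hk4 hc hn h3 h4 hf hQ hT hl
  subst hp
  have hu : ∀ i, f i ≠ u := fun i e => hQ.2 u hT.left_mem i e
  obtain ⟨hn4, -⟩ := h.card_longGaps_eq_one hk hf hu hn
  have hodd := h4 hn4
  rcases Nat.lt_or_ge k 5 with hk5 | hk5
  -- The counting leaves `k = 3` and `k = 4` open; order `2k+4` is assumed to occur only with odd
  -- `k`.
  · have : k ≠ 4 := by rintro rfl; exact absurd hodd (by decide)
    obtain rfl : k = 3 := by omega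
    exact ⟨rfl, hn4, h.nonempty_iso_petersen hn4 hf hu⟩
  · exact (h.false_of_five_le hk5 hf hu hn).elim

end TwoConnected

/-! ### Cut vertices and the two sides of a separation -/

section Separations

variable {V : Type*} [Fintype V] [DecidableEq V]

/-- The vertex `v` separates `S` from `T`, and there are no further vertices. -/
structure Separation (G : SimpleGraph V) (v : V) (S T : Finset V) : Prop where
  left : v ∉ S
  right : v ∉ T
  disj : Disjoint S T
  cover : ∀ x, x = v ∨ x ∈ S ∨ x ∈ T
  not_adj : ∀ x ∈ S, ∀ y ∈ T, ¬ G.Adj x y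

variable {G : SimpleGraph V} {v : V} {S T : Finset V}

theorem Separation.symm (h : Separation G v S T) : Separation G v T S :=
  ⟨h.right, h.left, h.disj.symm, fun x => (h.cover x).imp_right Or.symm,
    fun x hx y hy hxy => h.not_adj y hy x hx hxy.symm⟩

theorem exists_separation (h : ¬ NoCutVertex G) :
    ∃ v S T, Separation G v S T ∧ S.Nonempty ∧ T.Nonempty := by
  classical
  unfold NoCutVertex at h
  push Not at h
  obtain ⟨v, S, hv, ⟨x, hx⟩, ⟨y, hy, hyv⟩, hS⟩ := h
  refine ⟨v, Finset.univ.filter (· ∈ S), Finset.univ.filter fun y => y ∉ S ∧ y ≠ v, ⟨by simpa,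
    by simp, ?_, ?_, ?_⟩, ⟨x, by simpa⟩, ⟨y, by simpa using ⟨hy, hyv⟩⟩⟩
  · rw [Finset.disjoint_left]
    intro x hx hx'
    simp only [Finset.mem_filter, Finset.mem_univ, true_and] at hx hx'
    exact hx'.1 hx
  · intro x
    simp only [Finset.mem_filter, Finset.mem_univ, true_and]
    tauto
  · intro x hx y hy
    simp only [Finset.mem_filter, Finset.mem_univ, true_and] at hx hy
    exact hS x hx y hy.1 hy.2

theorem Separation.card_add_card (h : Separation G v S T) :
    S.card + T.card + 1 = Fintype.card V := by
  have : insert v (S ∪ T) = Finset.univ := by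
    ext x
    simpa using h.cover x
  rw [← Finset.card_univ, ← this, Finset.card_insert_of_notMem (by simp [h.left, h.right]),
    Finset.card_union_of_disjoint h.disj]

/-- A graph with a cut vertex has no Hamiltonian cycle. -/
theorem Separation.not_isHamiltonian (h : Separation G v S T) (hS : S.Nonempty)
    (hT : T.Nonempty) : ¬ G.IsHamiltonian := by
  intro hham
  obtain ⟨x, hx⟩ := hS
  obtain ⟨y, hy⟩ := hT
  have hvx : v ≠ x := fun e => h.left (e ▸ hx)
  have : Nontrivial V := ⟨v, x, hvx⟩
  obtain ⟨p, hp⟩ := hham.exists_isHamiltonianCycle v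
  -- A walk that starts in `S` stays there until it meets `v`. Removing the first step of a
  -- Hamiltonian cycle based at `v` leaves a Hamiltonian path that meets `v` only at its end, so it
  -- misses the other side.
  have key : ∀ {S T : Finset V} {a b : V} (q : G.Walk a b), Separation G v S T → a ∈ S →
      v ∉ q.support.dropLast → ∀ z ∈ q.support.dropLast, z ∈ S := by
    intro S T a b q h
    induction q with
    | nil => simp
    | @cons a b c hab q ih =>
      intro ha hv z hz
      rw [SimpleGraph.Walk.support_cons, List.dropLast_cons_of_ne_nil (by simp)] at hv hz
      rw [List.mem_cons, not_or] at hv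
      rcases List.mem_cons.1 hz with rfl | hz
      · exact ha
      · cases q with
        | nil => simp at hz
        | cons hbd q =>
          rcases h.cover b with rfl | hb | hb
          · exact absurd (by simp [List.dropLast_cons_of_ne_nil]) hv.2
          · exact ih hb hv.2 z hz
          · exact absurd hab (h.not_adj a ha b hb)
  have hend : ∀ {S T : Finset V} {a z : V} (q : G.Walk a v), Separation G v S T → a ∈ S →
      q.IsHamiltonian → z ∈ T → False := by
    intro S T a z q h ha hq hz
    have hnd := hq.isPath.support_nodup
    have hzs := hq.mem_support z
    rw [← SimpleGraph.Walk.dropLast_support_concat, List.nodup_append] at hnd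
    rw [← SimpleGraph.Walk.dropLast_support_concat, List.mem_append, List.mem_singleton] at hzs
    rcases hzs with hzs | rfl
    · exact Finset.disjoint_left.1 h.disj
        (key q h ha (fun hv => hnd.2.2 v hv v (by simp) rfl) z hzs) hz
    · exact h.right hz
  have hadj := p.adj_snd hp.not_nil
  rcases h.cover p.snd with e | hs | hs
  · exact G.irrefl (e ▸ hadj)
  · exact hend p.tail h hs hp.isHamiltonian_tail hy
  · exact hend p.tail h.symm hs hp.isHamiltonian_tail hx

theorem even_sum_card_neighborFinset_inter [DecidableRel G.Adj] (S : Finset V) :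
    Even (∑ x ∈ S, (G.neighborFinset x ∩ S).card) := by
  classical
  have h := (G.induce (S : Set V)).sum_degrees_eq_twice_card_edges
  refine ⟨((G.induce (S : Set V)).edgeFinset).card, ?_⟩
  rw [← two_mul, ← h, ← Finset.sum_coe_sort]
  refine Finset.sum_congr rfl fun x _ => ?_
  rw [← SimpleGraph.card_neighborFinset_eq_degree]
  symm
  refine Finset.card_bij (fun y _ => (y : V)) ?_ ?_ ?_
  · intro y hy
    simpa using hy
  · intro y _ z _ hyz
    exact Subtype.ext hyz
  · intro y hy
    simp only [Finset.mem_inter, SimpleGraph.mem_neighborFinset] at hy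
    exact ⟨⟨y, hy.2⟩, by simpa using hy.1, rfl⟩

theorem degree_eq_of_equiv {α : Type*} {A : SimpleGraph α} (P : Finset V) (e : α ≃ P)
    [DecidableRel G.Adj] (hA : ∀ i j, A.Adj i j ↔ G.Adj (e i) (e j)) (i : α)
    [Fintype (A.neighborSet i)] : A.degree i = (G.neighborFinset (e i : V) ∩ P).card := by
  rw [← SimpleGraph.card_neighborFinset_eq_degree]
  refine Finset.card_bij (fun j _ => (e j : V)) ?_ ?_ ?_
  · intro j hj
    simpa [hA] using hj
  · intro j _ l _ h
    exact e.injective (Subtype.ext h)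
  · intro y hy
    simp only [Finset.mem_inter, SimpleGraph.mem_neighborFinset] at hy
    exact ⟨e.symm ⟨y, hy.2⟩, by simpa [hA] using hy.1, by simp⟩

variable [DecidableRel G.Adj] {k : ℕ}

theorem Separation.exists_adj (h : Separation G v S T) (hconn : G.Connected) (hS : S.Nonempty) :
    (G.neighborFinset v ∩ S).Nonempty := by
  obtain ⟨x, hx, y, hy, hxy⟩ := hconn.exists_adj_compl (S := (S : Set V)) (by simpa) (by
    intro e
    exact h.left (by rw [← Finset.mem_coe, e]; trivial))
  refine ⟨x, ?_⟩
  rcases h.cover y with rfl | hy' | hy'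
  · simpa using ⟨hxy.symm, hx⟩
  · exact absurd hy' hy
  · exact absurd hxy (h.not_adj x hx y hy')

theorem Separation.card_inter_add_card_inter (h : Separation G v S T)
    (hreg : G.IsRegularOfDegree k) :
    (G.neighborFinset v ∩ S).card + (G.neighborFinset v ∩ T).card = k := by
  rw [← hreg v, ← SimpleGraph.card_neighborFinset_eq_degree, ← Finset.card_union_of_disjoint
    (h.disj.mono Finset.inter_subset_right Finset.inter_subset_right),
    ← Finset.inter_union_distrib_left, Finset.inter_eq_left.2]
  intro x hx
  rw [SimpleGraph.mem_neighborFinset] at hx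
  rcases h.cover x with rfl | hx'
  · exact absurd hx G.irrefl
  · simpa using hx'

theorem Separation.neighborFinset_subset (h : Separation G v S T) {x : V} (hx : x ∈ S) :
    G.neighborFinset x ⊆ insert v S := by
  intro y hy
  rw [SimpleGraph.mem_neighborFinset] at hy
  rcases h.cover y with rfl | hy' | hy'
  · simp
  · simp [hy']
  · exact absurd hy (h.not_adj x hx y hy')

theorem Separation.card_inter (h : Separation G v S T) (hreg : G.IsRegularOfDegree k) {x : V}
    (hx : x ∈ S) : (G.neighborFinset x ∩ S).card + (if G.Adj v x then 1 else 0) = k := by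
  rw [← hreg x, ← SimpleGraph.card_neighborFinset_eq_degree]
  have hsub := h.neighborFinset_subset hx
  split_ifs with hvx
  · rw [← Finset.card_insert_of_notMem (a := v) (by simp [h.left])]
    congr 1
    ext y
    have := @hsub y
    simp only [Finset.mem_insert, Finset.mem_inter, SimpleGraph.mem_neighborFinset] at this ⊢
    constructor
    · rintro (rfl | hy)
      · exact hvx.symm
      · exact hy.1
    · intro hy
      exact (this hy).imp_right fun hs => ⟨hy, hs⟩
  · rw [Finset.inter_eq_left.2, add_zero]
    intro y hy
    rcases Finset.mem_insert.1 (hsub hy) with rfl | hy'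
    · exact absurd (by simpa using hy) fun h => hvx (SimpleGraph.Adj.symm h)
    · exact hy'

/-- A vertex of `S` has all its neighbours in `S` or at `v`, so `k ≤ |S|`. As `v` also has a
neighbour in `T`, it has fewer than `k` in `S`. Hence some vertex of `S` is not adjacent to `v` and
has `k` neighbours inside `S`. -/
theorem Separation.lt_card (h : Separation G v S T) (hconn : G.Connected)
    (hreg : G.IsRegularOfDegree k) (hT : T.Nonempty) : k < S.card ∨ S = ∅ := by
  by_contra hcon
  push Not at hcon
  obtain ⟨hk, hS⟩ := hcon
  have h1 := h.card_inter_add_card_inter hreg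
  have h2 := Finset.card_pos.2 (h.symm.exists_adj hconn hT)
  have key : ∀ x ∈ S, (G.neighborFinset x ∩ S).card < S.card := fun x hx =>
    Finset.card_lt_card ⟨Finset.inter_subset_right, fun hs => by simpa using hs hx⟩
  obtain ⟨x, hx⟩ := hS
  have h3 := h.card_inter hreg hx
  have h4 := key x hx
  obtain ⟨y, hy, hy'⟩ := Finset.exists_mem_notMem_of_card_lt_card
    (s := G.neighborFinset v ∩ S) (t := S) (by split_ifs at h3 <;> omega)
  have h5 := h.card_inter hreg hy
  have h6 := key y hy
  have hvy : ¬ G.Adj v y := fun hvy => hy' (by simpa using ⟨hvy, hy⟩)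
  rw [if_neg hvy] at h5
  omega

/-- The degree sum of the graph induced on `S` is even and equals `|S| * k` minus the number of
edges to `v`. -/
theorem Separation.even_add (h : Separation G v S T) (hreg : G.IsRegularOfDegree k) :
    Even (S.card * k + (G.neighborFinset v ∩ S).card) := by
  have h1 := even_sum_card_neighborFinset_inter (G := G) S
  have h2 : ∑ x ∈ S, (G.neighborFinset x ∩ S).card + (G.neighborFinset v ∩ S).card
      = S.card * k := by
    have : (G.neighborFinset v ∩ S).card = ∑ x ∈ S, if G.Adj v x then 1 else 0 := by
      rw [← Finset.card_filter]
      congr 1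
      ext x
      simp [and_comm]
    rw [this, ← Finset.sum_add_distrib, Finset.sum_congr rfl fun x hx => h.card_inter hreg hx,
      Finset.sum_const, smul_eq_mul]
  rw [← h2]
  rw [Nat.even_add] at *
  simp only [Nat.even_add]
  tauto

open Classical in
/-- A regular graph with a cut vertex `v` arises by attaching `v` and one side to the other. -/
theorem Separation.exists_iso_attach (h : Separation G v S T) (hreg : G.IsRegularOfDegree k)
    (hk : 1 ≤ k) {N M : ℕ} (hN : S.card + 1 = N) (hM : T.card = M) :
    ∃ (A : SimpleGraph (Fin N)) (a : Fin N) (B : SimpleGraph (Fin M)),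
      A.degree a = (G.neighborFinset v ∩ S).card ∧ (∀ x, x ≠ a → A.degree x = k) ∧
      (Finset.univ.filter fun y => B.degree y = k).card + (G.neighborFinset v ∩ T).card = M ∧
      (Finset.univ.filter fun y => B.degree y = k - 1).card = (G.neighborFinset v ∩ T).card ∧
      Nonempty (G ≃g attach A a B {y | B.degree y = k - 1}) := by
  have hP : (insert v S).card = N := by rw [Finset.card_insert_of_notMem h.left, hN]
  let e : Fin N ≃ (insert v S : Finset V) := ((insert v S).equivFinOfCardEq hP).symm
  let e' : Fin M ≃ T := (T.equivFinOfCardEq hM).symm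
  let a : Fin N := e.symm ⟨v, by simp⟩
  have ha : (e a : V) = v := by simp [a]
  have ha' : ∀ x, (e x : V) = v ↔ x = a := fun x =>
    ⟨fun hx => e.injective (Subtype.ext (hx.trans ha.symm)), fun hx => hx ▸ ha⟩
  obtain ⟨A, hA⟩ : ∃ A : SimpleGraph (Fin N), ∀ i j, A.Adj i j ↔ G.Adj (e i) (e j) :=
    ⟨G.comap fun i => (e i : V), fun _ _ => Iff.rfl⟩
  obtain ⟨B, hB⟩ : ∃ B : SimpleGraph (Fin M), ∀ i j, B.Adj i j ↔ G.Adj (e' i) (e' j) :=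
    ⟨G.comap fun i => (e' i : V), fun _ _ => Iff.rfl⟩
  have hdeg : ∀ y, B.degree y + (if G.Adj v (e' y) then 1 else 0) = k :=
    fun y => by rw [degree_eq_of_equiv T e' hB]; exact h.symm.card_inter hreg (e' y).2
  have hfil : (Finset.univ.filter fun y => G.Adj v (e' y)).card
      = (G.neighborFinset v ∩ T).card := by
    refine Finset.card_bij (fun y _ => (e' y : V)) ?_ ?_ ?_
    · intro y hy
      simpa using hy
    · intro y _ z _ hyz
      exact e'.injective (Subtype.ext hyz)
    · intro y hy
      simp only [Finset.mem_inter, SimpleGraph.mem_neighborFinset] at hy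
      exact ⟨e'.symm ⟨y, hy.2⟩, by simpa using hy.1, by simp⟩
  have hpred : ∀ y, B.degree y = k - 1 ↔ G.Adj v (e' y) := by
    intro y
    have := hdeg y
    split_ifs at this with hy
    · exact ⟨fun _ => hy, fun _ => by omega⟩
    · exact ⟨fun h => by omega, fun h => absurd h hy⟩
  have hself : ∀ y, B.degree y = k ↔ ¬ G.Adj v (e' y) := by
    intro y
    have := hdeg y
    split_ifs at this with hy
    · exact ⟨fun h => by omega, fun h => absurd hy h⟩
    · exact ⟨fun _ => hy, fun h => by omega⟩
  refine ⟨A, a, B, ?_, ?_, ?_, ?_, ?_⟩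
  · rw [degree_eq_of_equiv _ e hA, ha]
    congr 1
    ext x
    simp only [Finset.mem_inter, SimpleGraph.mem_neighborFinset, Finset.mem_insert]
    exact and_congr_right fun hx => or_iff_right fun e => G.irrefl (e ▸ hx)
  · intro x hx
    have hxS : (e x : V) ∈ S :=
      (Finset.mem_insert.1 (e x).2).resolve_left fun hv => hx ((ha' x).1 hv)
    rw [degree_eq_of_equiv _ e hA, Finset.inter_eq_left.2 (h.neighborFinset_subset hxS),
      SimpleGraph.card_neighborFinset_eq_degree, hreg]
  · simp only [hself]
    rw [← hfil, add_comm, Finset.card_filter_add_card_filter_not, Finset.card_univ,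
      Fintype.card_fin]
  · simp only [hpred]
    exact hfil
  · have hbij : Function.Bijective (Sum.elim (fun i => (e i : V)) fun j => (e' j : V)) := by
      constructor
      · have hne : ∀ i j, (e i : V) ≠ e' j := fun i j hij => by
          rcases Finset.mem_insert.1 (e i).2 with hv | hS
          · exact h.right (by rw [← hv, hij]; exact (e' j).2)
          · exact Finset.disjoint_left.1 h.disj hS (by rw [hij]; exact (e' j).2)
        rintro (i | i) (j | j) hij
        · exact congrArg _ (e.injective (Subtype.ext hij))
        · exact (hne i j hij).elim
        · exact (hne j i hij.symm).elim
        · exact congrArg _ (e'.injective (Subtype.ext hij))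
      · intro x
        rcases h.cover x with hx | hx | hx
        · exact ⟨Sum.inl a, by rw [hx]; exact ha⟩
        · exact ⟨Sum.inl (e.symm ⟨x, by simp [hx]⟩), by simp⟩
        · exact ⟨Sum.inr (e'.symm ⟨x, hx⟩), by simp⟩
    have hcross : ∀ i j, G.Adj (e i : V) (e' j) ↔
        i = a ∧ j ∈ {y | B.degree y = k - 1} := by
      intro i j
      rw [Set.mem_ofPred_eq, hpred, ← ha']
      constructor
      · intro hij
        rcases Finset.mem_insert.1 (e i).2 with hv | hS
        · exact ⟨hv, hv ▸ hij⟩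
        · exact absurd hij (h.not_adj _ hS _ (e' j).2)
      · rintro ⟨hi, hj⟩
        rwa [hi]
    refine ⟨SimpleGraph.Iso.symm ⟨Equiv.ofBijective _ hbij, ?_⟩⟩
    rintro (i | i) (j | j)
    · exact (hA i j).symm
    · exact hcross i j
    · exact (G.adj_comm _ _).trans (hcross j i)
    · exact (hB i j).symm

end Separations

/-! ### Invariance under isomorphism -/

section Isomorphisms

variable {V W : Type*} [Fintype V] [Fintype W] {G : SimpleGraph V} {H : SimpleGraph W}

theorem SimpleGraph.IsHamiltonian.of_iso [DecidableEq V] [DecidableEq W] (hG : G.IsHamiltonian)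
    (e : G ≃g H) : H.IsHamiltonian := by
  intro hc
  obtain ⟨a, p, hp⟩ := hG (by rwa [Fintype.card_congr e.toEquiv])
  exact ⟨_, p.map e.toHom, hp.map e.bijective⟩

theorem degree_eq_of_iso (e : G ≃g H) (x : V) [Fintype (G.neighborSet x)]
    [Fintype (H.neighborSet (e x))] : G.degree x = H.degree (e x) := by
  rw [← SimpleGraph.card_neighborSet_eq_degree, ← SimpleGraph.card_neighborSet_eq_degree]
  exact Fintype.card_congr (e.mapNeighborSet x)

end Isomorphisms

/-! ### Attaching graphs at a cut vertex -/

section Attach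

variable {α β : Type*} [Fintype α] [Fintype β] [DecidableEq α] [DecidableEq β]
  {A : SimpleGraph α} {a : α} {B : SimpleGraph β} {S : Set β}

theorem degree_attach_inr [DecidablePred (· ∈ S)] (y : β) [Fintype (B.neighborSet y)]
    [Fintype ((attach A a B S).neighborSet (Sum.inr y))] :
    (attach A a B S).degree (Sum.inr y) = B.degree y + if y ∈ S then 1 else 0 := by
  rw [← SimpleGraph.card_neighborFinset_eq_degree, ← SimpleGraph.card_neighborFinset_eq_degree]
  have : (attach A a B S).neighborFinset (Sum.inr y)
      = (if y ∈ S then {a} else ∅ : Finset α).disjSum (B.neighborFinset y) := by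
    ext (x | x)
    · rw [SimpleGraph.mem_neighborFinset, Finset.inl_mem_disjSum]
      change x = a ∧ y ∈ S ↔ _
      split_ifs with h <;> simp [h]
    · rw [SimpleGraph.mem_neighborFinset, Finset.inr_mem_disjSum, SimpleGraph.mem_neighborFinset]
      exact Iff.rfl
  rw [this, Finset.card_disjSum, add_comm]
  split_ifs <;> simp

theorem degree_attach_inl_self [DecidablePred (· ∈ S)] [Fintype (A.neighborSet a)]
    [Fintype ((attach A a B S).neighborSet (Sum.inl a))] :
    (attach A a B S).degree (Sum.inl a) = A.degree a + (Finset.univ.filter (· ∈ S)).card := by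
  rw [← SimpleGraph.card_neighborFinset_eq_degree, ← SimpleGraph.card_neighborFinset_eq_degree,
    ← Finset.card_disjSum]
  congr 1
  ext (x | x)
  · rw [SimpleGraph.mem_neighborFinset, Finset.inl_mem_disjSum, SimpleGraph.mem_neighborFinset]
    exact Iff.rfl
  · rw [SimpleGraph.mem_neighborFinset, Finset.inr_mem_disjSum]
    change a = a ∧ x ∈ S ↔ _
    simp

theorem degree_attach_inl {x : α} (hx : x ≠ a) [Fintype (A.neighborSet x)]
    [Fintype ((attach A a B S).neighborSet (Sum.inl x))] :
    (attach A a B S).degree (Sum.inl x) = A.degree x := by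
  rw [← SimpleGraph.card_neighborFinset_eq_degree, ← SimpleGraph.card_neighborFinset_eq_degree,
    ← Finset.card_map (⟨Sum.inl, Sum.inl_injective⟩ : α ↪ α ⊕ β)]
  congr 1
  ext (z | z)
  · rw [SimpleGraph.mem_neighborFinset]
    change A.Adj x z ↔ _
    simp
  · rw [SimpleGraph.mem_neighborFinset]
    change x = a ∧ z ∈ S ↔ _
    simp [hx]

theorem separation_attach : Separation (attach A a B S) (Sum.inl a)
    ((Finset.univ.erase a).map ⟨Sum.inl, Sum.inl_injective⟩)
    (Finset.univ.map ⟨Sum.inr, Sum.inr_injective⟩) := by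
  refine ⟨by simp, by simp, ?_, ?_, ?_⟩
  · rw [Finset.disjoint_left]
    simp
  · rintro (x | x) <;> simp [em]
  · intro x hx y hy
    simp only [Finset.mem_map, Finset.mem_erase, Finset.mem_univ, and_true, true_and,
      Function.Embedding.coeFn_mk] at hx hy
    obtain ⟨x, hx, rfl⟩ := hx
    obtain ⟨y, rfl⟩ := hy
    exact fun h => hx h.1

theorem connected_attach (hA : A.Connected) (hB : B.Connected) (hS : S.Nonempty) :
    (attach A a B S).Connected := by
  obtain ⟨y, hy⟩ := hS
  rw [SimpleGraph.connected_iff_exists_forall_reachable]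
  have hAr : ∀ x, (attach A a B S).Reachable (Sum.inl a) (Sum.inl x) := fun x =>
    (hA.preconnected a x).map ⟨Sum.inl, fun h => h⟩
  have hBr : ∀ x, (attach A a B S).Reachable (Sum.inr y) (Sum.inr x) := fun x =>
    (hB.preconnected y x).map ⟨Sum.inr, fun h => h⟩
  have hadj : (attach A a B S).Adj (Sum.inl a) (Sum.inr y) := ⟨rfl, hy⟩
  refine ⟨Sum.inl a, ?_⟩
  rintro (x | x)
  · exact hAr x
  · exact hadj.reachable.trans (hBr x)

/-- Two unreachable vertices would have disjoint closed neighbourhoods of at least `d + 1` vertices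
each. -/
theorem reachable_of_card_le {d : ℕ} {x y : α} [Fintype (A.neighborSet x)]
    [Fintype (A.neighborSet y)] (hx : d ≤ A.degree x) (hy : d ≤ A.degree y)
    (hd : Fintype.card α ≤ 2 * d + 1) : A.Reachable x y := by
  by_contra hxy
  have hne : x ≠ y := by rintro rfl; exact hxy (SimpleGraph.Reachable.refl x)
  have hdis : Disjoint (A.neighborFinset x) (A.neighborFinset y) := by
    rw [Finset.disjoint_left]
    intro z h1 h2
    rw [SimpleGraph.mem_neighborFinset] at h1 h2
    exact hxy (h1.reachable.trans h2.symm.reachable)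
  have hsub : A.neighborFinset x ∪ A.neighborFinset y ⊆ Finset.univ \ {x, y} := by
    intro z hz
    rw [Finset.mem_union, SimpleGraph.mem_neighborFinset, SimpleGraph.mem_neighborFinset] at hz
    simp only [Finset.mem_sdiff, Finset.mem_univ, Finset.mem_insert, Finset.mem_singleton,
      true_and, not_or]
    constructor
    · rintro rfl
      rcases hz with h | h
      · exact A.irrefl h
      · exact hxy h.symm.reachable
    · rintro rfl
      rcases hz with h | h
      · exact hxy h.reachable
      · exact A.irrefl h
  have h := Finset.card_le_card hsub
  rw [Finset.card_union_of_disjoint hdis, Finset.card_sdiff_of_subset (Finset.subset_univ _),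
    Finset.card_pair hne, SimpleGraph.card_neighborFinset_eq_degree,
    SimpleGraph.card_neighborFinset_eq_degree, Finset.card_univ] at h
  have : 2 ≤ Fintype.card α := by rw [← Finset.card_pair hne]; exact Finset.card_le_univ _
  omega

open Classical in
/-- The graphs obtained by attaching a vertex `a` of small degree to the vertices of small degree
of another graph are connected, regular and have no Hamiltonian cycle. -/
theorem attach_spec {k t : ℕ} (hk : 3 ≤ k) (ht : 1 ≤ t) (htk : t + 1 ≤ k)
    (hα : Fintype.card α = k + 2) (hβ : Fintype.card β ≤ k + 2) (ha : A.degree a = t)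
    (hA : ∀ x, x ≠ a → A.degree x = k)
    (hB : (Finset.univ.filter fun y => B.degree y = k).card + (k - t) = Fintype.card β)
    (hB' : (Finset.univ.filter fun y => B.degree y = k - 1).card = k - t) :
    (attach A a B {y | B.degree y = k - 1}).Connected ∧
    (∀ x, (attach A a B {y | B.degree y = k - 1}).degree x = k) ∧
    ¬ (attach A a B {y | B.degree y = k - 1}).IsHamiltonian := by
  -- The two prescribed degree classes already exhaust the vertices of `B`.
  have hdegB : ∀ y, B.degree y = k ∨ B.degree y = k - 1 := by
    have hdis : Disjoint (Finset.univ.filter fun y => B.degree y = k)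
        (Finset.univ.filter fun y => B.degree y = k - 1) := by
      rw [Finset.disjoint_left]
      intro y h1 h2
      simp only [Finset.mem_filter, Finset.mem_univ, true_and] at h1 h2
      omega
    have := Finset.eq_univ_of_card _
      ((Finset.card_union_of_disjoint hdis).trans (by rw [hB', hB]))
    intro y
    simpa using Finset.ext_iff.1 this y
  obtain ⟨y, hy⟩ : (Finset.univ.filter fun y => B.degree y = k - 1).Nonempty :=
    Finset.card_pos.1 (by omega)
  obtain ⟨b, hb⟩ : (A.neighborFinset a).Nonempty := Finset.card_pos.1 (by
    rw [SimpleGraph.card_neighborFinset_eq_degree]; omega)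
  rw [SimpleGraph.mem_neighborFinset] at hb
  have hAc : A.Connected := by
    rw [SimpleGraph.connected_iff_exists_forall_reachable]
    refine ⟨b, fun x => ?_⟩
    by_cases hx : x = a
    · exact hx ▸ hb.symm.reachable
    · exact reachable_of_card_le (hA b hb.ne').ge (hA x hx).ge (by omega)
  have hBc : B.Connected := by
    rw [SimpleGraph.connected_iff_exists_forall_reachable]
    refine ⟨y, fun x => reachable_of_card_le (d := k - 1) ?_ ?_ (by omega)⟩
    · have := hdegB y; omega
    · have := hdegB x; omega
  refine ⟨connected_attach hAc hBc ⟨y, by simpa using hy⟩, ?_, ?_⟩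
  · rintro (x | x)
    · by_cases hx : x = a
      · subst hx
        rw [degree_attach_inl_self, ha]
        simp only [Set.mem_ofPred_eq, hB']
        omega
      · rw [degree_attach_inl hx, hA x hx]
    · rw [degree_attach_inr]
      have := hdegB x
      simp only [Set.mem_ofPred_eq]
      split_ifs <;> omega
  · exact separation_attach.not_isHamiltonian ⟨Sum.inl b, by simpa using hb.ne'⟩
      ⟨Sum.inr y, by simp⟩

end Attach

section Families

variable {V : Type*} [Fintype V] [DecidableEq V] {G : SimpleGraph V} [DecidableRel G.Adj]

theorem InFamilyF.spec {r : ℕ} (h : InFamilyF r G) : G.Connected ∧ G.IsRegularOfDegree (2 * r) ∧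
    Fintype.card V = 2 * (2 * r) + 3 ∧ ¬ G.IsHamiltonian := by
  classical
  obtain ⟨t, -, ht2, htr, A, a, B, ⟨ha, hA⟩, ⟨hB, hB'⟩, ⟨e⟩⟩ := h
  obtain ⟨h1, h2, h3⟩ := attach_spec (k := 2 * r) (t := t) (by omega) (by omega) (by omega)
    (by simp) (by simp) ha hA (by rw [hB, Fintype.card_fin]; omega) hB'
  refine ⟨e.connected_iff.2 h1, fun x => (degree_eq_of_iso e x).trans (h2 _), ?_,
    fun hG => h3 (hG.of_iso e)⟩
  rw [Fintype.card_congr e.toEquiv, Fintype.card_sum, Fintype.card_fin, Fintype.card_fin]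
  omega

theorem InFamilyH.spec {r : ℕ} (h : InFamilyH r G) :
    G.Connected ∧ G.IsRegularOfDegree (2 * r + 1) ∧
    Fintype.card V = 2 * (2 * r + 1) + 4 ∧ ¬ G.IsHamiltonian := by
  classical
  obtain ⟨t, -, ht2, htr, A, a, B, ⟨ha, hA⟩, ⟨hB, hB'⟩, ⟨e⟩⟩ := h
  obtain ⟨h1, h2, h3⟩ := attach_spec (k := 2 * r + 1) (t := t) (by omega) (by omega) (by omega)
    (by simp) (by simp) ha hA (by rw [hB, Fintype.card_fin]; omega) hB'
  refine ⟨e.connected_iff.2 h1, fun x => (degree_eq_of_iso e x).trans (h2 _), ?_,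
    fun hG => h3 (hG.of_iso e)⟩
  rw [Fintype.card_congr e.toEquiv, Fintype.card_sum, Fintype.card_fin]
  omega

end Families

/-! ### Classification of the non-Hamiltonian graphs -/

section Classification

variable {V : Type*} [Fintype V] [DecidableEq V] {G : SimpleGraph V} [DecidableRel G.Adj] {k : ℕ}

theorem exists_separation_of_not_noCutVertex (hconn : G.Connected)
    (hreg : G.IsRegularOfDegree k) (h : ¬ NoCutVertex G) : ∃ v S T, Separation G v S T ∧
      k < S.card ∧ S.card ≤ T.card ∧ S.card + T.card + 1 = Fintype.card V ∧
      0 < (G.neighborFinset v ∩ S).card ∧ 0 < (G.neighborFinset v ∩ T).card := by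
  obtain ⟨v, S, T, hST, hS, hT⟩ := exists_separation h
  have h1 := (hST.lt_card hconn hreg hT).resolve_right hS.ne_empty
  have h2 := (hST.symm.lt_card hconn hreg hS).resolve_right hT.ne_empty
  have h3 := Finset.card_pos.2 (hST.exists_adj hconn hS)
  have h4 := Finset.card_pos.2 (hST.symm.exists_adj hconn hT)
  rcases le_total S.card T.card with hle | hle
  · exact ⟨v, S, T, hST, h1, hle, hST.card_add_card, h3, h4⟩
  · exact ⟨v, T, S, hST.symm, h2, hle, hST.symm.card_add_card, h4, h3⟩

theorem isHamiltonian_of_card_le (hk : 2 ≤ k) (hconn : G.Connected)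
    (hreg : G.IsRegularOfDegree k) (hn : Fintype.card V ≤ 2 * k + 2) : G.IsHamiltonian := by
  by_contra hham
  rcases hk.eq_or_lt with rfl | hk3
  · exact hham (isHamiltonian_of_isRegularOfDegree_two hconn hreg)
  by_cases h2 : NoCutVertex G
  · have := nonempty_iso_petersen_of_noCutVertex hk3 hconn hreg hham h2 (by omega) (by omega)
    omega
  · obtain ⟨v, S, T, -, h1, h2, h3, -⟩ := exists_separation_of_not_noCutVertex hconn hreg h2
    omega

theorem inFamilyF_of_not_isHamiltonian {r : ℕ} (hr : 1 ≤ r) (hconn : G.Connected)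
    (hreg : G.IsRegularOfDegree (2 * r)) (hn : Fintype.card V = 2 * (2 * r) + 3)
    (hham : ¬ G.IsHamiltonian) : InFamilyF r G := by
  rcases hr.eq_or_lt with rfl | hr2
  · exact absurd (isHamiltonian_of_isRegularOfDegree_two hconn hreg) hham
  by_cases h2 : NoCutVertex G
  · have := nonempty_iso_petersen_of_noCutVertex (by omega) hconn hreg hham h2 (by omega)
      (by omega)
    omega
  · obtain ⟨v, S, T, hST, h1, h2, h3, h4, h5⟩ :=
      exists_separation_of_not_noCutVertex hconn hreg h2
    have hsum := hST.card_inter_add_card_inter hreg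
    have heven : Even (G.neighborFinset v ∩ S).card := by
      have := hST.even_add hreg
      rw [Nat.even_add, Nat.even_mul] at this
      exact this.1 (Or.inr (even_two_mul r))
    have ht : 2 ≤ (G.neighborFinset v ∩ S).card := by obtain ⟨m, hm⟩ := heven; omega
    -- Not all of the `2 * r` edges at `v` go to `S`, and the number that do is even; hence the
    -- bound `2 * r - 2`.
    have ht' : (G.neighborFinset v ∩ S).card ≤ 2 * r - 2 := by obtain ⟨m, hm⟩ := heven; omega
    obtain ⟨A, a, B, ha, hA, hB, hB', he⟩ := hST.exists_iso_attach hreg (by omega)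
      (N := 2 * r + 2) (M := 2 * r + 1) (by omega) (by omega)
    exact ⟨_, heven, ht, ht', A, a, B, ⟨ha, hA⟩, ⟨by omega, by omega⟩, he⟩

theorem inFamilyH_of_not_isHamiltonian {r : ℕ} (hr : 1 ≤ r) (hconn : G.Connected)
    (hreg : G.IsRegularOfDegree (2 * r + 1)) (hn : Fintype.card V = 2 * (2 * r + 1) + 4)
    (hham : ¬ G.IsHamiltonian) :
    InFamilyH r G ∨ 2 * r + 1 = 3 ∧ Nonempty (G ≃g petersen) := by
  by_cases h2 : NoCutVertex G
  · have := nonempty_iso_petersen_of_noCutVertex (by omega) hconn hreg hham h2 (by omega)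
      (fun _ => odd_two_mul_add_one r)
    exact Or.inr ⟨this.1, this.2.2⟩
  · obtain ⟨v, S, T, hST, h1, h2, h3, h4, h5⟩ :=
      exists_separation_of_not_noCutVertex hconn hreg h2
    have hsum := hST.card_inter_add_card_inter hreg
    -- The smaller side has `k + 1` vertices and the larger one `k + 2`. As `k` is odd, it is the
    -- even order of `S` that makes the number of edges from `v` to `S` even.
    have hS : S.card = 2 * r + 2 := by omega
    have heven : Even (G.neighborFinset v ∩ S).card := by
      have := hST.even_add hreg
      rw [Nat.even_add, Nat.even_mul] at this
      exact this.1 (Or.inl (hS ▸ ⟨r + 1, by ring⟩))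
    have ht : 2 ≤ (G.neighborFinset v ∩ S).card := by obtain ⟨m, hm⟩ := heven; omega
    have ht' : (G.neighborFinset v ∩ S).card ≤ 2 * r := by obtain ⟨m, hm⟩ := heven; omega
    obtain ⟨A, a, B, ha, hA, hB, hB', he⟩ := hST.exists_iso_attach hreg (by omega)
      (N := 2 * r + 3) (M := 2 * r + 3) (by omega) (by omega)
    exact Or.inl ⟨_, heven, ht, ht', A, a, B, ⟨ha, hA⟩, ⟨by omega, hB'.trans (by omega)⟩, he⟩

end Classification

/-! ### Non-Hamiltonicity from girth five -/

section Girth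

variable {V : Type*} [Fintype V] [DecidableEq V] {G : SimpleGraph V}

theorem exists_cycFun_ten_of_isHamiltonian (hham : G.IsHamiltonian) (hn : Fintype.card V = 10) :
    ∃ f : ZMod 10 → V, CycFun G f := by
  obtain ⟨a, p, hp⟩ := hham (by omega)
  have hlen := hp.length_eq.trans hn
  refine ⟨fun i => p.getVert i.val, ?_, ?_⟩
  · intro i j hij
    have hi := ZMod.val_lt i
    have hj := ZMod.val_lt j
    exact ZMod.val_injective 10 (hp.isCycle.getVert_injOn' (by simp; omega) (by simp; omega) hij)
  · intro i
    have hstep : ∀ i : ZMod 10, i.val < 10 ∧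
        ((i + 1).val = i.val + 1 ∨ (i.val + 1 = 10 ∧ (i + 1).val = 0)) := by decide
    obtain ⟨hi, hs | ⟨hs, hs'⟩⟩ := hstep i
    · simp only [hs]
      exact p.adj_getVert_succ (by omega)
    · have := p.adj_getVert_succ (i := i.val) (by omega)
      have e : p.getVert (i.val + 1) = p.getVert 0 := by
        rw [hs, ← hlen, p.getVert_length, p.getVert_zero]
      simp only [hs']
      rwa [e] at this

/-- A graph on ten vertices of minimum degree three without cycles of length three or four
is not Hamiltonian. -/
theorem not_isHamiltonian_of_girth [DecidableRel G.Adj] (hn : Fintype.card V = 10)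
    (hdeg : ∀ x, 3 ≤ G.degree x) (h3 : ∀ x y z, G.Adj x y → G.Adj y z → ¬ G.Adj z x)
    (h4 : ∀ x y z w, x ≠ z → y ≠ w → G.Adj x y → G.Adj y z → G.Adj z w → ¬ G.Adj w x) :
    ¬ G.IsHamiltonian := by
  intro hham
  obtain ⟨f, hf⟩ := exists_cycFun_ten_of_isHamiltonian hham hn
  have hsurj : Function.Surjective f := ((Fintype.bijective_iff_injective_and_card f).2
    ⟨hf.1, by rw [ZMod.card, hn]⟩).2
  -- Chords that span two or three steps would close a triangle or a four-cycle.
  have hchord : ∀ f : ZMod 10 → V, CycFun G f → Function.Surjective f → ∀ i,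
      G.Adj (f i) (f (i + 4)) ∨ G.Adj (f i) (f (i + 5)) ∨ G.Adj (f i) (f (i + 6)) := by
    intro f hf hsurj i
    obtain ⟨x, hx, hx'⟩ := Finset.exists_mem_notMem_of_card_lt_card
      (s := {f (i + 1), f (i + 9)}) (t := G.neighborFinset (f i))
      ((Finset.card_le_two).trans_lt (by
        rw [SimpleGraph.card_neighborFinset_eq_degree]; exact hdeg _))
    obtain ⟨j, rfl⟩ := hsurj x
    rw [SimpleGraph.mem_neighborFinset] at hx
    simp only [Finset.mem_insert, Finset.mem_singleton, not_or] at hx'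
    have hcases : ∀ i j : ZMod 10, j = i ∨ j = i + 1 ∨ j = i + 1 + 1 ∨ j = i + 1 + 1 + 1 ∨
        j = i + 4 ∨ j = i + 5 ∨ j = i + 6 ∨ i = j + 1 + 1 + 1 ∨ i = j + 1 + 1 ∨
          j = i + 9 := by decide
    have hne : ∀ i j, i ≠ j → f i ≠ f j := fun i j => hf.1.ne
    have h2 : ∀ i : ZMod 10, i ≠ i + 1 + 1 := by decide
    rcases hcases i j with rfl | rfl | rfl | rfl | rfl | rfl | rfl | rfl | rfl | rfl
    · exact absurd hx G.irrefl
    · exact absurd rfl hx'.1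
    · exact absurd hx.symm (h3 _ _ _ (hf.2 _) (hf.2 _))
    · exact absurd hx.symm (h4 _ _ _ _ (hne _ _ (h2 _)) (hne _ _ (h2 _))
        (hf.2 _) (hf.2 _) (hf.2 _))
    · exact Or.inl hx
    · exact Or.inr (Or.inl hx)
    · exact Or.inr (Or.inr hx)
    · exact absurd hx (h4 _ _ _ _ (hne _ _ (h2 _)) (hne _ _ (h2 _))
        (hf.2 _) (hf.2 _) (hf.2 _))
    · exact absurd hx (h3 _ _ _ (hf.2 _) (hf.2 _))
    · exact absurd rfl hx'.2
  -- Given the chord from `0` to `4`, the chord at `5` ends at `9`, `0` or `1`; each choice closes a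
  -- cycle of length at most four with the path `0, 4, 5`.
  have hno4 : ∀ f : ZMod 10 → V, CycFun G f → Function.Surjective f → ¬ G.Adj (f 0) (f 4) := by
    intro f hf hsurj h04
    have h45 : G.Adj (f 4) (f 5) := hf.2 4
    have hne : ∀ i j, i ≠ j → f i ≠ f j := fun i j => hf.1.ne
    rcases hchord f hf hsurj 5 with h | h | h
    · exact h4 (f 0) (f 4) (f 5) (f 9) (hne _ _ (by decide)) (hne _ _ (by decide)) h04 h45 h
        (hf.2 9)
    · exact h3 (f 0) (f 4) (f 5) h04 h45 h
    · exact h4 (f 0) (f 4) (f 5) (f 1) (hne _ _ (by decide)) (hne _ _ (by decide)) h04 h45 h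
        (hf.2 0).symm
  have h5 : ∀ i, G.Adj (f i) (f (i + 5)) := by
    intro i
    rcases hchord f hf hsurj i with h | h | h
    · refine absurd ?_ (hno4 (fun j => f (i + j)) (hf.shift i) fun x => ?_)
      · simpa using h
      · obtain ⟨j, rfl⟩ := hsurj x
        exact ⟨j - i, by simp⟩
    · exact h
    · refine absurd ?_ (hno4 (fun j => f (i + -j)) (hf.shift i).reflect fun x => ?_)
      · have : (-4 : ZMod 10) = 6 := by decide
        simpa [this] using h
      · obtain ⟨j, rfl⟩ := hsurj x
        exact ⟨i - j, by simp⟩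
  have hne : ∀ i j, i ≠ j → f i ≠ f j := fun i j => hf.1.ne
  -- All chords are diameters, and two neighbouring diameters form a four-cycle.
  exact h4 (f 0) (f 1) (f 6) (f 5) (hne _ _ (by decide)) (hne _ _ (by decide)) (hf.2 0) (h5 1)
    (hf.2 5).symm (h5 0).symm

end Girth

/-! ### Properties of the Petersen graph -/

section Petersen

instance : DecidableRel petersen.Adj := fun s t => inferInstanceAs (Decidable (Disjoint s.1 t.1))

theorem card_petersen : Fintype.card {s : Finset (Fin 5) // s.card = 2} = 10 := by
  decide +kernel

theorem petersen_isRegularOfDegree : petersen.IsRegularOfDegree 3 := by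
  unfold SimpleGraph.IsRegularOfDegree
  decide +kernel

theorem petersen_connected : petersen.Connected := by
  have key : ∀ x y, x = y ∨ petersen.Adj x y ∨ ∃ z, petersen.Adj x z ∧ petersen.Adj z y := by
    decide +kernel
  have : Nonempty {s : Finset (Fin 5) // s.card = 2} := ⟨⟨{0, 1}, rfl⟩⟩
  refine ⟨fun x y => ?_⟩
  rcases key x y with rfl | h | ⟨z, h, h'⟩
  · exact SimpleGraph.Reachable.refl x
  · exact h.reachable
  · exact h.reachable.trans h'.reachable

theorem petersen_not_isHamiltonian : ¬ petersen.IsHamiltonian := by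
  have key3 : ∀ x y, petersen.Adj x y → ∀ z, petersen.Adj y z → ¬ petersen.Adj z x := by
    decide +kernel
  have key4 : ∀ x y, petersen.Adj x y → ∀ z, petersen.Adj y z → x ≠ z → ∀ w, petersen.Adj z w →
      y ≠ w → ¬ petersen.Adj w x := by
    decide +kernel
  exact not_isHamiltonian_of_girth card_petersen (fun x => (petersen_isRegularOfDegree x).ge)
    (fun x y z hxy hyz => key3 x y hxy z hyz)
    (fun x y z w hxz hyw hxy hyz hzw => key4 x y hxy z hyz hxz w hzw hyw)

end Petersen

/-! ### Existence of the building blocks -/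

section Constructions

theorem degree_of_forall_adj_iff {N : ℕ} {A : SimpleGraph (Fin N)} {x : Fin N}
    [Fintype (A.neighborSet x)] (P : Finset (Fin N)) (h : ∀ y, A.Adj x y ↔ y ∉ P) :
    A.degree x = N - P.card := by
  rw [← SimpleGraph.card_neighborFinset_eq_degree,
    show A.neighborFinset x = Finset.univ \ P by ext y; simp [h],
    Finset.card_sdiff_of_subset (Finset.subset_univ _), Finset.card_univ, Fintype.card_fin]

theorem card_filter_le_and_lt {N a b : ℕ} (hb : b ≤ N) :
    (Finset.univ.filter fun x : Fin N => a ≤ (x : ℕ) ∧ (x : ℕ) < b).card = b - a := by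
  rw [← Nat.card_Ico a b]
  refine Finset.card_bij (fun x _ => (x : ℕ)) ?_ ?_ ?_
  · intro x hx
    simpa using hx
  · intro x _ y _ h
    exact Fin.ext h
  · intro x hx
    rw [Finset.mem_Ico] at hx
    exact ⟨⟨x, by omega⟩, by simpa using hx, rfl⟩

open Classical in
/-- If exactly the vertices with `a ≤ x < b` have degree `d'`, and the others degree `d`, the
vertices of these degrees are easy to count. -/
theorem card_filter_degree {N a b d d' : ℕ} {B : SimpleGraph (Fin N)} (hb : b ≤ N) (hd : d ≠ d')
    (h : ∀ x : Fin N, B.degree x = if a ≤ (x : ℕ) ∧ (x : ℕ) < b then d' else d) :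
    (Finset.univ.filter fun x => B.degree x = d).card = N - (b - a) ∧
      (Finset.univ.filter fun x => B.degree x = d').card = b - a := by
  have h1 : ∀ x, B.degree x = d' ↔ a ≤ (x : ℕ) ∧ (x : ℕ) < b := by
    intro x
    rw [h x]
    split_ifs with hx <;> simp [hx, hd]
  have h2 : ∀ x, B.degree x = d ↔ ¬ (a ≤ (x : ℕ) ∧ (x : ℕ) < b) := by
    intro x
    rw [h x]
    split_ifs with hx
    · simp [hx, hd.symm]
    · exact iff_of_true rfl hx
  simp only [h1, h2]
  have h3 := card_filter_le_and_lt (a := a) hb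
  refine ⟨?_, h3⟩
  have h4 := Finset.card_filter_add_card_filter_not (s := Finset.univ)
    (fun x : Fin N => a ≤ (x : ℕ) ∧ (x : ℕ) < b)
  rw [h3, Finset.card_univ, Fintype.card_fin] at h4
  omega

theorem exists_adj_iff_of_symmetric (N : ℕ) {R : ℕ → ℕ → Prop} (hR : ∀ x y, R x y → R y x) :
    ∃ A : SimpleGraph (Fin N), ∀ x y, A.Adj x y ↔ (x : ℕ) ≠ y ∧ R x y :=
  ⟨{ Adj := fun x y => (x : ℕ) ≠ y ∧ R x y
     symm := ⟨fun _ _ h => ⟨h.1.symm, hR _ _ h.2⟩⟩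
     loopless := ⟨fun _ h => h.1 rfl⟩ }, fun _ _ => Iff.rfl⟩

open Classical in
/-- There is a graph on `N` vertices with a vertex of degree `t` whose other vertices have
degree `N - 2`: the complement consists of a star and a perfect matching of the rest. -/
theorem exists_degree_eq {N t : ℕ} (ht : Even t) (hN : t + 1 ≤ N) :
    ∃ (A : SimpleGraph (Fin N)) (a : Fin N), A.degree a = t ∧ ∀ x, x ≠ a → A.degree x = N - 2 := by
  obtain ⟨s, rfl⟩ := ht
  -- Vertex `0` is the distinguished one, with neighbours `1, …, 2s`. These are matched in the
  -- complement as pairs `{2i-1, 2i}`; all later vertices miss `0` instead.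
  obtain ⟨A, hA⟩ := exists_adj_iff_of_symmetric N (R := fun x y => (x ≠ 0 ∨ y ≤ s + s) ∧
    (y ≠ 0 ∨ x ≤ s + s) ∧ ¬ (x ≠ 0 ∧ y ≠ 0 ∧ x ≤ s + s ∧ y ≤ s + s ∧ (x + 1) / 2 = (y + 1) / 2))
    (fun x y => by omega)
  refine ⟨A, ⟨0, by omega⟩, ?_, fun x hx => ?_⟩
  · refine (degree_of_forall_adj_iff (Finset.univ.filter fun x : Fin N => ¬ (1 ≤ (x : ℕ) ∧
      (x : ℕ) < s + s + 1)) fun y => ?_).trans ?_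
    · simp only [hA, Finset.mem_filter, Finset.mem_univ, true_and]
      omega
    · have h4 := Finset.card_filter_add_card_filter_not (s := Finset.univ)
        (fun x : Fin N => 1 ≤ (x : ℕ) ∧ (x : ℕ) < s + s + 1)
      rw [card_filter_le_and_lt hN, Finset.card_univ, Fintype.card_fin] at h4
      omega
  · have hx0 : (x : ℕ) ≠ 0 := fun e => hx (Fin.ext e)
    by_cases hxs : (x : ℕ) ≤ s + s
    · refine (degree_of_forall_adj_iff {x, ⟨if (x : ℕ) % 2 = 0 then x - 1 else x + 1, by
        split_ifs <;> omega⟩} fun y => ?_).trans ?_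
      · simp only [hA, Fin.ext_iff, Finset.mem_insert, Finset.mem_singleton]
        split_ifs <;> omega
      · rw [Finset.card_pair]
        simp only [ne_eq, Fin.ext_iff]
        split_ifs <;> omega
    · refine (degree_of_forall_adj_iff {x, ⟨0, by omega⟩} fun y => ?_).trans
        (by rw [Finset.card_pair hx])
      simp only [hA, Fin.ext_iff, Finset.mem_insert, Finset.mem_singleton]
      omega

/-- The complement of a matching is a graph `F'_{r,t}`. -/
theorem exists_isF' {r t : ℕ} (ht : Even t) (htr : t < 2 * r) : ∃ B, IsF' r t B := by
  classical
  obtain ⟨s, rfl⟩ := ht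
  obtain ⟨B, hB⟩ := exists_adj_iff_of_symmetric (2 * r + 1) (R := fun x y =>
    ¬ (x < 2 * r - (s + s) ∧ y < 2 * r - (s + s) ∧ x / 2 = y / 2)) (fun x y => by omega)
  obtain ⟨h1, h2⟩ := card_filter_degree (B := B) (a := 0) (b := 2 * r - (s + s)) (d := 2 * r)
    (d' := 2 * r - 1) (by omega) (by omega) (by
      intro x
      split_ifs with hx
      · refine (degree_of_forall_adj_iff {x, ⟨if (x : ℕ) % 2 = 0 then x + 1 else x - 1, by
          split_ifs <;> omega⟩} fun y => ?_).trans ?_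
        · simp only [hB, Fin.ext_iff, Finset.mem_insert, Finset.mem_singleton]
          split_ifs <;> omega
        · rw [Finset.card_pair]
          · omega
          · simp only [ne_eq, Fin.ext_iff]
            split_ifs <;> omega
      · refine (degree_of_forall_adj_iff {x} fun y => ?_).trans
          (by rw [Finset.card_singleton]; omega)
        simp only [hB, Fin.ext_iff, Finset.mem_singleton]
        omega)
  exact ⟨B, h1.trans (by omega), h2⟩

/-- The complement of the disjoint union of a path and a matching is a graph `H'_{r,t}`. -/
theorem exists_isH' {r t : ℕ} (ht : Even t) (htr : t ≤ 2 * r) : ∃ B, IsH' r t B := by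
  classical
  obtain ⟨m, rfl⟩ := ht
  obtain ⟨s, hs⟩ : ∃ s, s + (m + m) = 2 * r + 1 := ⟨2 * r + 1 - (m + m), by omega⟩
  -- The complement is the path `0, …, s+1`, whose `s` inner vertices lose two neighbours, and a
  -- matching of the rest. Since `s` is odd, `(x + 1) / 2` pairs the vertices from `s + 2` on
  -- without remainder.
  obtain ⟨B, hB⟩ := exists_adj_iff_of_symmetric (2 * r + 3) (R := fun x y =>
    ¬ (x ≤ s + 1 ∧ y ≤ s + 1 ∧ (x + 1 = y ∨ y + 1 = x) ∨
      s + 2 ≤ x ∧ s + 2 ≤ y ∧ (x + 1) / 2 = (y + 1) / 2)) (fun x y => by omega)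
  obtain ⟨h1, h2⟩ := card_filter_degree (B := B) (a := 1) (b := s + 1) (d := 2 * r + 1)
    (d' := 2 * r) (by omega) (by omega) (by
      intro x
      split_ifs with hx
      · refine (degree_of_forall_adj_iff {x, ⟨x - 1, by omega⟩, ⟨x + 1, by omega⟩}
          fun y => ?_).trans ?_
        · simp only [hB, Fin.ext_iff, Finset.mem_insert, Finset.mem_singleton]
          omega
        · rw [Finset.card_eq_three.2 ⟨_, _, _, ?_, ?_, ?_, rfl⟩]
          · omega
          all_goals
            simp only [ne_eq, Fin.ext_iff]
            omega
      · refine (degree_of_forall_adj_iff {x, ⟨if (x : ℕ) = 0 then 1 else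
          if (x : ℕ) = s + 1 then s else if (x : ℕ) % 2 = 0 then x - 1 else x + 1, by
            split_ifs <;> omega⟩} fun y => ?_).trans ?_
        · simp only [hB, Fin.ext_iff, Finset.mem_insert, Finset.mem_singleton]
          split_ifs <;> omega
        · rw [Finset.card_pair]
          · omega
          · simp only [ne_eq, Fin.ext_iff]
            split_ifs <;> omega)
  exact ⟨B, h1.trans (by omega), h2.trans (by omega)⟩

theorem exists_isF {r t : ℕ} (ht : Even t) (htr : t ≤ 2 * r) : ∃ A a, IsF r t A a :=
  exists_degree_eq ht (by omega)

theorem exists_isH {r t : ℕ} (ht : Even t) (htr : t ≤ 2 * r) : ∃ A a, IsH r t A a :=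
  exists_degree_eq ht (by omega)

end Constructions

/-! ### The least non-Hamiltonian order -/

section Orders

theorem two_mul_add_three_mem_nonHamiltonianOrders {r : ℕ} (hr : 2 ≤ r) :
    2 * (2 * r) + 3 ∈ nonHamiltonianOrders (2 * r) := by
  classical
  obtain ⟨A, a, hA⟩ := exists_isF (r := r) even_two (by omega)
  obtain ⟨B, hB⟩ := exists_isF' (r := r) even_two (by omega)
  obtain ⟨e⟩ : Nonempty (Fin (2 * (2 * r) + 3) ≃ Fin (2 * r + 2) ⊕ Fin (2 * r + 1)) :=
    ⟨Fintype.equivOfCardEq (by simp; omega)⟩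
  have h : InFamilyF r ((attach A a B {y | B.degree y = 2 * r - 1}).comap e) :=
    ⟨2, even_two, le_rfl, by omega, A, a, B, hA, hB, ⟨SimpleGraph.Iso.comap e _⟩⟩
  obtain ⟨h1, h2, -, h4⟩ := h.spec
  exact ⟨_, _, h1, h2, h4⟩

theorem two_mul_add_four_mem_nonHamiltonianOrders {r : ℕ} (hr : 1 ≤ r) :
    2 * (2 * r + 1) + 4 ∈ nonHamiltonianOrders (2 * r + 1) := by
  classical
  obtain ⟨A, a, hA⟩ := exists_isH (r := r) even_two (by omega)
  obtain ⟨B, hB⟩ := exists_isH' (r := r) even_two (by omega)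
  obtain ⟨e⟩ : Nonempty (Fin (2 * (2 * r + 1) + 4) ≃ Fin (2 * r + 3) ⊕ Fin (2 * r + 3)) :=
    ⟨Fintype.equivOfCardEq (by simp; omega)⟩
  have h : InFamilyH r ((attach A a B {y | B.degree y = 2 * r}).comap e) :=
    ⟨2, even_two, le_rfl, by omega, A, a, B, hA, hB, ⟨SimpleGraph.Iso.comap e _⟩⟩
  obtain ⟨h1, h2, -, h4⟩ := h.spec
  exact ⟨_, _, h1, h2, h4⟩

/-- The parity is what excludes the order `2k+3` for odd `k`. -/
theorem lt_of_mem_nonHamiltonianOrders {k n : ℕ} (hk : 2 ≤ k) (hn : n ∈ nonHamiltonianOrders k) :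
    2 * k + 2 < n ∧ Even (n * k) := by
  obtain ⟨G, _, hconn, hreg, hham⟩ := hn
  have h1 := hreg.even_card_mul
  rw [Fintype.card_fin] at h1
  refine ⟨?_, h1⟩
  by_contra hcon
  exact hham (isHamiltonian_of_card_le hk hconn hreg (by rw [Fintype.card_fin]; omega))

end Orders

theorem theorem2p1 :
    -- connected `k`-regular graphs on at most `2k+2` vertices are Hamiltonian
    (∀ (k : ℕ), 2 ≤ k → ∀ (V : Type u) [Fintype V] [DecidableEq V] (G : SimpleGraph V)
        [DecidableRel G.Adj], G.Connected → G.IsRegularOfDegree k →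
        Fintype.card V ≤ 2 * k + 2 → G.IsHamiltonian) ∧
    -- `k = 2r` even: the non-Hamiltonian ones on `2k+3` vertices
    (∀ (k r : ℕ), 1 ≤ r → k = 2 * r → ∀ (V : Type u) [Fintype V] [DecidableEq V]
        (G : SimpleGraph V) [DecidableRel G.Adj],
        (G.Connected ∧ G.IsRegularOfDegree k ∧ Fintype.card V = 2 * k + 3 ∧ ¬ G.IsHamiltonian) ↔
          InFamilyF r G) ∧
    -- `k = 2r+1` odd: the non-Hamiltonian ones on `2k+4` vertices
    (∀ (k r : ℕ), 1 ≤ r → k = 2 * r + 1 → ∀ (V : Type u) [Fintype V] [DecidableEq V]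
        (G : SimpleGraph V) [DecidableRel G.Adj],
        (G.Connected ∧ G.IsRegularOfDegree k ∧ Fintype.card V = 2 * k + 4 ∧ ¬ G.IsHamiltonian) ↔
          (InFamilyH r G ∨ (k = 3 ∧ Nonempty (G ≃g petersen)))) ∧
    -- all the building blocks exist
    (∀ (r t : ℕ), 2 ≤ r → Even t → 2 ≤ t → t ≤ 2 * r - 2 →
        (∃ A a, IsF r t A a) ∧ ∃ B, IsF' r t B) ∧
    (∀ (r t : ℕ), 1 ≤ r → Even t → 2 ≤ t → t ≤ 2 * r →
        (∃ A a, IsH r t A a) ∧ ∃ B, IsH' r t B) ∧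
    -- sharpness: the least order of a non-Hamiltonian connected `k`-regular graph
    (∀ (k : ℕ), 4 ≤ k → Even k → IsLeast (nonHamiltonianOrders k) (2 * k + 3)) ∧
    (∀ (k : ℕ), 3 ≤ k → Odd k → IsLeast (nonHamiltonianOrders k) (2 * k + 4)) := by
  refine ⟨fun k hk V _ _ G _ hconn hreg hn => isHamiltonian_of_card_le hk hconn hreg hn,
    ?_, ?_, ?_, ?_, ?_, ?_⟩
  · rintro k r hr rfl V _ _ G _
    exact ⟨fun ⟨hconn, hreg, hn, hham⟩ => inFamilyF_of_not_isHamiltonian hr hconn hreg hn hham,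
      InFamilyF.spec⟩
  · rintro k r hr rfl V _ _ G _
    refine ⟨fun ⟨hconn, hreg, hn, hham⟩ => inFamilyH_of_not_isHamiltonian hr hconn hreg hn hham, ?_⟩
    rintro (h | ⟨hk, ⟨e⟩⟩)
    · exact h.spec
    · refine ⟨e.connected_iff.2 petersen_connected, fun x => ?_, ?_,
        fun hG => petersen_not_isHamiltonian (hG.of_iso e)⟩
      · rw [degree_eq_of_iso e x, petersen_isRegularOfDegree, hk]
      · rw [Fintype.card_congr e.toEquiv, card_petersen, hk]
  · intro r t _ ht _ htr
    exact ⟨exists_isF ht (by omega), exists_isF' ht (by omega)⟩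
  · intro r t _ ht _ htr
    exact ⟨exists_isH ht htr, exists_isH' ht htr⟩
  · rintro k hk ⟨r, rfl⟩
    rw [← two_mul] at hk ⊢
    exact ⟨two_mul_add_three_mem_nonHamiltonianOrders (by omega),
      fun n hn => (lt_of_mem_nonHamiltonianOrders (by omega) hn).1⟩
  · rintro k hk ⟨r, rfl⟩
    refine ⟨two_mul_add_four_mem_nonHamiltonianOrders (by omega), fun n hn => ?_⟩
    obtain ⟨h1, h2⟩ := lt_of_mem_nonHamiltonianOrders (by omega) hn
    obtain ⟨m, hm⟩ := (Nat.even_mul.1 h2).resolve_right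
      (Nat.not_even_iff_odd.2 (odd_two_mul_add_one r))
    omega
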